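/- **Conventions.** Fourier transforms are $\hat g(\xi)=\int_{\mathbb R} g(t)e^{-i\xi t}\,dt$, and $(\Delta x)_k=x_k-x_{k-1}$ for sequences. **Wavelets.** Let $M\ge 1$ be an integer and $\alpha>1$. Let $\phi,\psi\in L^2(\mathbb R)$ be real-valued, integrable and compactly supported functions such that $\int\phi=1$, $\int\psi^2=1$; $\sup_{\xi}|\hat\psi(\xi)|(1+|\xi|)^{\alpha}<\infty$; $\int t^m\psi(t)\,dt=0$ for $m=0,\dots,M-1$; and $t\mapsto\sum_{k\in\mathbb Z}k^m\phi(t-k)$ is (almost everywhere equal to) a polynomial of degree $m$ for $m=0,\dots,M-1$. Let $T\ge 1$ be an integer such that $\phi$ vanishes outside $(-T,0)$ and $\psi$ vanishes outside $(0,T)$. **Process.** Let $\beta\in(0,2]$, $L>0$ and $d\in((1+\beta)/2-\alpha,\,M]$. Let $f^*\in\mathcal H(\beta,L)$, that is, $f^*$ is even and nonnegative on $[-\pi,\pi]$ with $|f^*(\lambda)-f^*(0)|\le L f^*(0)|\lambda|^\beta$ for all $\lambda\in[-\pi,\pi]$, and let $f^*$ be bounded away from zero in a neighborhood of the origin (equivalently,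 $f^*(0)>0$). Let $X=(X_k)_{k\in\mathbb Z}$ be a real Gaussian process with memory parameter $d$ and generalized spectral density $|1-e^{-i\lambda}|^{-2d}f^*(\lambda)$: for every integer $K\ge0$ with $K>d-1/2$, the process $Y=\Delta^KX$ is centered and weakly stationary with spectral density $g(\lambda)=|1-e^{-i\lambda}|^{2(K-d)}f^*(\lambda)$ on $(-\pi,\pi)$, in the sense that $\mathrm{Cov}(Y_{k+h},Y_k)=\int_{-\pi}^{\pi}e^{ih\lambda}g(\lambda)\,d\lambda$. **Estimator.** For $j\ge0$ and $k\in\mathbb Z$ put $\psi_{j,k}(t)=2^{-j/2}\psi(2^{-j}t-k)$ and $W_{j,k}=\int_{\mathbb R}\big(\sum_{l\in\mathbb Z}X_l\,\phi(t-l)\big)\psi_{j,k}(t)\,dt$. For a sample size $n$ let $n_j=[2^{-j}(n-T+1)-T+1]$ (integer part) and $\hat\sigma_j^2=n_j^{-1}\sum_{k=0}^{n_j-1}W_{j,k}^2$; when $n_j\ge 1$ this depends only on $X_1,\dots,X_n$. Let $\ell\ge1$ and let $w=(w_0,\dots,w_\ell)^T\in\mathbb R^{\ell+1}$ satisfy $\sum_{i=0}^{\ell}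 w_i=0$ and $2\log(2)\sum_{i=0}^{\ell} i\,w_i=1$. For a sequence of nonnegative integers $J_0(n)$ put $$\hat d_n(w)=\sum_{i=0}^{\ell}w_i\,\log\hat\sigma^2_{J_0(n)+i}.$$ **Limit matrix.** Put $K_\psi(d)=\int_{\mathbb R}|\xi|^{-2d}|\hat\psi(\xi)|^2\,d\xi$ and, for integers $u\ge0$, $$\mathbf e_u(\xi)=2^{-u/2}\,[1,e^{-i2^{-u}\xi},\dots,e^{-i(2^u-1)2^{-u}\xi}]^T,$$ $$\mathbf D_{\infty,u}(\lambda;d)=\sum_{l\in\mathbb Z}|\lambda+2l\pi|^{-2d}\,\mathbf e_u(\lambda+2l\pi)\,\overline{\hat\psi(\lambda+2l\pi)}\,\hat\psi(2^{-u}(\lambda+2l\pi)),$$ and let $V(d)$ be the $(\ell+1)\times(\ell+1)$ matrix with entries $$V_{i,j}(d)=\frac{4\pi\,2^{2d|i-j|}\,2^{\min(i,j)}}{K_\psi(d)^2}\int_{-\pi}^{\pi}\big|\mathbf D_{\infty,|i-j|}(\lambda;d)\big|^2\,d\lambda,\qquad 0\le i,j\le\ell,$$ where $|\cdot|$ is the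 Euclidean norm. **Statement.** Suppose that $$n\,2^{-J_0(n)(1+2\beta)}+n^{-1}2^{J_0(n)}\to0\qquad(n\to\infty).$$ Then $(\hat d_n(w)-d)^2$ is integrable for all sufficiently large $n$, and $$\lim_{n\to\infty}n\,2^{-J_0(n)}\,\mathbb E\big[(\hat d_n(w)-d)^2\big]=w^TV(d)\,w .$$ -/

import Mathlib

open MeasureTheory ProbabilityTheory Filter Topology
open scoped Matrix

noncomputable section

namespace WaveletMemory

/-! Difference operator, weak stationarity and memory parameter -/

/-- First order difference `(Δ x)_k = x_k - x_{k-1}` of a doubly infinite sequence. -/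
def diff {E : Type*} [Sub E] (x : ℤ → E) : ℤ → E := fun k => x k - x (k - 1)

/-- `Y` is (real-valued) weakly stationary with spectral density `g` on `(-π, π)`, with the
normalisation `Cov(Y_{k+h}, Y_k) = ∫_{-π}^{π} e^{ihξ} g(ξ) dξ`. -/
structure HasSpectralDensity {Ω : Type*} [MeasurableSpace Ω] (P : Measure Ω)
    (Y : ℤ → Ω → ℝ) (g : ℝ → ℝ) : Prop where
  memLp : ∀ k, MemLp (Y k) 2 P
  mean_const : ∀ k, P[Y k] = P[Y 0]
  integrableOn : IntegrableOn g (Set.Ioo (-Real.pi) Real.pi)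
  cov_eq : ∀ k h : ℤ, ((cov[Y (k + h), Y k; P] : ℝ) : ℂ) =
    ∫ ξ in Set.Ioo (-Real.pi) Real.pi, Complex.exp (Complex.I * h * ξ) * (g ξ : ℂ)

/-- `X` has memory parameter `d` (is an `M(d)` process) with short-range part `fstar` of its
generalized spectral density `|1 - e^{-iξ}|^{-2d} fstar(ξ)`: for every integer `K ≥ 0` with
`K > d - 1/2` the `K`-th difference is weakly stationary with spectral density
`|1 - e^{-iξ}|^{2(K-d)} fstar(ξ)`. -/
structure HasMemoryParameter {Ω : Type*} [MeasurableSpace Ω] (P : Measure Ω)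
    (X : ℤ → Ω → ℝ) (d : ℝ) (fstar : ℝ → ℝ) : Prop where
  nonneg : ∀ ξ ∈ Set.Ioo (-Real.pi) Real.pi, 0 ≤ fstar ξ
  symm : ∀ ξ ∈ Set.Ioo (-Real.pi) Real.pi, fstar (-ξ) = fstar ξ
  bounded : ∃ C : ℝ, ∀ ξ ∈ Set.Ioo (-Real.pi) Real.pi, fstar ξ ≤ C
  bounded_away : ∃ c : ℝ, 0 < c ∧ ∀ᶠ ξ in 𝓝 (0 : ℝ), c ≤ fstar ξ
  density : ∀ K : ℕ, d - 1 / 2 < (K : ℝ) →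
    HasSpectralDensity P (diff^[K] X)
      (fun ξ => ‖1 - Complex.exp (-(Complex.I * ξ))‖ ^ (2 * ((K : ℝ) - d)) * fstar ξ)

/-- The smoothness class `H(β, L)` of even nonnegative functions on `[-π, π]`
(the values of `g` outside `[-π, π]` play no role). -/
def smoothClass (β L : ℝ) : Set (ℝ → ℝ) :=
  {g | ∀ ξ ∈ Set.Icc (-Real.pi) Real.pi,
    0 ≤ g ξ ∧ g (-ξ) = g ξ ∧ |g ξ - g 0| ≤ L * g 0 * |ξ| ^ β}

/-! Scaling function and wavelet -/

/-- Fourier transform with the convention `ĝ(ξ) = ∫ g(t) e^{-iξt} dt`. -/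
def fourier (g : ℝ → ℝ) (ξ : ℝ) : ℂ :=
  ∫ t : ℝ, (g t : ℂ) * Complex.exp (-(Complex.I * ξ * t))

/-- The standing assumptions on the scaling function `φ` and the wavelet `ψ`, with decay exponent
`α` and `M` vanishing moments. Functions in `L²` are identified up to null sets, so the polynomial
reproduction property is required almost everywhere. -/
structure WaveletAssumptions (φ ψ : ℝ → ℝ) (α : ℝ) (M : ℕ) : Prop where
  memLp_phi : MemLp φ 2 volume
  memLp_psi : MemLp ψ 2 volume
  compact_phi : HasCompactSupport φ
  compact_psi : HasCompactSupport ψ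
  integrable_phi : Integrable φ
  integrable_psi : Integrable ψ
  integral_phi : ∫ t, φ t = 1
  integral_psi_sq : ∫ t, ψ t ^ 2 = 1
  one_lt_alpha : 1 < α
  decay : ∃ C : ℝ, ∀ ξ : ℝ, ‖fourier ψ ξ‖ * (1 + |ξ|) ^ α ≤ C
  vanishing_moments : ∀ m < M, ∫ t, t ^ m * ψ t = 0
  polynomial_reproduction : ∀ m < M, ∃ p : Polynomial ℝ, p.degree = (m : WithBot ℕ) ∧
    ∀ᵐ t : ℝ, ∑' k : ℤ, (k : ℝ) ^ m * φ (t - k) = p.eval t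

/-- `ψ_{j,k}(t) = 2^{-j/2} ψ(2^{-j} t - k)`. -/
def waveletFun (ψ : ℝ → ℝ) (j : ℕ) (k : ℤ) (t : ℝ) : ℝ :=
  (2 : ℝ) ^ (-(j : ℝ) / 2) * ψ ((2 : ℝ) ^ (-(j : ℝ)) * t - k)

/-- Wavelet coefficient `W_{j,k}` of the sequence `x`:
`∫ (∑_l x_l φ(t - l)) ψ_{j,k}(t) dt`. -/
def waveletCoeff (φ ψ : ℝ → ℝ) (x : ℤ → ℝ) (j : ℕ) (k : ℤ) : ℝ :=
  ∫ t : ℝ, (∑' l : ℤ, x l * φ (t - l)) * waveletFun ψ j k t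

/-! The estimator -/

/-- Number `n_j = [2^{-j}(n - T + 1) - T + 1]` of wavelet coefficients at scale `j` that are
available from `x_1, …, x_n`. -/
def numCoeff (T n j : ℕ) : ℕ :=
  ⌊(2 : ℝ) ^ (-(j : ℝ)) * ((n : ℝ) - T + 1) - T + 1⌋₊

/-- Empirical variance `n_j⁻¹ ∑_{k=0}^{n_j - 1} W_{j,k}²` at scale `j`. -/
def empVar (φ ψ : ℝ → ℝ) (T n : ℕ) (x : ℤ → ℝ) (j : ℕ) : ℝ :=
  (numCoeff T n j : ℝ)⁻¹ *
    ∑ k ∈ Finset.range (numCoeff T n j), waveletCoeff φ ψ x j (k : ℤ) ^ 2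

/-- The log-scale regression estimator of `d` with weights `w_0, …, w_ℓ` and lowest scale `J`. -/
def dHat (φ ψ : ℝ → ℝ) (T n : ℕ) {ℓ : ℕ} (w : Fin (ℓ + 1) → ℝ) (J : ℕ) (x : ℤ → ℝ) : ℝ :=
  ∑ i : Fin (ℓ + 1), w i * Real.log (empVar φ ψ T n x (J + i))

/-! The limiting variance -/

/-- `K_ψ(d) = ∫ |ξ|^{-2d} |ψ̂(ξ)|² dξ`. -/
def Kpsi (ψ : ℝ → ℝ) (d : ℝ) : ℝ :=
  ∫ ξ : ℝ, |ξ| ^ (-2 * d) * ‖fourier ψ ξ‖ ^ 2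

/-- `e_u(ξ) = 2^{-u/2} [1, e^{-i 2^{-u} ξ}, …, e^{-i (2^u - 1) 2^{-u} ξ}]ᵀ`. -/
def eVec (u : ℕ) (ξ : ℝ) : EuclideanSpace ℂ (Fin (2 ^ u)) :=
  WithLp.toLp 2 fun v => (((2 : ℝ) ^ (-(u : ℝ) / 2) : ℝ) : ℂ) *
    Complex.exp (-(Complex.I * ((v : ℕ) : ℂ) * (((2 : ℝ) ^ (-(u : ℝ)) * ξ : ℝ) : ℂ)))

/-- `D_{∞,u}(ξ; d) = ∑_{l ∈ ℤ} |ξ + 2lπ|^{-2d} e_u(ξ + 2lπ) conj(ψ̂(ξ + 2lπ)) ψ̂(2^{-u}(ξ + 2lπ))`. -/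
def DInf (ψ : ℝ → ℝ) (u : ℕ) (d ξ : ℝ) : EuclideanSpace ℂ (Fin (2 ^ u)) :=
  ∑' l : ℤ,
    (((|ξ + 2 * l * Real.pi| ^ (-2 * d) : ℝ) : ℂ) *
      (starRingEnd ℂ) (fourier ψ (ξ + 2 * l * Real.pi)) *
      fourier ψ ((2 : ℝ) ^ (-(u : ℝ)) * (ξ + 2 * l * Real.pi))) • eVec u (ξ + 2 * l * Real.pi)

/-- The matrix `V(d)`, with entries
`4π 2^{2d|i-j|} 2^{min(i,j)} K_ψ(d)⁻² ∫_{-π}^{π} |D_{∞,|i-j|}(ξ; d)|² dξ`, `0 ≤ i, j ≤ ℓ`. -/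
def asympVar (ψ : ℝ → ℝ) (d : ℝ) (ℓ : ℕ) : Matrix (Fin (ℓ + 1)) (Fin (ℓ + 1)) ℝ :=
  Matrix.of fun i j =>
    4 * Real.pi * (2 : ℝ) ^ (2 * d * (Nat.dist i j : ℝ)) * (2 : ℝ) ^ (min (i : ℕ) (j : ℕ)) /
      Kpsi ψ d ^ 2 *
      ∫ ξ in Set.Ioo (-Real.pi) Real.pi, ‖DInf ψ (Nat.dist i j) d ξ‖ ^ 2

end WaveletMemory

end

namespace WaveletMemory

/-! ### Moments of Gaussian variables -/

/-! Let S_i be the empirical variance at scale j = J₀(n)+i divided by f*(0) 2^{2dj} K_ψ(d). The two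
linear conditions on w cancel every constant, so that almost surely the estimation error is ∑ w_i
log S_i (`dHat_sub_eq`). With r = n 2^{-J₀(n)} the theorem is then a delta method for second
moments, `tendsto_integral_sq_sum_log`: replacing log S_i by S_i - 1 costs o(1/r) in squared L²
norm, so it is enough that r Cov(S_i, S_j) → V_ij and r (E S_i - 1)² → 0. No limit in law is needed.
The replacement uses E(S - ES)⁴ = O(r⁻²), from diagonalizing a Gaussian quadratic form
(`integral_sum_sq_sub_pow_four_le`), and, against the singularity of log at 0, the crude bound E
S^{-1/4} = O(r^{1/4}), obtained by keeping a single square of the sum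
(`integral_scaled_average_rpow_le`).

For the covariances, polynomial reproduction and vanishing moments make the filter polynomials
divisible by (X - 1)^M (`exists_filterPoly_eq`). Hence the wavelet coefficients are finite filters
of the stationary process Δ^M X, and their covariances have a spectral representation
(`covariance_waveletCoeff`). By Poisson summation the normalized transfer function at scale j is
φ̂(ξ) conj ψ̂(2^j ξ) up to an aliasing error O(2^{-αj} |ξ|^M) (`exists_norm_transferFun_sub_le`).
After rescaling frequencies, the spectral kernel differs from `limitKernel` by O(2^{-βj}
(1+|ξ|)^{-(2d+2α-β)}) (`exists_norm_scaleKernel_sub_le`); the lower bound on d says exactly that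
this error is integrable.

Integrating the estimate at equal scales gives a relative bias O(2^{-βj}), and r 2^{-2βJ₀} = n
2^{-J₀(1+2β)} → 0 makes it negligible. Since the covariance of squares of centered Gaussian
variables is twice the squared covariance, Cov(S_i, S_j) is an average of squared covariances.
Sorting the locations at the finer scale by their residue modulo 2^u, with u the scale difference,
turns it into 2^u Toeplitz averages of squared Fourier coefficients. These converge to full sums of
squares (`tendsto_toeplitz_average`), and Parseval's identity for the periodized kernel identifies
the sums with the integral of |D_{∞,u}|² (`hasSum_sq_integral_limitKernel`). -/

theorem integral_rpow_mul_exp_neg_sq_half {q : ℝ} (hq : -1 < q) :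
    ∫ x in Set.Ioi (0 : ℝ), x ^ q * Real.exp (-(1 / 2) * x ^ (2 : ℝ)) =
      (1 / 2 : ℝ) ^ (-(q + 1) / 2) * (1 / 2) * Real.Gamma ((q + 1) / 2) :=
  integral_rpow_mul_exp_neg_mul_rpow (by norm_num) hq (by norm_num)

theorem integral_even_pow_gaussianReal_std (k : ℕ) :
    ∫ x, x ^ (2 * k) ∂(gaussianReal 0 1) =
      2 ^ k * Real.Gamma (k + 1 / 2) / √Real.pi := by
  rw [integral_gaussianReal_eq_integral_smul (by simp)]
  simp only [gaussianPDFReal_def, sub_zero, NNReal.coe_one, mul_one, smul_eq_mul]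
  have h1 : (fun x : ℝ => (√(2 * Real.pi))⁻¹ * Real.exp (-x ^ 2 / 2) * x ^ (2 * k)) =
      fun x => (fun y => (√(2 * Real.pi))⁻¹ * (y ^ (2 * k) * Real.exp (-y ^ 2 / 2))) |x| := by
    funext x
    have : |x| ^ (2 * k) = x ^ (2 * k) := by rw [pow_mul, sq_abs, ← pow_mul]
    change _ = (√(2 * Real.pi))⁻¹ * (|x| ^ (2 * k) * Real.exp (-|x| ^ 2 / 2))
    rw [this, sq_abs]; ring
  rw [h1, integral_comp_abs (f := fun y => (√(2 * Real.pi))⁻¹ *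
    (y ^ (2 * k) * Real.exp (-y ^ 2 / 2))), integral_const_mul]
  have h2 : ∫ x in Set.Ioi (0 : ℝ), x ^ (2 * k) * Real.exp (-x ^ 2 / 2) =
      ∫ x in Set.Ioi (0 : ℝ), x ^ ((2 * k : ℕ) : ℝ) * Real.exp (-(1 / 2) * x ^ (2 : ℝ)) := by
    refine setIntegral_congr_fun measurableSet_Ioi fun x _ => ?_
    rw [Real.rpow_natCast, show (2 : ℝ) = ((2 : ℕ) : ℝ) by norm_num, Real.rpow_natCast]
    congr 2; push_cast; ring
  rw [h2, integral_rpow_mul_exp_neg_sq_half (by linarith [(Nat.cast_nonneg (2 * k) : (0 : ℝ) ≤ _)])]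
  have h3 : ((2 * k : ℕ) : ℝ) + 1 = 2 * (k + 1 / 2) := by push_cast; ring
  rw [h3, mul_div_cancel_left₀ _ (two_ne_zero),
    show -(2 * ((k : ℝ) + 1 / 2)) / 2 = -((k : ℝ) + 1 / 2) by ring,
    Real.rpow_neg (by norm_num), ← Real.inv_rpow (by norm_num), Real.rpow_add (by norm_num)]
  norm_num
  rw [← Real.sqrt_eq_rpow]
  have := Real.sqrt_pos.2 Real.pi_pos
  field_simp

theorem integral_even_pow_gaussianReal (v : NNReal) (k : ℕ) :
    ∫ x, x ^ (2 * k) ∂(gaussianReal 0 v) =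
      (v : ℝ) ^ k * (2 ^ k * Real.Gamma (k + 1 / 2) / √Real.pi) := by
  have h := gaussianReal_map_const_mul (μ := 0) (v := 1) (√(v : ℝ))
  rw [mul_zero, mul_one] at h
  have hv : NNReal.mk (√(v : ℝ) ^ 2) (sq_nonneg _) = v := by
    ext; simp
  rw [hv] at h
  rw [← h, integral_map (by fun_prop) (by fun_prop), ← integral_even_pow_gaussianReal_std,
    ← integral_const_mul]
  congr 1 with x
  rw [mul_pow, pow_mul (√(v : ℝ)), Real.sq_sqrt v.coe_nonneg]

theorem integral_pow_four_gaussianReal (v : NNReal) :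
    ∫ x, x ^ 4 ∂(gaussianReal 0 v) = 3 * (v : ℝ) ^ 2 := by
  rw [integral_even_pow_gaussianReal v 2]
  have : Real.Gamma (((2 : ℕ) : ℝ) + 1 / 2) = 3 / 4 * √Real.pi := by
    rw [show ((2 : ℕ) : ℝ) + 1 / 2 = (1 / 2 + 1) + 1 by norm_num, Real.Gamma_add_one (by norm_num),
      Real.Gamma_add_one (by norm_num), Real.Gamma_one_half_eq]; ring
  rw [this]
  have := Real.sqrt_pos.2 Real.pi_pos
  field_simp; norm_num

theorem integral_pow_six_gaussianReal (v : NNReal) :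
    ∫ x, x ^ 6 ∂(gaussianReal 0 v) = 15 * (v : ℝ) ^ 3 := by
  rw [integral_even_pow_gaussianReal v 3]
  have : Real.Gamma (((3 : ℕ) : ℝ) + 1 / 2) = 15 / 8 * √Real.pi := by
    rw [show ((3 : ℕ) : ℝ) + 1 / 2 = ((1 / 2 + 1) + 1) + 1 by norm_num,
      Real.Gamma_add_one (by norm_num), Real.Gamma_add_one (by norm_num),
      Real.Gamma_add_one (by norm_num), Real.Gamma_one_half_eq]; ring
  rw [this]
  have := Real.sqrt_pos.2 Real.pi_pos
  field_simp; norm_num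

theorem integral_pow_eight_gaussianReal (v : NNReal) :
    ∫ x, x ^ 8 ∂(gaussianReal 0 v) = 105 * (v : ℝ) ^ 4 := by
  rw [integral_even_pow_gaussianReal v 4]
  have : Real.Gamma (((4 : ℕ) : ℝ) + 1 / 2) = 105 / 16 * √Real.pi := by
    rw [show ((4 : ℕ) : ℝ) + 1 / 2 = (((1 / 2 + 1) + 1) + 1) + 1 by norm_num,
      Real.Gamma_add_one (by norm_num), Real.Gamma_add_one (by norm_num),
      Real.Gamma_add_one (by norm_num), Real.Gamma_add_one (by norm_num),
      Real.Gamma_one_half_eq]; ring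
  rw [this]
  have := Real.sqrt_pos.2 Real.pi_pos
  field_simp; norm_num

section GaussianVariable

variable {Ω : Type*} [MeasurableSpace Ω] {P : Measure Ω}

theorem integrable_pow_of_memLp [IsFiniteMeasure P] {f : Ω → ℝ} {k : ℕ} (hf : MemLp f k P) :
    Integrable (fun ω => f ω ^ k) P :=
  (integrable_norm_iff (hf.1.pow k)).1 (by simpa using hf.integrable_norm_pow')

theorem memLp_four_of_integrable_pow {f : Ω → ℝ} (hm : AEStronglyMeasurable f P)
    (hf : Integrable (fun ω => f ω ^ 4) P) : MemLp f 4 P := by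
  rw [← integrable_norm_rpow_iff hm (by norm_num) (by norm_num)]
  refine hf.congr (ae_of_all _ fun ω => ?_)
  have : (4 : ENNReal).toReal = ((4 : ℕ) : ℝ) := by norm_num
  simp only [this, Real.rpow_natCast, Real.norm_eq_abs]
  exact (Even.pow_abs (by decide) _).symm

theorem integrable_pow_of_hasGaussianLaw {W : Ω → ℝ} (hW : HasGaussianLaw W P) (k : ℕ) :
    Integrable (fun ω => W ω ^ k) P := by
  have := hW.isProbabilityMeasure
  exact integrable_pow_of_memLp (hW.memLp (by simp))

/-- Integrating a function of a centered Gaussian variable. -/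
theorem integral_comp_of_hasGaussianLaw {W : Ω → ℝ} (hW : HasGaussianLaw W P) (h0 : P[W] = 0)
    {g : ℝ → ℝ} (hg : Measurable g) :
    ∫ ω, g (W ω) ∂P = ∫ x, g x ∂(gaussianReal 0 Var[W; P].toNNReal) := by
  have := hW.map_eq_gaussianReal
  rw [h0] at this
  rw [← this, integral_map hW.aemeasurable hg.aestronglyMeasurable]

theorem integral_pow_four_of_hasGaussianLaw {W : Ω → ℝ} (hW : HasGaussianLaw W P)
    (h0 : P[W] = 0) : ∫ ω, W ω ^ 4 ∂P = 3 * Var[W; P] ^ 2 := by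
  rw [integral_comp_of_hasGaussianLaw (g := fun x => x ^ 4) hW h0 (by fun_prop),
    integral_pow_four_gaussianReal, Real.coe_toNNReal _ (variance_nonneg _ _)]

theorem integral_sq_of_hasGaussianLaw {W : Ω → ℝ} (hW : HasGaussianLaw W P)
    (h0 : P[W] = 0) : ∫ ω, W ω ^ 2 ∂P = Var[W; P] :=
  (variance_of_integral_eq_zero hW.aemeasurable h0).symm

theorem integral_sq_sub_variance_pow_four {W : Ω → ℝ} (hW : HasGaussianLaw W P)
    (h0 : P[W] = 0) : ∫ ω, (W ω ^ 2 - Var[W; P]) ^ 4 ∂P = 60 * Var[W; P] ^ 4 := by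
  have := hW.isProbabilityMeasure
  have h6 : ∫ ω, W ω ^ 6 ∂P = 15 * Var[W; P] ^ 3 := by
    rw [integral_comp_of_hasGaussianLaw (g := fun x => x ^ 6) hW h0 (by fun_prop),
      integral_pow_six_gaussianReal, Real.coe_toNNReal _ (variance_nonneg _ _)]
  have h8 : ∫ ω, W ω ^ 8 ∂P = 105 * Var[W; P] ^ 4 := by
    rw [integral_comp_of_hasGaussianLaw (g := fun x => x ^ 8) hW h0 (by fun_prop),
      integral_pow_eight_gaussianReal, Real.coe_toNNReal _ (variance_nonneg _ _)]
  have h4 := integral_pow_four_of_hasGaussianLaw hW h0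
  have h2 := integral_sq_of_hasGaussianLaw hW h0
  set v := Var[W; P]
  have e : (fun ω => (W ω ^ 2 - v) ^ 4) = fun ω => W ω ^ 8 + (-4 * v) * W ω ^ 6 +
      (6 * v ^ 2) * W ω ^ 4 + (-4 * v ^ 3) * W ω ^ 2 + v ^ 4 := by
    funext ω; ring
  have i := fun k => integrable_pow_of_hasGaussianLaw hW k
  rw [e, integral_add, integral_add, integral_add, integral_add, integral_const_mul,
    integral_const_mul, integral_const_mul, h8, h6, h4, h2]
  · simp; ring
  · exact i 8
  · exact (i 6).const_mul _
  · exact (i 8).add ((i 6).const_mul _)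
  · exact (i 4).const_mul _
  · exact ((i 8).add ((i 6).const_mul _)).add ((i 4).const_mul _)
  · exact (i 2).const_mul _
  · exact (((i 8).add ((i 6).const_mul _)).add ((i 4).const_mul _)).add ((i 2).const_mul _)
  · exact integrable_const _

theorem integral_sq_sub_variance_sq {W : Ω → ℝ} (hW : HasGaussianLaw W P)
    (h0 : P[W] = 0) : ∫ ω, (W ω ^ 2 - Var[W; P]) ^ 2 ∂P = 2 * Var[W; P] ^ 2 := by
  have := hW.isProbabilityMeasure
  have h4 := integral_pow_four_of_hasGaussianLaw hW h0
  have h2 := integral_sq_of_hasGaussianLaw hW h0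
  set v := Var[W; P]
  have e : (fun ω => (W ω ^ 2 - v) ^ 2) = fun ω => W ω ^ 4 + (-2 * v) * W ω ^ 2 + v ^ 2 := by
    funext ω; ring
  have i := fun k => integrable_pow_of_hasGaussianLaw hW k
  rw [e, integral_add, integral_add, integral_const_mul, h4, h2]
  · simp; ring
  · exact i 4
  · exact (i 2).const_mul _
  · exact (i 4).add ((i 2).const_mul _)
  · exact integrable_const _

/-- The covariance of squares of jointly Gaussian centered variables. -/
theorem covariance_sq_of_hasGaussianLaw {W Z : Ω → ℝ}
    (hWZ : HasGaussianLaw (fun ω => (W ω, Z ω)) P) (hW0 : P[W] = 0) (hZ0 : P[Z] = 0) :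
    cov[fun ω => W ω ^ 2, fun ω => Z ω ^ 2; P] = 2 * cov[W, Z; P] ^ 2 := by
  have := hWZ.isProbabilityMeasure
  have hW := hWZ.fst
  have hZ := hWZ.snd
  have hA := hWZ.add
  have hS := hWZ.sub
  have iW := hW.integrable
  have iZ := hZ.integrable
  have hA0 : P[W + Z] = 0 := by simp [integral_add iW iZ, hW0, hZ0]
  have hS0 : P[W - Z] = 0 := by simp [integral_sub iW iZ, hW0, hZ0]
  have mW := hW.memLp_two
  have mZ := hZ.memLp_two
  have eA := integral_pow_four_of_hasGaussianLaw hA hA0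
  have eS := integral_pow_four_of_hasGaussianLaw hS hS0
  have eW := integral_pow_four_of_hasGaussianLaw hW hW0
  have eZ := integral_pow_four_of_hasGaussianLaw hZ hZ0
  rw [variance_add mW mZ] at eA
  rw [variance_sub mW mZ] at eS
  have i4A := integrable_pow_of_hasGaussianLaw hA 4
  have i4S := integrable_pow_of_hasGaussianLaw hS 4
  have i4W := integrable_pow_of_hasGaussianLaw hW 4
  have i4Z := integrable_pow_of_hasGaussianLaw hZ 4
  -- Polarization, 12 W²Z² = (W+Z)⁴ + (W-Z)⁴ - 2W⁴ - 2Z⁴, reduces the mixed moment to fourth moments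
  -- of single Gaussian variables.
  have key : ∫ ω, W ω ^ 2 * Z ω ^ 2 ∂P = Var[W; P] * Var[Z; P] + 2 * cov[W, Z; P] ^ 2 := by
    have e : (fun ω => W ω ^ 2 * Z ω ^ 2) = fun ω => (1 / 12 : ℝ) * ((W + Z) ω ^ 4 +
        (W - Z) ω ^ 4 + ((-2 : ℝ) * W ω ^ 4 + (-2 : ℝ) * Z ω ^ 4)) := by
      funext ω; simp only [Pi.add_apply, Pi.sub_apply]; ring
    have j1 : Integrable (fun ω => (W + Z) ω ^ 4 + (W - Z) ω ^ 4) P := i4A.add i4S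
    have j2 : Integrable (fun ω => (-2 : ℝ) * W ω ^ 4 + (-2 : ℝ) * Z ω ^ 4) P :=
      (i4W.const_mul _).add (i4Z.const_mul _)
    rw [e, integral_const_mul, integral_add j1 j2, integral_add i4A i4S,
      integral_add (i4W.const_mul _) (i4Z.const_mul _), integral_const_mul, integral_const_mul,
      eA, eS, eW, eZ]
    ring
  have m4W : MemLp (fun ω => W ω ^ 2) 2 P :=
    (memLp_two_iff_integrable_sq (integrable_pow_of_hasGaussianLaw hW 2).1).2
      (by simpa only [← pow_mul] using i4W)
  have m4Z : MemLp (fun ω => Z ω ^ 2) 2 P :=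
    (memLp_two_iff_integrable_sq (integrable_pow_of_hasGaussianLaw hZ 2).1).2
      (by simpa only [← pow_mul] using i4Z)
  rw [covariance_eq_sub m4W m4Z, integral_sq_of_hasGaussianLaw hW hW0,
    integral_sq_of_hasGaussianLaw hZ hZ0]
  simp only [Pi.mul_apply, key]
  ring

/-- Moment of order `-1/2` of a centered Gaussian variable. -/
theorem integrable_abs_rpow_neg_half_of_hasGaussianLaw {W : Ω → ℝ} (hW : HasGaussianLaw W P)
    (h0 : P[W] = 0) {c : ℝ} (hc : 0 < c) (hv : c ≤ Var[W; P]) :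
    Integrable (fun ω => |W ω| ^ (-(1 / 2) : ℝ)) P ∧
      ∫ ω, |W ω| ^ (-(1 / 2) : ℝ) ∂P ≤ 1 + (√(2 * Real.pi * c))⁻¹ *
        ∫ x in Set.Ioc (-1 : ℝ) 1, |x| ^ (-(1 / 2) : ℝ) := by
  have hmap := hW.map_eq_gaussianReal
  rw [h0] at hmap
  set v := Var[W; P].toNNReal with hvdef
  have hvc : (v : ℝ) = Var[W; P] := Real.coe_toNNReal _ (variance_nonneg _ _)
  have hv0 : v ≠ 0 := by
    intro h; rw [h] at hvc; simp at hvc; linarith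
  have hmeas : Measurable (fun x : ℝ => |x| ^ (-(1 / 2) : ℝ)) := by fun_prop
  have hloc : IntegrableOn (fun x : ℝ => |x| ^ (-(1 / 2) : ℝ)) (Set.Ioc (-1) 1) := by
    have h := (intervalIntegral.intervalIntegrable_rpow' (a := 0) (b := 1)
      (r := (-(1 / 2) : ℝ)) (by norm_num))
    have h1 : IntegrableOn (fun x : ℝ => |x| ^ (-(1 / 2) : ℝ)) (Set.Ioc 0 1) := by
      refine ((intervalIntegrable_iff_integrableOn_Ioc_of_le (by norm_num)).1 h).congr_fun
        (fun x hx => by simp [abs_of_pos hx.1]) measurableSet_Ioc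
    have h2 : IntegrableOn (fun x : ℝ => |x| ^ (-(1 / 2) : ℝ)) (Set.Ico (-1) 0) := by
      have := (integrableOn_Ioc_iff_integrableOn_Ioo).1 h1
      have h3 := (this.comp_neg)
      simp only [abs_neg, Set.neg_Ioo, neg_zero] at h3
      exact (integrableOn_Ico_iff_integrableOn_Ioo).2 h3
    have h3 : IntegrableOn (fun x : ℝ => |x| ^ (-(1 / 2) : ℝ)) (Set.Icc (-1) 0) :=
      (integrableOn_Icc_iff_integrableOn_Ico).2 h2
    have h4 := h3.union h1
    refine h4.mono_set fun x hx => ?_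
    rcases le_or_gt x 0 with h | h
    · exact Or.inl ⟨hx.1.le, h⟩
    · exact Or.inr ⟨h, hx.2⟩
  have hpt : ∀ x : ℝ, gaussianPDFReal 0 v x ≤ (√(2 * Real.pi * c))⁻¹ := by
    intro x
    rw [gaussianPDFReal_def]
    calc _ ≤ (√(2 * Real.pi * v))⁻¹ * 1 := by
          refine mul_le_mul_of_nonneg_left ?_ (by positivity)
          rw [Real.exp_le_one_iff]
          apply div_nonpos_of_nonpos_of_nonneg
          · nlinarith [sq_nonneg (x - 0)]
          · positivity
      _ ≤ _ := by
          rw [mul_one]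
          have hcv : c ≤ (v : ℝ) := hvc ▸ hv
          have hpos : 0 < √(2 * Real.pi * c) := Real.sqrt_pos.2 (by positivity)
          exact inv_anti₀ hpos (Real.sqrt_le_sqrt (by gcongr))
  -- Near 0 the density is replaced by its supremum, which only involves the lower bound c on the
  -- variance; for |x| ≥ 1 the power is at most 1.
  have hdom : ∀ x : ℝ, gaussianPDFReal 0 v x * |x| ^ (-(1 / 2) : ℝ) ≤
      gaussianPDFReal 0 v x + (√(2 * Real.pi * c))⁻¹ *
        (Set.Ioc (-1 : ℝ) 1).indicator (fun x => |x| ^ (-(1 / 2) : ℝ)) x := by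
    intro x
    have p0 := gaussianPDFReal_nonneg 0 v x
    by_cases hx : x ∈ Set.Ioc (-1 : ℝ) 1
    · rw [Set.indicator_of_mem hx]
      have : 0 ≤ |x| ^ (-(1 / 2) : ℝ) := by positivity
      nlinarith [hpt x]
    · rw [Set.indicator_of_notMem hx, mul_zero, add_zero]
      have hx1 : 1 ≤ |x| := by
        by_contra h
        push Not at h
        rw [abs_lt] at h
        exact hx ⟨h.1, h.2.le⟩
      have := Real.rpow_le_one_of_one_le_of_nonpos hx1 (show (-(1 / 2) : ℝ) ≤ 0 by norm_num)
      nlinarith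
  have hI2 : Integrable (fun x : ℝ => gaussianPDFReal 0 v x + (√(2 * Real.pi * c))⁻¹ *
        (Set.Ioc (-1 : ℝ) 1).indicator (fun x => |x| ^ (-(1 / 2) : ℝ)) x) :=
    (integrable_gaussianPDFReal 0 v).add
      ((hloc.integrable_indicator measurableSet_Ioc).const_mul _)
  have hI1 : Integrable (fun x : ℝ => gaussianPDFReal 0 v x * |x| ^ (-(1 / 2) : ℝ)) := by
    refine hI2.mono' (by fun_prop) (ae_of_all _ fun x => ?_)
    rw [Real.norm_of_nonneg (mul_nonneg (gaussianPDFReal_nonneg 0 v x) (by positivity))]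
    exact hdom x
  have hG : Integrable (fun x : ℝ => |x| ^ (-(1 / 2) : ℝ)) (gaussianReal 0 v) := by
    rw [gaussianReal_of_var_ne_zero 0 hv0, integrable_withDensity_iff (by fun_prop)
      (ae_of_all _ fun x => gaussianPDF_lt_top)]
    refine hI1.congr (ae_of_all _ fun x => ?_)
    simp only [toReal_gaussianPDF]
    ring
  constructor
  · rw [← hmap] at hG
    exact (integrable_map_measure hmeas.aestronglyMeasurable hW.aemeasurable).1 hG
  · rw [integral_comp_of_hasGaussianLaw (g := fun x => |x| ^ (-(1 / 2) : ℝ)) hW h0 hmeas,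
      ← hvdef, integral_gaussianReal_eq_integral_smul hv0]
    refine (integral_mono hI1 hI2 hdom).trans_eq ?_
    rw [integral_add (integrable_gaussianPDFReal 0 v)
      ((hloc.integrable_indicator measurableSet_Ioc).const_mul _), integral_const_mul,
      integral_indicator measurableSet_Ioc, integral_gaussianPDFReal_eq_one 0 hv0]


/-- Fourth moment of a finite sum of independent centered variables. -/
theorem integral_sum_pow_four_le {ι : Type*} {ξ : ι → Ω → ℝ} (hind : iIndepFun ξ P)
    (hm : ∀ i, AEMeasurable (ξ i) P) (hL : ∀ i, MemLp (ξ i) 4 P) (h0 : ∀ i, ∫ ω, ξ i ω ∂P = 0)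
    (v : ι → ℝ) (h2 : ∀ i, ∫ ω, ξ i ω ^ 2 ∂P = v i) (h4 : ∀ i, ∫ ω, ξ i ω ^ 4 ∂P ≤ 15 * v i ^ 2)
    (s : Finset ι) :
    ∫ ω, (∑ i ∈ s, ξ i ω) ^ 4 ∂P ≤ 15 * (∑ i ∈ s, v i) ^ 2 ∧
      ∫ ω, (∑ i ∈ s, ξ i ω) ^ 2 ∂P = ∑ i ∈ s, v i := by
  classical
  have := hind.isProbabilityMeasure
  have hv0 : ∀ i, 0 ≤ v i := fun i => h2 i ▸ integral_nonneg fun ω => sq_nonneg _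
  induction s using Finset.induction_on with
  | empty => simp
  | insert a s ha ih =>
    set A : Ω → ℝ := fun ω => ∑ i ∈ s, ξ i ω with hA
    have hAL : MemLp A 4 P := memLp_finsetSum s fun i _ => hL i
    have hIp : ∀ k : ℕ, k ≤ 4 → Integrable (fun ω => A ω ^ k) P := fun k hk =>
      integrable_pow_of_memLp (hAL.mono_exponent (by exact_mod_cast hk))
    have hIq : ∀ k : ℕ, k ≤ 4 → Integrable (fun ω => ξ a ω ^ k) P := fun k hk =>
      integrable_pow_of_memLp ((hL a).mono_exponent (by exact_mod_cast hk))
    have hindA : IndepFun A (ξ a) P := by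
      have := hind.indepFun_finsetSum_of_notMem₀ hm ha
      convert this using 1
      ext ω; simp [hA]
    have hindp : ∀ k l : ℕ, IndepFun (fun ω => A ω ^ k) (fun ω => ξ a ω ^ l) P := fun k l =>
      hindA.comp (φ := fun x => x ^ k) (ψ := fun x => x ^ l) (by fun_prop) (by fun_prop)
    have hprod : ∀ k l : ℕ, ∫ ω, A ω ^ k * ξ a ω ^ l ∂P =
        (∫ ω, A ω ^ k ∂P) * ∫ ω, ξ a ω ^ l ∂P := fun k l =>
      (hindp k l).integral_fun_mul_eq_mul_integral (hAL.1.pow k)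
        ((hm a).pow_const l).aestronglyMeasurable
    have hIprod : ∀ k l : ℕ, k ≤ 4 → l ≤ 4 → Integrable (fun ω => A ω ^ k * ξ a ω ^ l) P :=
      fun k l hk hl => (hindp k l).integrable_mul (hIp k hk) (hIq l hl)
    have hA1 : ∫ ω, A ω ∂P = 0 := by
      rw [hA, integral_finsetSum _ fun i _ => (hL i).integrable (by norm_num)]
      exact Finset.sum_eq_zero fun i _ => h0 i
    obtain ⟨ih4, ih2⟩ := ih
    change ∫ ω, A ω ^ 4 ∂P ≤ _ at ih4
    change ∫ ω, A ω ^ 2 ∂P = _ at ih2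
    have e4 : ∀ ω, (∑ i ∈ insert a s, ξ i ω) ^ 4 = A ω ^ 4 * ξ a ω ^ 0 + (4 * (A ω ^ 3 * ξ a ω ^ 1)
        + (6 * (A ω ^ 2 * ξ a ω ^ 2) + (4 * (A ω ^ 1 * ξ a ω ^ 3) + A ω ^ 0 * ξ a ω ^ 4))) := by
      intro ω; rw [Finset.sum_insert ha]; simp only [hA]; ring
    have e2 : ∀ ω, (∑ i ∈ insert a s, ξ i ω) ^ 2 = A ω ^ 2 * ξ a ω ^ 0 + (2 * (A ω ^ 1 * ξ a ω ^ 1)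
        + A ω ^ 0 * ξ a ω ^ 2) := by
      intro ω; rw [Finset.sum_insert ha]; simp only [hA]; ring
    have i1 := hIprod 4 0 (by norm_num) (by norm_num)
    have i2 := (hIprod 3 1 (by norm_num) (by norm_num)).const_mul 4
    have i3 := (hIprod 2 2 (by norm_num) (by norm_num)).const_mul 6
    have i4 := (hIprod 1 3 (by norm_num) (by norm_num)).const_mul 4
    have i5 := hIprod 0 4 (by norm_num) (by norm_num)
    have j1 := hIprod 2 0 (by norm_num) (by norm_num)
    have j2 := (hIprod 1 1 (by norm_num) (by norm_num)).const_mul 2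
    have j3 := hIprod 0 2 (by norm_num) (by norm_num)
    have k4 : Integrable (fun ω => 4 * (A ω ^ 1 * ξ a ω ^ 3) + A ω ^ 0 * ξ a ω ^ 4) P := i4.add i5
    have k3 : Integrable (fun ω => 6 * (A ω ^ 2 * ξ a ω ^ 2) +
      (4 * (A ω ^ 1 * ξ a ω ^ 3) + A ω ^ 0 * ξ a ω ^ 4)) P := i3.add k4
    have k2 : Integrable (fun ω => 4 * (A ω ^ 3 * ξ a ω ^ 1) + (6 * (A ω ^ 2 * ξ a ω ^ 2) +
      (4 * (A ω ^ 1 * ξ a ω ^ 3) + A ω ^ 0 * ξ a ω ^ 4))) P := i2.add k3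
    have k1 : Integrable (fun ω => 2 * (A ω ^ 1 * ξ a ω ^ 1) + A ω ^ 0 * ξ a ω ^ 2) P := j2.add j3
    have hV := Finset.sum_nonneg fun i (_ : i ∈ s) => hv0 i
    constructor
    · simp only [e4]
      rw [integral_add i1 k2, integral_add i2 k3, integral_add i3 k4, integral_add i4 i5,
        integral_const_mul, integral_const_mul, integral_const_mul, hprod, hprod, hprod, hprod,
        hprod, Finset.sum_insert ha]
      simp only [pow_zero, pow_one, hA1, h0, h2, ih2, integral_const, probReal_univ, smul_eq_mul,
        mul_zero, zero_mul, mul_one, one_mul]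
      -- The terms with a first power of a centered factor have vanished, and 15V² + 6Vv + 15v² ≤
      -- 15(V + v)² closes the induction.
      nlinarith [h4 a, mul_nonneg (hv0 a) hV]
    · simp only [e2]
      rw [integral_add j1 k1, integral_add j2 j3, integral_const_mul, hprod, hprod, hprod,
        Finset.sum_insert ha]
      simp only [pow_zero, pow_one, hA1, h0, h2, ih2, integral_const, probReal_univ, smul_eq_mul,
        mul_zero, mul_one, one_mul]
      ring

/-- Fourth central moment of the squared norm of a centered Gaussian vector. -/
theorem integral_sum_sq_sub_pow_four_le {ι : Type*} [Fintype ι] {W : ι → Ω → ℝ}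
    (hW : HasGaussianLaw (fun ω => (W · ω)) P) (h0 : ∀ i, P[W i] = 0) :
    ∫ ω, (∑ i, W i ω ^ 2 - ∑ i, Var[W i; P]) ^ 4 ∂P ≤
      60 * (∑ i, ∑ j, cov[W i, W j; P] ^ 2) ^ 2 := by
  classical
  have := hW.isProbabilityMeasure
  set S : Matrix ι ι ℝ := Matrix.of fun i j => cov[W i, W j; P] with hS
  have hSH : S.IsHermitian := by
    ext i j; simp [hS, covariance_comm (W i)]
  set U : Matrix ι ι ℝ := (hSH.eigenvectorUnitary : Matrix ι ι ℝ) with hU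
  have hUU : Uᵀ * U = 1 := by
    have := Unitary.coe_star_mul_self hSH.eigenvectorUnitary
    simpa [Matrix.star_eq_conjTranspose] using this
  have hUU' : U * Uᵀ = 1 := by
    have := Unitary.coe_mul_star_self hSH.eigenvectorUnitary
    simpa [Matrix.star_eq_conjTranspose] using this
  have hdiag : Uᵀ * S * U = Matrix.diagonal hSH.eigenvalues := by
    have h := hSH.conjStarAlgAut_star_eigenvectorUnitary
    rw [Unitary.conjStarAlgAut_star_apply] at h
    simpa [Matrix.star_eq_conjTranspose, hU, Function.comp_def] using h
  -- In an orthonormal eigenbasis of the covariance matrix the coordinates are uncorrelated, hence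
  -- independent, and the squared norm is unchanged. Traces of S and S² translate the eigenvalue
  -- sums back.
  set Z : ι → Ω → ℝ := fun a ω => ∑ i, U i a * W i ω with hZ
  have hZG : HasGaussianLaw (fun ω => (Z · ω)) P := by
    have := hW.map (Matrix.toLin' Uᵀ).toContinuousLinearMap
    have e : (fun ω => (Z · ω)) =
        (Matrix.toLin' Uᵀ).toContinuousLinearMap ∘ fun ω => (W · ω) := by
      funext ω a
      simp [hZ, Matrix.mulVec, dotProduct]
    rw [e]
    exact this
  have mW : ∀ i, MemLp (W i) 2 P := fun i => (hW.eval i).memLp_two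
  have hcov : ∀ a b, cov[Z a, Z b; P] = (Uᵀ * S * U) a b := by
    intro a b
    rw [hZ, covariance_fun_sum_fun_sum (fun i => (mW i).const_mul _) (fun i => (mW i).const_mul _)]
    simp only [covariance_const_mul_left, covariance_const_mul_right, Matrix.mul_apply,
      Matrix.transpose_apply, Finset.sum_mul, hS, Matrix.of_apply]
    rw [Finset.sum_comm]
    refine Finset.sum_congr rfl fun i _ => Finset.sum_congr rfl fun j _ => by ring
  have hvar : ∀ a, Var[Z a; P] = hSH.eigenvalues a := by
    intro a
    rw [← covariance_self (hZG.eval a).aemeasurable, hcov, hdiag, Matrix.diagonal_apply_eq]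
  have hZ0 : ∀ a, P[Z a] = 0 := by
    intro a
    simp only [hZ]
    rw [integral_finsetSum _ fun i _ => ((hW.eval i).integrable).const_mul _]
    simp [integral_const_mul, h0]
  have hind : iIndepFun Z P := hZG.iIndepFun_of_covariance_eq_zero fun a b hab => by
    rw [hcov, hdiag, Matrix.diagonal_apply_ne _ hab]
  have hsum : ∀ ω, ∑ i, W i ω ^ 2 = ∑ a, Z a ω ^ 2 := by
    intro ω
    have h1 : ∑ a, Z a ω ^ 2 = (Uᵀ *ᵥ fun i => W i ω) ⬝ᵥ (Uᵀ *ᵥ fun i => W i ω) := by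
      simp [dotProduct, hZ, Matrix.mulVec, pow_two]
    rw [h1, Matrix.dotProduct_mulVec, ← Matrix.mulVec_transpose, Matrix.transpose_transpose,
      Matrix.mulVec_mulVec, hUU', Matrix.one_mulVec]
    simp [dotProduct, pow_two]
  have htr : ∑ i, Var[W i; P] = ∑ a, hSH.eigenvalues a := by
    have h1 : S.trace = (Uᵀ * S * U).trace := by
      rw [Matrix.trace_mul_comm, ← Matrix.mul_assoc, hUU', Matrix.one_mul]
    rw [hdiag, Matrix.trace_diagonal] at h1
    rw [← h1]
    simp only [Matrix.trace, Matrix.diag, hS, Matrix.of_apply]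
    exact Finset.sum_congr rfl fun i _ => (covariance_self (hW.eval i).aemeasurable).symm
  have htr2 : ∑ i, ∑ j, cov[W i, W j; P] ^ 2 = ∑ a, hSH.eigenvalues a ^ 2 := by
    have h1 : (S * S).trace = (Uᵀ * S * U * (Uᵀ * S * U)).trace := by
      have : Uᵀ * S * U * (Uᵀ * S * U) = Uᵀ * (S * (U * Uᵀ) * S * U) := by
        simp only [Matrix.mul_assoc]
      rw [this, hUU', Matrix.mul_one, Matrix.trace_mul_comm Uᵀ, Matrix.mul_assoc (S * S), hUU',
        Matrix.mul_one]
    rw [hdiag, Matrix.diagonal_mul_diagonal, Matrix.trace_diagonal] at h1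
    simp only [pow_two, ← h1]
    simp only [Matrix.trace, Matrix.diag, Matrix.mul_apply, hS, Matrix.of_apply]
    exact Finset.sum_congr rfl fun i _ => Finset.sum_congr rfl fun j _ => by
      rw [covariance_comm (W j)]
  have hξind : iIndepFun (fun a ω => Z a ω ^ 2 - hSH.eigenvalues a) P :=
    hind.comp (fun a x => x ^ 2 - hSH.eigenvalues a) (fun a => by fun_prop)
  have hZm : ∀ a, AEMeasurable (fun ω => Z a ω ^ 2 - hSH.eigenvalues a) P := fun a =>
    ((hZG.eval a).aemeasurable.pow_const 2).sub_const _
  have hZ4 : ∀ a, ∫ ω, (Z a ω ^ 2 - hSH.eigenvalues a) ^ 4 ∂P = 60 * hSH.eigenvalues a ^ 4 :=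
    fun a => by
      have := integral_sq_sub_variance_pow_four (hZG.eval a) (hZ0 a)
      rwa [hvar a] at this
  have hZ2 : ∀ a, ∫ ω, (Z a ω ^ 2 - hSH.eigenvalues a) ^ 2 ∂P = 2 * hSH.eigenvalues a ^ 2 :=
    fun a => by
      have := integral_sq_sub_variance_sq (hZG.eval a) (hZ0 a)
      rwa [hvar a] at this
  have hL4 : ∀ a, MemLp (fun ω => Z a ω ^ 2 - hSH.eigenvalues a) 4 P := fun a => by
    refine MemLp.sub (memLp_four_of_integrable_pow
      ((hZG.eval a).aemeasurable.pow_const 2).aestronglyMeasurable ?_) (memLp_const _)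
    simpa only [← pow_mul] using integrable_pow_of_hasGaussianLaw (hZG.eval a) 8
  have hZ1 : ∀ a, ∫ ω, (Z a ω ^ 2 - hSH.eigenvalues a) ∂P = 0 := fun a => by
    rw [integral_sub (integrable_pow_of_hasGaussianLaw (hZG.eval a) 2) (integrable_const _),
      integral_sq_of_hasGaussianLaw (hZG.eval a) (hZ0 a), hvar a]
    simp
  -- The constant 15 is an equality here: the fourth moment 60λ⁴ is 15 times the square of the
  -- second moment 2λ².
  have := (integral_sum_pow_four_le hξind hZm hL4 hZ1 (fun a => 2 * hSH.eigenvalues a ^ 2) hZ2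
    (fun a => by rw [hZ4 a]; apply le_of_eq; ring) Finset.univ).1
  rw [htr, htr2]
  simp only [hsum, ← Finset.sum_sub_distrib]
  refine this.trans_eq ?_
  rw [← Finset.mul_sum]
  ring

end GaussianVariable

/-! ### Second order asymptotics of weighted sums of logarithms -/

/-- Away from 0 the Taylor remainder of log is quadratic, so its square is bounded by (s - 1)⁴; near
0 the squared logarithm is dominated by a small negative power of s. The free parameter q balances
the large fourth-moment term against the rough negative moment. -/
theorem sq_log_sub_le {s q : ℝ} (hs : 0 ≤ s) (hq : 1 ≤ q) :
    (Real.log s - (s - 1)) ^ 2 ≤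
      16384 * (q * (s - 1) ^ 4 + (q ^ 3)⁻¹ * s ^ (-(1 / 4) : ℝ)) := by
  have hq0 : 0 < q := by linarith
  have hneg : 0 ≤ (q ^ 3)⁻¹ * s ^ (-(1 / 4) : ℝ) := by positivity
  rcases hs.eq_or_lt with rfl | hs
  · simp only [Real.log_zero]
    nlinarith
  rcases le_or_gt (1 / 2) s with h | h
  · have h1 := Real.log_le_sub_one_of_pos hs
    have h2 := Real.one_sub_inv_le_log_of_pos hs
    have h3 : s - 1 - Real.log s ≤ 2 * (s - 1) ^ 2 := by
      have : s - 1 - (1 - s⁻¹) = (s - 1) ^ 2 * s⁻¹ := by field_simp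
      have h4 : s⁻¹ ≤ 2 := by
        rw [inv_le_comm₀ hs (by norm_num)]; linarith
      nlinarith [sq_nonneg (s - 1)]
    have h5 : (Real.log s - (s - 1)) ^ 2 ≤ (2 * (s - 1) ^ 2) ^ 2 := by
      rw [← neg_sq]
      exact pow_le_pow_left₀ (by linarith) (by linarith) 2
    have h6 : 0 ≤ (s - 1) ^ 4 := by positivity
    nlinarith
  -- The squared logarithm is at most 1024x. Either x ≤ q, or x ≤ q⁻³x⁴ with x⁴ = s^{-1/4}; in the
  -- first case q ≤ 16q(s - 1)⁴ because s < 1/2. This yields 16384 = 1024 · 16.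
  · set x := s ^ (-(1 / 16) : ℝ) with hx
    have hx0 : 0 < x := Real.rpow_pos_of_pos hs _
    have hl : (Real.log s - (s - 1)) ^ 2 ≤ 1024 * x := by
      have h1 := Real.log_le_sub_one_of_pos hs
      have h2 := Real.log_le_sub_one_of_pos (Real.rpow_pos_of_pos hs (-(1 / 32) : ℝ))
      rw [Real.log_rpow hs] at h2
      have h3 : -Real.log s ≤ 32 * s ^ (-(1 / 32) : ℝ) := by linarith
      have h4 : (s - 1) - Real.log s ≤ 32 * s ^ (-(1 / 32) : ℝ) := by linarith
      have h5 : x = (s ^ (-(1 / 32) : ℝ)) ^ 2 := by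
        rw [← Real.rpow_natCast, ← Real.rpow_mul hs.le, hx]; norm_num
      rw [h5, ← neg_sq]
      calc _ ≤ (32 * s ^ (-(1 / 32) : ℝ)) ^ 2 := pow_le_pow_left₀ (by linarith) (by linarith) 2
        _ = _ := by ring
    have hx4 : s ^ (-(1 / 4) : ℝ) = x ^ 4 := by
      rw [← Real.rpow_natCast, ← Real.rpow_mul hs.le]; norm_num
    have hxq : x ≤ (q ^ 3)⁻¹ * x ^ 4 + q := by
      rcases le_or_gt x q with h | h
      · have : 0 ≤ (q ^ 3)⁻¹ * x ^ 4 := by positivity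
        linarith
      · have h3 : q ^ 3 ≤ x ^ 3 := pow_le_pow_left₀ hq0.le h.le 3
        have : x ≤ (q ^ 3)⁻¹ * x ^ 4 := by
          rw [inv_mul_eq_div, le_div_iff₀ (by positivity)]
          nlinarith
        linarith
    have h16 : q ≤ 16 * (q * (s - 1) ^ 4) := by
      have : (1 / 2 : ℝ) ^ 4 ≤ (1 - s) ^ 4 := pow_le_pow_left₀ (by norm_num) (by linarith) 4
      have e : (1 - s) ^ 4 = (s - 1) ^ 4 := by ring
      rw [e] at this
      nlinarith
    rw [hx4] at hneg ⊢
    nlinarith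

/-- The choice δ = √b + 1/r tends to 0 while δ⁻¹b ≤ √b does too; the term 1/r only keeps δ positive
when b vanishes. -/
theorem tendsto_of_perturbation {a b c r : ℕ → ℝ} {v : ℝ}
    (ha : Tendsto a atTop (𝓝 v)) (hb : Tendsto b atTop (𝓝 0)) (hb0 : ∀ᶠ n in atTop, 0 ≤ b n)
    (hr : Tendsto r atTop atTop)
    (h : ∀ᶠ n in atTop, ∀ δ > 0, |c n - a n| ≤ δ * a n + (1 + δ⁻¹) * b n) :
    Tendsto c atTop (𝓝 v) := by
  have hδ : Tendsto (fun n => √(b n) + (r n)⁻¹) atTop (𝓝 0) := by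
    have := (Real.continuous_sqrt.tendsto 0).comp hb
    simpa using this.add hr.inv_tendsto_atTop
  have hs : Tendsto (fun n => √(b n)) atTop (𝓝 0) := by
    simpa [Function.comp_def] using (Real.continuous_sqrt.tendsto 0).comp hb
  have hbound : Tendsto (fun n => (√(b n) + (r n)⁻¹) * a n + b n + √(b n)) atTop (𝓝 0) := by
    simpa using ((hδ.mul ha).add hb).add hs
  have : Tendsto (fun n => c n - a n) atTop (𝓝 0) := by
    refine squeeze_zero_norm' ?_ hbound
    filter_upwards [h, hb0, hr.eventually_gt_atTop 0] with n hn hbn hrn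
    have hpos : 0 < √(b n) + (r n)⁻¹ := by positivity
    refine (hn _ hpos).trans ?_
    have : (√(b n) + (r n)⁻¹)⁻¹ * b n ≤ √(b n) := by
      rw [inv_mul_le_iff₀ hpos]
      have := Real.mul_self_sqrt hbn
      have : 0 ≤ (r n)⁻¹ * √(b n) := by positivity
      nlinarith
    linarith
  simpa using this.add ha

section Core

variable {Ω : Type*} [MeasurableSpace Ω] {P : Measure Ω} [IsProbabilityMeasure P]

theorem integrable_sq_log_sub_and_integral_le {S : Ω → ℝ} (hS0 : ∀ ω, 0 ≤ S ω) (hS : MemLp S 4 P)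
    (hneg : Integrable (fun ω => S ω ^ (-(1 / 4) : ℝ)) P) {q : ℝ} (hq : 1 ≤ q) :
    Integrable (fun ω => (Real.log (S ω) - (S ω - 1)) ^ 2) P ∧
      ∫ ω, (Real.log (S ω) - (S ω - 1)) ^ 2 ∂P ≤
        16384 * (q * (8 * ∫ ω, (S ω - P[S]) ^ 4 ∂P + 8 * (P[S] - 1) ^ 4) +
          (q ^ 3)⁻¹ * ∫ ω, S ω ^ (-(1 / 4) : ℝ) ∂P) := by
  set m := P[S]
  have hI4 : ∀ c : ℝ, Integrable (fun ω => (S ω - c) ^ 4) P := fun c =>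
    integrable_pow_of_memLp (k := 4) (by exact_mod_cast hS.sub (memLp_const c))
  have hI : Integrable (fun ω => 16384 * (q * (8 * (S ω - m) ^ 4 + 8 * (m - 1) ^ 4) +
      (q ^ 3)⁻¹ * S ω ^ (-(1 / 4) : ℝ))) P :=
    ((((hI4 m).const_mul 8).add (integrable_const _)).const_mul q |>.add
      (hneg.const_mul _)).const_mul _
  have hle : ∀ ω, (Real.log (S ω) - (S ω - 1)) ^ 2 ≤
      16384 * (q * (8 * (S ω - m) ^ 4 + 8 * (m - 1) ^ 4) +
      (q ^ 3)⁻¹ * S ω ^ (-(1 / 4) : ℝ)) := by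
    intro ω
    refine (sq_log_sub_le (hS0 ω) hq).trans ?_
    have : (S ω - 1) ^ 4 ≤ 8 * (S ω - m) ^ 4 + 8 * (m - 1) ^ 4 := by
      have e : S ω - 1 = (S ω - m) + (m - 1) := by ring
      have h1 := sq_nonneg ((S ω - m) - (m - 1))
      have h2 := sq_nonneg ((S ω - m) ^ 2 - (m - 1) ^ 2)
      have h3 : (S ω - 1) ^ 2 ≤ 2 * ((S ω - m) ^ 2 + (m - 1) ^ 2) := by rw [e]; nlinarith
      have h4 := pow_le_pow_left₀ (sq_nonneg _) h3 2
      nlinarith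
    gcongr
  have hm : AEStronglyMeasurable (fun ω => (Real.log (S ω) - (S ω - 1)) ^ 2) P := by
    have := hS.1.aemeasurable
    exact (((Real.measurable_log.comp_aemeasurable this).sub
      (this.sub_const 1)).pow_const 2).aestronglyMeasurable
  have hInt := hI.mono' hm (ae_of_all _ fun ω => by
    rw [Real.norm_of_nonneg (sq_nonneg _)]; exact hle ω)
  refine ⟨hInt, (integral_mono hInt hI hle).trans_eq ?_⟩
  have k1 : Integrable (fun ω => 8 * (S ω - m) ^ 4 + 8 * (m - 1) ^ 4) P :=
    ((hI4 m).const_mul 8).add (integrable_const _)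
  rw [integral_const_mul, integral_add (k1.const_mul q) (hneg.const_mul _), integral_const_mul,
    integral_const_mul, integral_add ((hI4 m).const_mul 8) (integrable_const _),
    integral_const_mul]
  simp

/-- Delta method in L²: the sum splits into the linear part A, whose second moment is explicit in
means and covariances, and the remainder B of the logarithm. The remainder satisfies r E B² → 0, and
Young's inequality with a free δ shows that the cross term does not affect the limit. -/
theorem tendsto_integral_sq_sum_log {ι : Type*} [Fintype ι] (w : ι → ℝ) (S : ℕ → ι → Ω → ℝ)
    (r : ℕ → ℝ) (hr : Tendsto r atTop atTop) (hS0 : ∀ n i ω, 0 ≤ S n i ω)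
    (hS : ∀ n i, MemLp (S n i) 4 P)
    (hmean : ∀ i, Tendsto (fun n => r n * (P[S n i] - 1) ^ 2) atTop (𝓝 0))
    (V : Matrix ι ι ℝ)
    (hcov : ∀ i j, Tendsto (fun n => r n * cov[S n i, S n j; P]) atTop (𝓝 (V i j)))
    {C : ℝ} (h4 : ∀ i, ∀ᶠ n in atTop, ∫ ω, (S n i ω - P[S n i]) ^ 4 ∂P ≤ C / r n ^ 2)
    (hneg : ∀ i, ∀ᶠ n in atTop, Integrable (fun ω => S n i ω ^ (-(1 / 4) : ℝ)) P ∧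
      ∫ ω, S n i ω ^ (-(1 / 4) : ℝ) ∂P ≤ C * √√(r n)) :
    (∀ᶠ n in atTop, Integrable (fun ω => (∑ i, w i * Real.log (S n i ω)) ^ 2) P) ∧
      Tendsto (fun n => r n * ∫ ω, (∑ i, w i * Real.log (S n i ω)) ^ 2 ∂P) atTop
        (𝓝 (w ⬝ᵥ (V *ᵥ w))) := by
  set A : ℕ → Ω → ℝ := fun n ω => ∑ i, w i * (S n i ω - 1) with hA
  set B : ℕ → Ω → ℝ := fun n ω => ∑ i, w i * (Real.log (S n i ω) - (S n i ω - 1)) with hB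
  have hAB : ∀ n ω, ∑ i, w i * Real.log (S n i ω) = A n ω + B n ω := by
    intro n ω
    simp only [hA, hB, ← Finset.sum_add_distrib]
    exact Finset.sum_congr rfl fun i _ => by ring
  have hS2 : ∀ n i, MemLp (S n i) 2 P := fun n i => (hS n i).mono_exponent (by norm_num)
  have hA2 : ∀ n, MemLp (A n) 2 P := fun n =>
    memLp_finsetSum _ fun i _ => ((hS2 n i).sub (memLp_const 1)).const_mul _
  have hev : ∀ᶠ n in atTop, ∀ i, Integrable (fun ω => S n i ω ^ (-(1 / 4) : ℝ)) P :=
    eventually_all.2 fun i => (hneg i).mono fun n hn => hn.1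
  have hB2 : ∀ᶠ n in atTop, MemLp (B n) 2 P := by
    filter_upwards [hev] with n hn
    refine memLp_finsetSum _ fun i _ => MemLp.const_mul ?_ _
    have h := (integrable_sq_log_sub_and_integral_le (hS0 n i) (hS n i) (hn i) le_rfl).1
    refine (memLp_two_iff_integrable_sq ?_).2 h
    have := (hS n i).1.aemeasurable
    exact ((Real.measurable_log.comp_aemeasurable this).sub
      (this.sub_const 1)).aestronglyMeasurable
  have hrho : ∀ i, Tendsto (fun n => r n * ∫ ω, (Real.log (S n i ω) - (S n i ω - 1)) ^ 2 ∂P)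
      atTop (𝓝 0) := by
    intro i
    have hsq : Tendsto (fun n => √(r n)) atTop atTop := Real.tendsto_sqrt_atTop.comp hr
    have hsqq : Tendsto (fun n => √√(r n)) atTop atTop := Real.tendsto_sqrt_atTop.comp hsq
    have hbd : Tendsto (fun n => 16384 * ((8 * C * (√(r n))⁻¹ +
        8 * (r n * (P[S n i] - 1) ^ 2) ^ 2 * (√(r n))⁻¹) + C * (√√(r n))⁻¹)) atTop (𝓝 0) := by
      have h1 := (tendsto_inv_atTop_zero.comp hsq)
      have h2 := (tendsto_inv_atTop_zero.comp hsqq)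
      have := ((((h1.const_mul (8 * C)).add ((((hmean i).pow 2).const_mul 8).mul h1)).add
        (h2.const_mul C)).const_mul 16384)
      simpa using this
    refine squeeze_zero' ?_ ?_ hbd
    · filter_upwards [hr.eventually_ge_atTop 0] with n hn
      exact mul_nonneg hn (integral_nonneg fun ω => sq_nonneg _)
    · filter_upwards [h4 i, hneg i, hr.eventually_ge_atTop 1] with n h4n hnegn hrn
      -- With q = r^{1/2} the fourth-moment contribution r · q · r⁻² is r^{-1/2} and the
      -- negative-moment contribution r · q⁻³ · r^{1/4} is r^{-1/4}; the squared bias enters through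
      -- its fourth power in the same way.
      set q := √(r n) with hqdef
      have hq1 : 1 ≤ q := Real.one_le_sqrt.2 hrn
      have hq0 : 0 < q := by linarith
      have hrq : r n = q ^ 2 := (Real.sq_sqrt (by linarith)).symm
      set p := √q with hpdef
      have hp0 : 0 < p := Real.sqrt_pos.2 hq0
      have hqp : q = p ^ 2 := (Real.sq_sqrt hq0.le).symm
      have h := (integrable_sq_log_sub_and_integral_le (hS0 n i) (hS n i) hnegn.1 hq1).2
      calc _ ≤ r n * (16384 * (q * (8 * (C / r n ^ 2) + 8 * (P[S n i] - 1) ^ 4) +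
            (q ^ 3)⁻¹ * (C * p))) := by
            refine mul_le_mul_of_nonneg_left (h.trans ?_) (by linarith)
            gcongr
            exact hnegn.2
        _ = _ := by
            rw [hrq, hqp]
            field_simp
  have hBlim : Tendsto (fun n => r n * ∫ ω, B n ω ^ 2 ∂P) atTop (𝓝 0) := by
    have hbd : Tendsto (fun n => (∑ i, w i ^ 2) * ∑ i, (r n *
        ∫ ω, (Real.log (S n i ω) - (S n i ω - 1)) ^ 2 ∂P)) atTop (𝓝 0) := by
      have := (tendsto_finsetSum Finset.univ fun i _ => hrho i).const_mul (∑ i, w i ^ 2)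
      simpa using this
    refine squeeze_zero' ?_ ?_ hbd
    · filter_upwards [hr.eventually_ge_atTop 0] with n hn
      exact mul_nonneg hn (integral_nonneg fun ω => sq_nonneg _)
    · filter_upwards [hev, hB2, hr.eventually_ge_atTop 0] with n hn hBn hrn
      have hi := fun i =>
        (integrable_sq_log_sub_and_integral_le (hS0 n i) (hS n i) (hn i) le_rfl).1
      rw [← Finset.mul_sum, mul_left_comm]
      refine mul_le_mul_of_nonneg_left ?_ hrn
      rw [← integral_finsetSum _ fun i _ => hi i, ← integral_const_mul]
      refine integral_mono hBn.integrable_sq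
        ((integrable_finsetSum _ fun i _ => hi i).const_mul _) fun ω => ?_
      exact Finset.sum_mul_sq_le_sq_mul_sq _ _ _
  have hAlim : Tendsto (fun n => r n * ∫ ω, A n ω ^ 2 ∂P) atTop (𝓝 (w ⬝ᵥ (V *ᵥ w))) := by
    have hbb : ∀ i j, Tendsto (fun n => r n * ((P[S n i] - 1) * (P[S n j] - 1))) atTop (𝓝 0) := by
      intro i j
      have h := ((hmean i).add (hmean j))
      rw [add_zero] at h
      refine squeeze_zero_norm' ?_ h
      filter_upwards [hr.eventually_ge_atTop 0] with n hn
      rw [Real.norm_eq_abs, abs_mul, abs_of_nonneg hn, ← mul_add]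
      refine mul_le_mul_of_nonneg_left ?_ hn
      rw [abs_le]
      constructor <;> nlinarith [sq_nonneg ((P[S n i] - 1) + (P[S n j] - 1)),
        sq_nonneg ((P[S n i] - 1) - (P[S n j] - 1)), sq_nonneg (P[S n i] - 1),
        sq_nonneg (P[S n j] - 1)]
    have hE : ∀ n, r n * ∫ ω, A n ω ^ 2 ∂P = ∑ i, ∑ j, w i * w j *
        (r n * cov[S n i, S n j; P] + r n * ((P[S n i] - 1) * (P[S n j] - 1))) := by
      intro n
      have e1 : ∀ i j, ∫ ω, (S n i ω - 1) * (S n j ω - 1) ∂P =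
          cov[S n i, S n j; P] + (P[S n i] - 1) * (P[S n j] - 1) := by
        intro i j
        have hi := (hS2 n i).integrable (by norm_num)
        have hj := (hS2 n j).integrable (by norm_num)
        have hij : Integrable (fun ω => S n i ω * S n j ω) P := (hS2 n i).integrable_mul (hS2 n j)
        rw [covariance_eq_sub (hS2 n i) (hS2 n j)]
        have : ∀ ω, (S n i ω - 1) * (S n j ω - 1) = (S n i ω * S n j ω - S n i ω) -
          (S n j ω - 1) := fun ω => by ring
        simp only [this]
        have hij' : Integrable (fun ω => S n i ω * S n j ω - S n i ω) P := hij.sub hi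
        have hj' : Integrable (fun ω => S n j ω - 1) P := hj.sub (integrable_const _)
        rw [integral_sub hij' hj', integral_sub hij hi,
          integral_sub hj (integrable_const _)]
        simp only [Pi.mul_apply, integral_const, probReal_univ, smul_eq_mul]
        ring
      have hint : ∀ i j, Integrable (fun ω => w i * w j * ((S n i ω - 1) * (S n j ω - 1))) P :=
        fun i j => (((hS2 n i).sub (memLp_const 1)).integrable_mul
          ((hS2 n j).sub (memLp_const 1))).const_mul _
      have e2 : ∀ ω, A n ω ^ 2 = ∑ i, ∑ j, w i * w j * ((S n i ω - 1) * (S n j ω - 1)) := by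
        intro ω
        simp only [hA, pow_two, Finset.sum_mul_sum]
        exact Finset.sum_congr rfl fun i _ => Finset.sum_congr rfl fun j _ => by ring
      simp only [e2]
      rw [integral_finsetSum _ fun i _ => integrable_finsetSum _ fun j _ => hint i j,
        Finset.mul_sum]
      refine Finset.sum_congr rfl fun i _ => ?_
      rw [integral_finsetSum _ fun j _ => hint i j, Finset.mul_sum]
      refine Finset.sum_congr rfl fun j _ => ?_
      rw [integral_const_mul, e1]
      ring
    simp only [hE]
    have : w ⬝ᵥ (V *ᵥ w) = ∑ i, ∑ j, w i * w j * (V i j + 0) := by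
      simp only [dotProduct, Matrix.mulVec, Finset.mul_sum]
      exact Finset.sum_congr rfl fun i _ => Finset.sum_congr rfl fun j _ => by ring
    rw [this]
    exact tendsto_finsetSum _ fun i _ => tendsto_finsetSum _ fun j _ =>
      ((hcov i j).add (hbb i j)).const_mul _
  constructor
  · filter_upwards [hB2] with n hBn
    simp only [hAB]
    exact ((hA2 n).add hBn).integrable_sq
  · simp only [hAB]
    refine tendsto_of_perturbation hAlim hBlim ?_ hr ?_
    · filter_upwards [hr.eventually_ge_atTop 0] with n hn
      exact mul_nonneg hn (integral_nonneg fun ω => sq_nonneg _)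
    · filter_upwards [hB2, hr.eventually_ge_atTop 0] with n hBn hrn δ hδ
      have iA := (hA2 n).integrable_sq
      have iB := hBn.integrable_sq
      have iAB : Integrable (fun ω => (A n ω + B n ω) ^ 2) P := ((hA2 n).add hBn).integrable_sq
      have e : r n * ∫ ω, (A n ω + B n ω) ^ 2 ∂P - r n * ∫ ω, A n ω ^ 2 ∂P =
          r n * ∫ ω, ((A n ω + B n ω) ^ 2 - A n ω ^ 2) ∂P := by
        rw [integral_sub iAB iA]; ring
      have e' : δ * (r n * ∫ ω, A n ω ^ 2 ∂P) + (1 + δ⁻¹) * (r n * ∫ ω, B n ω ^ 2 ∂P) =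
          r n * ∫ ω, (δ * A n ω ^ 2 + (1 + δ⁻¹) * B n ω ^ 2) ∂P := by
        rw [integral_add (iA.const_mul _) (iB.const_mul _), integral_const_mul,
          integral_const_mul]; ring
      rw [e, e', abs_mul, abs_of_nonneg hrn]
      refine mul_le_mul_of_nonneg_left ?_ hrn
      refine abs_integral_le_integral_abs.trans (integral_mono (iAB.sub iA).abs
        ((iA.const_mul _).add (iB.const_mul _)) fun ω => ?_)
      have h1 : 0 ≤ δ * (A n ω - δ⁻¹ * B n ω) ^ 2 := by positivity
      have h2 : 0 ≤ δ * (A n ω + δ⁻¹ * B n ω) ^ 2 := by positivity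
      have e1 : δ * (A n ω - δ⁻¹ * B n ω) ^ 2 =
          δ * A n ω ^ 2 - 2 * (A n ω * B n ω) + δ⁻¹ * B n ω ^ 2 := by field_simp; ring
      have e2 : δ * (A n ω + δ⁻¹ * B n ω) ^ 2 =
          δ * A n ω ^ 2 + 2 * (A n ω * B n ω) + δ⁻¹ * B n ω ^ 2 := by field_simp; ring
      rw [e1] at h1
      rw [e2] at h2
      simp only [abs_le]
      constructor <;> nlinarith [sq_nonneg (B n ω)]

end Core

/-! ### Periodization and Parseval's identity -/

/-- Polarized Parseval identity, from the Fourier Hilbert basis of L² on the circle of length b - a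
after lifting both functions from the interval. -/
theorem hasSum_fourierCoeffOn_mul {a b : ℝ} (hab : a < b) {f g : ℝ → ℂ}
    (hf : MemLp f 2 (volume.restrict (Set.Ioc a b)))
    (hg : MemLp g 2 (volume.restrict (Set.Ioc a b))) :
    HasSum (fun k => (starRingEnd ℂ) (fourierCoeffOn hab f k) * fourierCoeffOn hab g k)
      ((b - a)⁻¹ • ∫ x in Set.Ioc a b, (starRingEnd ℂ) (f x) * g x) := by
  have hT := Fact.mk (by linarith : 0 < b - a)
  rw [← add_sub_cancel a b] at hf hg
  have h1 := hf.memLp_liftIoc.haarAddCircle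
  have h2 := hg.memLp_liftIoc.haarAddCircle
  have key := fourierBasis.hasSum_inner_mul_inner h1.toLp h2.toLp
  have e : ∀ (F : Lp ℂ 2 (@AddCircle.haarAddCircle (b - a) hT)) (k : ℤ),
      inner ℂ (fourierBasis k) F = fourierCoeff F k := fun F k => by
    rw [← fourierBasis.repr_apply_apply, fourierBasis_repr]
  convert! key using 1
  · funext k
    rw [← inner_conj_symm, e, e]
    simp [fourierCoeff_congr_ae h1.coeFn_toLp, fourierCoeff_congr_ae h2.coeFn_toLp,
      fourierCoeff_liftIoc_eq]
  · rw [← intervalIntegral.integral_of_le hab.le]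
    have hab' : ∫ x in a..b, (starRingEnd ℂ) (f x) * g x =
        ∫ x in a..(a + (b - a)), (starRingEnd ℂ) (f x) * g x := by rw [add_sub_cancel]
    rw [hab', ← AddCircle.integral_liftIoc_eq_intervalIntegral, MeasureTheory.L2.inner_def,
      ← AddCircle.integral_haarAddCircle]
    apply integral_congr_ae
    filter_upwards [h1.coeFn_toLp, h2.coeFn_toLp] with x hx hy
    rw [hx, hy, RCLike.inner_apply, mul_comm]
    rfl

theorem integral_eq_integral_tsum_add_int {E : Type*} [NormedAddCommGroup E] [NormedSpace ℝ E]
    [CompleteSpace E] {h : ℝ → E} (hh : Integrable h) :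
    ∫ x in Set.Ioc (0 : ℝ) 1, ∑' l : ℤ, h (x + l) = ∫ x, h x := by
  have h1 := hh.hasSum_intervalIntegral_comp_add_int
  have h2 := hh.norm.hasSum_intervalIntegral_comp_add_int
  simp only [intervalIntegral.integral_of_le zero_le_one] at h1 h2
  have hi : ∀ l : ℤ, Integrable (fun x => h (x + l)) (volume.restrict (Set.Ioc 0 1)) := fun l =>
    (hh.comp_add_right (l : ℝ)).integrableOn
  exact (hasSum_integral_of_summable_integral_norm hi h2.summable).unique h1

/-- The integral over the line is the integral over a period of the `2π`-periodization. -/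
theorem integral_eq_integral_tsum_add_two_pi {h : ℝ → ℂ} (hh : Integrable h) :
    ∫ x in Set.Ioc (-Real.pi) Real.pi, ∑' l : ℤ, h (x + 2 * l * Real.pi) = ∫ x, h x := by
  have hpi := Real.pi_pos
  have hc : (2 * Real.pi) ≠ 0 := by positivity
  set h' : ℝ → ℂ := fun x => h (2 * Real.pi * x + -Real.pi) with hh'
  have hi' : Integrable h' := (hh.comp_add_right (-Real.pi)).comp_mul_left' hc
  have k2 := integral_eq_integral_tsum_add_int hi'
  set G : ℝ → ℂ := fun x => ∑' l : ℤ, h (x + 2 * l * Real.pi) with hG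
  have eG : (fun x => ∑' l : ℤ, h' (x + l)) = fun x => G (2 * Real.pi * x + -Real.pi) := by
    funext x
    simp only [hh', hG]
    congr 1 with l
    congr 1; ring
  rw [eG] at k2
  have e3 : ∫ x, h' x = (2 * Real.pi)⁻¹ • ∫ x, h x := by
    have := Measure.integral_comp_mul_left (fun y => h (y + -Real.pi)) (2 * Real.pi)
    rw [integral_add_right_eq_self (fun y => h y)] at this
    rw [← abs_of_pos (show 0 < (2 * Real.pi)⁻¹ by positivity)]
    exact this
  rw [← intervalIntegral.integral_of_le (by norm_num),
    intervalIntegral.integral_comp_mul_add _ hc, e3] at k2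
  have := smul_right_injective ℂ (inv_ne_zero hc) k2
  rw [← intervalIntegral.integral_of_le (by linarith), ← this]
  congr 1 <;> ring

theorem aestronglyMeasurable_tsum_int {μ : Measure ℝ} {E : Type*} [NormedAddCommGroup E]
    {F : ℤ → ℝ → E} (hF : ∀ l, AEStronglyMeasurable (F l) μ)
    (hs : ∀ᵐ x ∂μ, Summable fun l => F l x) :
    AEStronglyMeasurable (fun x => ∑' l, F l x) μ := by
  refine aestronglyMeasurable_of_tendsto_ae (atTop : Filter (Finset ℤ))
    (f := fun s x => ∑ l ∈ s, F l x)
    (fun s => Finset.aestronglyMeasurable_fun_sum s fun l _ => hF l) ?_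
  filter_upwards [hs] with x hx using hx.hasSum

/-- A Poisson summation formula for compactly supported square integrable functions. -/
theorem hasSum_integral_mul_integral_exp {f g : ℝ → ℂ} {R : ℕ}
    (hf : MemLp f 2) (hg : MemLp g 2) (hf1 : Integrable f) (hg1 : Integrable g)
    (hfs : ∀ t, f t ≠ 0 → |t| ≤ R) (hgs : ∀ t, g t ≠ 0 → |t| ≤ R)
    (s : Finset ℤ) (hs : ∀ m : ℤ, ∀ t : ℝ, f (t + m) ≠ 0 → g t ≠ 0 → m ∈ s) :
    HasSum (fun k : ℤ => (starRingEnd ℂ) (∫ t, f t * Complex.exp (-(2 * Real.pi * Complex.I * k * t))) *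
        ∫ t, g t * Complex.exp (-(2 * Real.pi * Complex.I * k * t)))
      (∑ m ∈ s, ∫ t, (starRingEnd ℂ) (f (t + m)) * g t) := by
  have coeff : ∀ (f : ℝ → ℂ) (_ : Integrable f) (k : ℤ),
      fourierCoeffOn zero_lt_one (fun x => ∑' l : ℤ, f (x + l)) k =
        ∫ t, f t * Complex.exp (-(2 * Real.pi * Complex.I * k * t)) := by
    intro f hf1 k
    have hexp : Continuous fun t : ℝ => Complex.exp (-(2 * Real.pi * Complex.I * k * t)) := by
      fun_prop
    have hfe : Integrable fun t => f t * Complex.exp (-(2 * Real.pi * Complex.I * k * t)) := by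
      refine hf1.mul_bdd (c := 1) hexp.aestronglyMeasurable (ae_of_all _ fun t => ?_)
      rw [show -(2 * Real.pi * Complex.I * k * t) = ((-(2 * Real.pi * k * t) : ℝ) : ℂ) * Complex.I by
        push_cast; ring, Complex.norm_exp_ofReal_mul_I]
    rw [fourierCoeffOn_eq_integral, ← integral_eq_integral_tsum_add_int hfe,
      intervalIntegral.integral_of_le zero_le_one]
    simp only [sub_zero, div_one, one_smul]
    refine setIntegral_congr_fun measurableSet_Ioc fun x _ => ?_
    simp only [smul_eq_mul]
    rw [← tsum_mul_left]
    congr 1 with l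
    rw [mul_comm, fourier_coe_apply]
    congr 1
    rw [Complex.exp_eq_exp_iff_exists_int]
    refine ⟨k * l, ?_⟩
    push_cast
    ring
  -- Bounded support makes the periodization a fixed finite sum on the unit interval, which places
  -- it in L².
  have fin : ∀ (f : ℝ → ℂ) (_ : ∀ t, f t ≠ 0 → |t| ≤ R) (x : ℝ), x ∈ Set.Ioc (0 : ℝ) 1 →
      ∑' l : ℤ, f (x + l) = ∑ l ∈ Finset.Icc (-(R : ℤ) - 1) R, f (x + l) := by
    intro f hfs x hx
    refine tsum_eq_sum fun l hl => ?_
    by_contra h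
    have := abs_le.1 (hfs _ h)
    apply hl
    rw [Finset.mem_Icc]
    have h1 : -(R : ℝ) - 1 ≤ l := by linarith [hx.2]
    have h2 : (l : ℝ) ≤ R := by linarith [hx.1]
    constructor
    · exact_mod_cast h1
    · exact_mod_cast h2
  have memL : ∀ (f : ℝ → ℂ) (_ : MemLp f 2) (_ : ∀ t, f t ≠ 0 → |t| ≤ R),
      MemLp (fun x => ∑' l : ℤ, f (x + l)) 2 (volume.restrict (Set.Ioc (0 : ℝ) 1)) := by
    intro f hf hfs
    have : MemLp (fun x => ∑ l ∈ Finset.Icc (-(R : ℤ) - 1) R, f (x + l)) 2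
        (volume.restrict (Set.Ioc (0 : ℝ) 1)) := by
      refine memLp_finsetSum _ fun l _ => MemLp.restrict _ ?_
      exact hf.comp_measurePreserving (measurePreserving_add_right volume (l : ℝ))
    refine this.ae_eq ?_
    filter_upwards [ae_restrict_mem measurableSet_Ioc] with x hx
    exact (fin f hfs x hx).symm
  have key := hasSum_fourierCoeffOn_mul zero_lt_one (memL f hf hfs) (memL g hg hgs)
  simp only [coeff f hf1, coeff g hg1] at key
  convert key using 1
  -- Unfolding: p is 1-periodic, so only the periodization of g is unrolled to the line; on the
  -- support of g the series p reduces to the shifts in s.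
  set p : ℝ → ℂ := fun x => ∑' l : ℤ, f (x + l) with hp
  have per : ∀ (x : ℝ) (l : ℤ), p (x + l) = p x := by
    intro x l
    simp only [hp]
    rw [← (Equiv.addLeft l).tsum_eq (fun m : ℤ => f (x + m))]
    congr 1 with m
    simp [add_assoc]
  have hpt : ∀ t, (starRingEnd ℂ) (p t) * g t = ∑ m ∈ s, (starRingEnd ℂ) (f (t + m)) * g t := by
    intro t
    by_cases hgt : g t = 0
    · simp [hgt]
    · rw [← Finset.sum_mul, ← map_sum]
      congr 2
      refine tsum_eq_sum fun m hm => ?_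
      by_contra h
      exact hm (hs m t h hgt)
  have hint : ∀ m : ℤ, Integrable fun t => (starRingEnd ℂ) (f (t + m)) * g t := by
    intro m
    have : MemLp (fun t => (starRingEnd ℂ) (f (t + m))) 2 :=
      (hf.comp_measurePreserving (measurePreserving_add_right volume (m : ℝ))).star
    exact this.integrable_mul hg
  have hI : Integrable fun t => (starRingEnd ℂ) (p t) * g t := by
    simp only [hpt]
    exact integrable_finsetSum _ fun m _ => hint m
  have h1 := integral_eq_integral_tsum_add_int hI
  simp only [per, tsum_mul_left] at h1
  rw [sub_zero, inv_one, one_smul, h1]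
  simp only [hpt]
  rw [integral_finsetSum _ fun m _ => hint m]

/-! ### Fourier transforms of the scaling function and of the wavelet -/

theorem norm_exp_neg_I_mul (x y : ℝ) : ‖Complex.exp (-(Complex.I * x * y))‖ = 1 := by
  rw [show -(Complex.I * x * y) = ((-(x * y) : ℝ) : ℂ) * Complex.I by push_cast; ring,
    Complex.norm_exp_ofReal_mul_I]

theorem integrable_mul_exp_neg {f : ℝ → ℂ} (hf : Integrable f) (ξ : ℝ) :
    Integrable fun t : ℝ => f t * Complex.exp (-(Complex.I * ξ * t)) :=
  hf.mul_bdd (c := 1) (by fun_prop) (ae_of_all _ fun t => (norm_exp_neg_I_mul ξ t).le)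

theorem integrable_mul_pow_of_bounded_support {f : ℝ → ℂ} (hf : Integrable f) {T : ℝ}
    (hs : ∀ t, f t ≠ 0 → |t| ≤ T) (m : ℕ) : Integrable fun t : ℝ => f t * (t : ℂ) ^ m := by
  have h1 : Integrable fun t : ℝ => f t * (if |t| ≤ T then (t : ℂ) ^ m else 0) := by
    refine hf.mul_bdd (c := |T| ^ m) ?_ (ae_of_all _ fun t => ?_)
    · refine (Measurable.ite ?_ (by fun_prop) measurable_const).aestronglyMeasurable
      exact measurableSet_le (by fun_prop) measurable_const
    · split_ifs with h
      · simp only [norm_pow, Complex.norm_real, Real.norm_eq_abs]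
        exact pow_le_pow_left₀ (abs_nonneg _) (h.trans (le_abs_self T)) m
      · simp only [norm_zero]; positivity
  refine h1.congr (ae_of_all _ fun t => ?_)
  by_cases h : f t = 0
  · simp [h]
  · simp [hs t h]

/-- Vanishing moments allow the Taylor polynomial of degree below M to be subtracted from the
exponential for free; the Taylor remainder is bounded on the support. -/
theorem norm_integral_mul_exp_le {f : ℝ → ℂ} (hf : Integrable f) {T : ℝ}
    (hs : ∀ t, f t ≠ 0 → |t| ≤ T) {M : ℕ} (hm : ∀ m < M, ∫ t, f t * (t : ℂ) ^ m = 0) (ξ : ℝ) :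
    ‖∫ t, f t * Complex.exp (-(Complex.I * ξ * t))‖ ≤
      (T * |ξ|) ^ M * Real.exp (T * |ξ|) * ∫ t, ‖f t‖ := by
  have hmom := integrable_mul_pow_of_bounded_support hf hs
  have hpoly : ∫ t, f t * ∑ m ∈ Finset.range M, (-(Complex.I * ξ * t)) ^ m / (m.factorial : ℂ)
      = 0 := by
    have e : ∀ t : ℝ, f t * ∑ m ∈ Finset.range M, (-(Complex.I * ξ * t)) ^ m / (m.factorial : ℂ) =
        ∑ m ∈ Finset.range M, ((-(Complex.I * ξ)) ^ m / (m.factorial : ℂ)) * (f t * (t : ℂ) ^ m) := by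
      intro t
      rw [Finset.mul_sum]
      refine Finset.sum_congr rfl fun m _ => ?_
      rw [show -(Complex.I * ξ * t) = (-(Complex.I * ξ)) * t by ring, mul_pow]
      ring
    simp only [e]
    rw [integral_finsetSum _ fun m _ => (hmom m).const_mul _]
    refine Finset.sum_eq_zero fun m hmM => ?_
    rw [integral_const_mul, hm m (Finset.mem_range.1 hmM), mul_zero]
  have hpolyI : Integrable fun t : ℝ =>
      f t * ∑ m ∈ Finset.range M, (-(Complex.I * ξ * t)) ^ m / (m.factorial : ℂ) := by
    simp only [Finset.mul_sum]
    refine integrable_finsetSum _ fun m _ => ?_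
    refine ((hmom m).mul_const ((-(Complex.I * ξ)) ^ m / (m.factorial : ℂ))).congr
      (ae_of_all _ fun t => ?_)
    simp only
    rw [show -(Complex.I * ξ * t) = (-(Complex.I * ξ)) * t by ring, mul_pow]
    ring
  rw [← sub_zero (∫ t, f t * _), ← hpoly, ← integral_sub (integrable_mul_exp_neg hf ξ) hpolyI,
    ← integral_const_mul]
  refine norm_integral_le_of_norm_le (hf.norm.const_mul _) (ae_of_all _ fun t => ?_)
  rw [← mul_sub, norm_mul, mul_comm]
  by_cases h : f t = 0
  · simp [h]
  refine mul_le_mul_of_nonneg_right ?_ (norm_nonneg _)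
  refine (Complex.norm_exp_sub_sum_le_norm_mul_exp _ M).trans ?_
  have hn : ‖-(Complex.I * ξ * t)‖ ≤ T * |ξ| := by
    simp only [norm_neg, norm_mul, Complex.norm_I, one_mul, Complex.norm_real, Real.norm_eq_abs]
    rw [mul_comm]
    exact mul_le_mul_of_nonneg_right (hs t h) (abs_nonneg _)
  exact mul_le_mul (pow_le_pow_left₀ (norm_nonneg _) hn M) (Real.exp_le_exp.2 hn)
    (Real.exp_pos _).le (pow_nonneg ((norm_nonneg _).trans hn) M)

theorem fourier_eq (g : ℝ → ℝ) (ξ : ℝ) :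
    fourier g ξ = ∫ t : ℝ, (g t : ℂ) * Complex.exp (-(Complex.I * ξ * t)) := rfl

theorem norm_fourier_le (g : ℝ → ℝ) (ξ : ℝ) : ‖fourier g ξ‖ ≤ ∫ t, ‖g t‖ := by
  refine (norm_integral_le_integral_norm _).trans_eq ?_
  congr 1 with t
  rw [norm_mul, norm_exp_neg_I_mul, mul_one, Complex.norm_real]

theorem conj_fourier (g : ℝ → ℝ) (ξ : ℝ) : (starRingEnd ℂ) (fourier g ξ) = fourier g (-ξ) := by
  rw [fourier_eq, fourier_eq, ← integral_conj]
  congr 1 with t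
  rw [map_mul, Complex.conj_ofReal, ← Complex.exp_conj]
  congr 2
  simp

theorem continuous_fourier {g : ℝ → ℝ} (hg : Integrable g) : Continuous (fourier g) := by
  refine continuous_of_dominated (bound := fun t => ‖g t‖)
    (fun ξ => (integrable_mul_exp_neg hg.ofReal ξ).1)
    (fun ξ => ae_of_all _ fun t => ?_) hg.norm (ae_of_all _ fun t => by fun_prop)
  rw [norm_mul, norm_exp_neg_I_mul, mul_one, Complex.norm_real]

/-- Envelope of the Fourier transform of a wavelet. -/
noncomputable def decayEnv (M : ℕ) (α ξ : ℝ) : ℝ := min 1 |ξ| ^ M * (1 + |ξ|) ^ (-α)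

theorem decayEnv_nonneg (M : ℕ) (α ξ : ℝ) : 0 ≤ decayEnv M α ξ := by
  unfold decayEnv; positivity

section Wavelet

variable {φ ψ : ℝ → ℝ} {α : ℝ} {M : ℕ}

/-- The zero of order M at the origin comes from the vanishing moments and compact support, the
decay at infinity is assumed; the two bounds meet at |ξ| = 1. -/
theorem exists_norm_fourier_wavelet_le (hW : WaveletAssumptions φ ψ α M) {T : ℕ}
    (hψ : Function.support ψ ⊆ Set.Ioo 0 (T : ℝ)) :
    ∃ C : ℝ, 0 < C ∧ ∀ ξ, ‖fourier ψ ξ‖ ≤ C * decayEnv M α ξ := by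
  obtain ⟨C, hC⟩ := hW.decay
  have hα := hW.one_lt_alpha
  set A := (T : ℝ) ^ M * Real.exp T * ∫ t, ‖ψ t‖ with hA
  have hA0 : 0 ≤ A := by
    have : 0 ≤ ∫ t, ‖ψ t‖ := integral_nonneg fun t => norm_nonneg _
    positivity
  have hC0 : 0 ≤ C := le_trans (by positivity) (hC 0)
  refine ⟨A * 2 ^ α + C + 1, by positivity, fun ξ => ?_⟩
  unfold decayEnv
  have hp : 0 < (1 + |ξ|) := by positivity
  rcases le_or_gt |ξ| 1 with h | h
  · rw [min_eq_right h]
    have h1 := norm_integral_mul_exp_le (f := fun t => (ψ t : ℂ)) (T := T) (M := M)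
      hW.integrable_psi.ofReal (fun t ht => by
        have := hψ (show ψ t ≠ 0 by simpa using ht)
        rw [abs_of_pos this.1]; exact this.2.le) (fun m hm => by
        have := hW.vanishing_moments m hm
        have e : ∀ t : ℝ, (ψ t : ℂ) * (t : ℂ) ^ m = ((t ^ m * ψ t : ℝ) : ℂ) := fun t => by
          push_cast; ring
        simp only [e]
        rw [integral_complex_ofReal, this]; simp) ξ
    rw [← fourier_eq] at h1
    refine h1.trans ?_
    have e1 : Real.exp (T * |ξ|) ≤ Real.exp T := by
      apply Real.exp_le_exp.2
      nlinarith [(Nat.cast_nonneg T : (0 : ℝ) ≤ T)]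
    have e2 : (1 : ℝ) ≤ 2 ^ α * (1 + |ξ|) ^ (-α) := by
      rw [Real.rpow_neg hp.le, ← div_eq_mul_inv, one_le_div (by positivity)]
      exact Real.rpow_le_rpow hp.le (by linarith) (by linarith)
    have hI : 0 ≤ ∫ t, ‖ψ t‖ := integral_nonneg fun t => norm_nonneg _
    simp only [Complex.norm_real]
    calc (T * |ξ|) ^ M * Real.exp (T * |ξ|) * ∫ t, ‖ψ t‖
        ≤ (T * |ξ|) ^ M * Real.exp T * ∫ t, ‖ψ t‖ := by gcongr
      _ = A * |ξ| ^ M * 1 := by rw [hA, mul_pow]; ring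
      _ ≤ A * |ξ| ^ M * (2 ^ α * (1 + |ξ|) ^ (-α)) := by gcongr
      _ = A * 2 ^ α * (|ξ| ^ M * (1 + |ξ|) ^ (-α)) := by ring
      _ ≤ _ := by gcongr; linarith
  · rw [min_eq_left h.le, one_pow, one_mul]
    have h1 := hC ξ
    rw [Real.rpow_neg hp.le, ← div_eq_mul_inv, le_div_iff₀ (by positivity)]
    refine h1.trans ?_
    have : 0 ≤ A * 2 ^ α := by positivity
    linarith

/-- The error is quadratic, not linear, because φ is real: the real part of the transform is 1 +
O(ξ²), and the imaginary part is O(ξ) but enters squared. The quadratic rate is what permits every β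
up to 2. -/
theorem exists_abs_norm_fourier_sq_sub_one_le (hW : WaveletAssumptions φ ψ α M) {T : ℕ}
    (hφ : Function.support φ ⊆ Set.Ioo (-(T : ℝ)) 0) :
    ∃ C : ℝ, 0 ≤ C ∧ ∀ ξ, |‖fourier φ ξ‖ ^ 2 - 1| ≤ C * ξ ^ 2 := by
  set A := ∫ t, ‖φ t‖ with hA
  have hA0 : 0 ≤ A := integral_nonneg fun t => norm_nonneg _
  have hI := hW.integrable_phi
  have hTb : ∀ t, φ t ≠ 0 → |t| ≤ T := fun t ht => by
    have := hφ ht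
    rw [abs_of_neg this.2]; linarith [this.1]
  refine ⟨T ^ 2 * A * (A + 1) + (T * A) ^ 2, by positivity, fun ξ => ?_⟩
  have iF := integrable_mul_exp_neg (f := fun t => (φ t : ℂ)) hI.ofReal ξ
  have iF1 : Integrable fun t => ((φ t : ℂ)) := hI.ofReal
  have e1 : fourier φ ξ - 1 = ∫ t, (φ t : ℂ) * (Complex.exp (-(Complex.I * ξ * t)) - 1) := by
    simp only [mul_sub, mul_one]
    rw [integral_sub iF iF1, ← fourier_eq, integral_complex_ofReal, hW.integral_phi]
    simp
  have iG : Integrable fun t : ℝ => (φ t : ℂ) * (Complex.exp (-(Complex.I * ξ * t)) - 1) := by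
    simp only [mul_sub, mul_one]
    exact iF.sub iF1
  have hcos : ∀ t : ℝ, Complex.exp (-(Complex.I * ξ * t)) =
      ((Real.cos (ξ * t) : ℝ) : ℂ) - (Real.sin (ξ * t) : ℝ) * Complex.I := by
    intro t
    rw [show -(Complex.I * ξ * t) = ((-(ξ * t) : ℝ) : ℂ) * Complex.I by push_cast; ring,
      Complex.exp_mul_I, ← Complex.ofReal_cos, ← Complex.ofReal_sin, Real.cos_neg, Real.sin_neg]
    push_cast; ring
  have hre : |(fourier φ ξ).re - 1| ≤ T ^ 2 * ξ ^ 2 * A := by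
    have : (fourier φ ξ).re - 1 = ∫ t, φ t * (Real.cos (ξ * t) - 1) := by
      have h := congrArg Complex.re e1
      rw [Complex.sub_re, Complex.one_re] at h
      rw [h, ← RCLike.re_eq_complex_re, ← integral_re iG]
      congr 1 with t
      rw [hcos]
      simp [-Complex.ofReal_cos, -Complex.ofReal_sin]
    rw [this, hA, ← integral_const_mul, ← Real.norm_eq_abs]
    refine norm_integral_le_of_norm_le (hI.norm.const_mul _) (ae_of_all _ fun t => ?_)
    by_cases h : φ t = 0
    · simp [h]
    rw [norm_mul, mul_comm]
    refine mul_le_mul_of_nonneg_right ?_ (norm_nonneg _)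
    have h1 := Real.one_sub_sq_div_two_le_cos (x := ξ * t)
    have h2 := Real.cos_le_one (ξ * t)
    have h3 : t ^ 2 ≤ T ^ 2 := sq_le_sq' (by linarith [abs_le.1 (hTb t h)])
      (by linarith [(abs_le.1 (hTb t h)).2])
    rw [Real.norm_eq_abs, abs_le]
    constructor <;> nlinarith [sq_nonneg ξ, sq_nonneg t]
  have him : |(fourier φ ξ).im| ≤ T * |ξ| * A := by
    have : (fourier φ ξ).im = ∫ t, -(φ t * Real.sin (ξ * t)) := by
      have h := congrArg Complex.im e1
      rw [Complex.sub_im, Complex.one_im, sub_zero] at h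
      rw [h, ← RCLike.im_eq_complex_im, ← integral_im iG]
      congr 1 with t
      rw [hcos]
      simp [-Complex.ofReal_cos, -Complex.ofReal_sin]
    rw [this, hA, ← integral_const_mul, ← Real.norm_eq_abs]
    refine norm_integral_le_of_norm_le (hI.norm.const_mul _) (ae_of_all _ fun t => ?_)
    by_cases h : φ t = 0
    · simp [h]
    rw [norm_neg, norm_mul, mul_comm]
    refine mul_le_mul_of_nonneg_right ?_ (norm_nonneg _)
    have h1 := Real.abs_sin_le_abs (x := ξ * t)
    rw [Real.norm_eq_abs]
    refine h1.trans ?_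
    rw [abs_mul, mul_comm]
    exact mul_le_mul_of_nonneg_right (hTb t h) (abs_nonneg _)
  have hle := (Complex.abs_re_le_norm _).trans (norm_fourier_le φ ξ)
  rw [← hA] at hle
  rw [Complex.sq_norm, Complex.normSq_apply]
  set x := (fourier φ ξ).re
  set y := (fourier φ ξ).im
  have h1 : |x * x - 1| ≤ T ^ 2 * ξ ^ 2 * A * (A + 1) := by
    rw [show x * x - 1 = (x - 1) * (x + 1) by ring, abs_mul]
    exact mul_le_mul hre ((abs_add_le _ _).trans (by simpa using hle)) (abs_nonneg _)
      (by positivity)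
  have h2 : y * y ≤ (T * A) ^ 2 * ξ ^ 2 := by
    rw [← abs_mul_abs_self]
    calc |y| * |y| ≤ (T * |ξ| * A) * (T * |ξ| * A) :=
          mul_le_mul him him (abs_nonneg _) (by positivity)
      _ = (T * A) ^ 2 * |ξ| ^ 2 := by ring
      _ = _ := by rw [sq_abs]
  rw [show x * x + y * y - 1 = (x * x - 1) + y * y by ring]
  refine (abs_add_le _ _).trans ?_
  rw [abs_of_nonneg (mul_self_nonneg y)]
  nlinarith

/-- The moments of the modulated scaling function at the dual lattice vanish. -/
theorem integral_mul_exp_mul_pow_eq_zero (hW : WaveletAssumptions φ ψ α M) {T : ℕ}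
    (hφ : Function.support φ ⊆ Set.Ioo (-(T : ℝ)) 0) {m : ℕ} (hm : m < M) {k : ℤ} (hk : k ≠ 0) :
    ∫ t : ℝ, (φ t : ℂ) * Complex.exp (2 * Real.pi * Complex.I * k * t) * (t : ℂ) ^ m = 0 := by
  choose p _ hp using fun m : Fin M => hW.polynomial_reproduction m m.2
  have hfin : ∀ (t : ℝ) (l : ℤ), l ∉ Finset.Icc ⌊t⌋ ⌈t + T⌉ → φ (t - l) = 0 := by
    intro t l hl
    by_contra h
    have := hφ h
    apply hl
    rw [Finset.mem_Icc]
    constructor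
    · have : t < l := by linarith [this.2]
      exact_mod_cast ((Int.floor_le t).trans this.le)
    · have : (l : ℝ) < t + T := by linarith [this.1]
      exact_mod_cast (this.le.trans (Int.le_ceil _))
  -- Binomial expansion and polynomial reproduction make Q almost everywhere a polynomial. Being
  -- 1-periodic, it is constant, so its nonzero Fourier coefficients, which are the moments in
  -- question, vanish.
  set Q : ℝ → ℝ := fun t => ∑' l : ℤ, (t - l) ^ m * φ (t - l) with hQ
  set q : Polynomial ℝ := ∑ b : Fin (m + 1), Polynomial.C ((-1) ^ (m - b) * (m.choose b : ℝ)) *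
    Polynomial.X ^ (b : ℕ) * p ⟨m - b, by omega⟩ with hq
  have hQq : ∀ᵐ t : ℝ, Q t = q.eval t := by
    filter_upwards [ae_all_iff.2 hp] with t ht
    have h1 : ∀ b : ℕ, ∑' l : ℤ, (l : ℝ) ^ b * φ (t - l) =
        ∑ l ∈ Finset.Icc ⌊t⌋ ⌈t + T⌉, (l : ℝ) ^ b * φ (t - l) := fun b =>
      tsum_eq_sum fun l hl => by rw [hfin t l hl, mul_zero]
    have h2 : Q t = ∑ l ∈ Finset.Icc ⌊t⌋ ⌈t + T⌉, (t - l) ^ m * φ (t - l) :=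
      tsum_eq_sum fun l hl => by rw [hfin t l hl, mul_zero]
    rw [h2, hq, Polynomial.eval_finsetSum]
    simp only [Polynomial.eval_mul, Polynomial.eval_C, Polynomial.eval_pow, Polynomial.eval_X,
      ← ht, h1, Finset.mul_sum]
    rw [Finset.sum_comm]
    refine Finset.sum_congr rfl fun l _ => ?_
    rw [sub_eq_add_neg, add_pow, Finset.sum_mul, Finset.sum_range]
    refine Finset.sum_congr rfl fun b _ => ?_
    rw [neg_pow (l : ℝ)]
    simp only [← sub_eq_add_neg]
    ring
  have hper : ∀ t, Q (t + 1) = Q t := by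
    intro t
    simp only [hQ]
    rw [← (Equiv.addRight (1 : ℤ)).tsum_eq (fun l : ℤ => (t + 1 - l) ^ m * φ (t + 1 - l))]
    congr 1 with l
    simp
  have hqper : ∀ t, q.eval (t + 1) = q.eval t := by
    have h1 : ∀ᵐ t : ℝ, Q (t + 1) = q.eval (t + 1) :=
      (measurePreserving_add_right volume (1 : ℝ)).quasiMeasurePreserving.ae hQq
    have h2 : (fun t : ℝ => q.eval (t + 1)) =ᵐ[volume] fun t => q.eval t := by
      filter_upwards [hQq, h1] with t a b
      rw [← a, ← b, hper]
    -- Reproduction is only known almost everywhere; continuity of polynomials upgrades periodicity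
    -- to every point.
    exact fun t => congrFun ((Continuous.ae_eq_iff_eq volume (by fun_prop) (by fun_prop)).1 h2) t
  have hqn : ∀ n : ℕ, q.eval (n : ℝ) = q.eval 0 := by
    intro n
    induction n with
    | zero => simp
    | succ n ih => rw [Nat.cast_succ, hqper, ih]
  have hqC : q = Polynomial.C (q.eval 0) := by
    refine Polynomial.eq_of_infinite_eval_eq _ _ ((Set.infinite_range_of_injective
      (Nat.cast_injective (R := ℝ))).mono ?_)
    rintro _ ⟨n, rfl⟩
    simp [hqn n]
  have hQc : ∀ᵐ t : ℝ, Q t = q.eval 0 := by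
    filter_upwards [hQq] with t ht
    rw [ht, hqC]; simp
  set h : ℝ → ℂ := fun t => (φ t : ℂ) * Complex.exp (2 * Real.pi * Complex.I * k * t) * (t : ℂ) ^ m
    with hh
  have hI : Integrable h := by
    refine integrable_mul_pow_of_bounded_support (T := T) ?_ (fun t ht => ?_) m
    · have := integrable_mul_exp_neg (f := fun t => (φ t : ℂ)) hW.integrable_phi.ofReal
        (-(2 * Real.pi * k))
      refine this.congr (ae_of_all _ fun t => ?_)
      simp only
      congr 2; push_cast; ring
    · have := hφ (show φ t ≠ 0 by
        intro h0; apply ht; simp [h0])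
      rw [abs_of_neg this.2]; linarith [this.1]
  have hc : (2 * Real.pi * Complex.I * k : ℂ) ≠ 0 := by
    have : (k : ℂ) ≠ 0 := by exact_mod_cast hk
    simp [Real.pi_ne_zero, this]
  rw [← integral_eq_integral_tsum_add_int hI]
  have hsum : ∀ᵐ x : ℝ, ∑' l : ℤ, h (x + l) =
      Complex.exp (2 * Real.pi * Complex.I * k * x) * (q.eval 0 : ℝ) := by
    filter_upwards [hQc] with x hx
    rw [← hx, hQ, Complex.ofReal_tsum, ← tsum_mul_left,
      ← (Equiv.neg ℤ).tsum_eq]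
    congr 1 with l
    simp only [hh, Equiv.neg_apply, Int.cast_neg, ← sub_eq_add_neg]
    have : Complex.exp (2 * Real.pi * Complex.I * k * ((x - l : ℝ) : ℂ)) =
        Complex.exp (2 * Real.pi * Complex.I * k * x) := by
      rw [Complex.exp_eq_exp_iff_exists_int]
      exact ⟨-(k * l), by push_cast; ring⟩
    rw [this]
    push_cast
    ring
  rw [integral_congr_ae (ae_restrict_of_ae hsum), integral_mul_const,
    ← intervalIntegral.integral_of_le zero_le_one, integral_exp_mul_complex hc]
  have : Complex.exp (2 * Real.pi * Complex.I * k * ((1 : ℝ) : ℂ)) =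
      Complex.exp (2 * Real.pi * Complex.I * k * ((0 : ℝ) : ℂ)) := by
    rw [Complex.exp_eq_exp_iff_exists_int]
    exact ⟨k, by push_cast; ring⟩
  rw [this]; simp

end Wavelet

/-! ### Discrete filters associated with the wavelet coefficients -/

theorem two_rpow_neg_natCast (j : ℕ) : (2 : ℝ) ^ (-(j : ℝ)) = ((2 : ℝ) ^ j)⁻¹ := by
  rw [Real.rpow_neg (by norm_num), Real.rpow_natCast]

theorem two_rpow_neg_half_mul_self (j : ℕ) :
    (2 : ℝ) ^ (-(j : ℝ) / 2) * (2 : ℝ) ^ (-(j : ℝ) / 2) = ((2 : ℝ) ^ j)⁻¹ := by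
  rw [← Real.rpow_add (by norm_num), ← two_rpow_neg_natCast]; ring_nf

theorem waveletFun_eq_sub (ψ : ℝ → ℝ) (j : ℕ) (k : ℤ) (t : ℝ) :
    waveletFun ψ j k t = waveletFun ψ j 0 (t - 2 ^ j * k) := by
  unfold waveletFun
  rw [two_rpow_neg_natCast]
  congr 2
  have : (2 : ℝ) ^ j ≠ 0 := by positivity
  field_simp
  push_cast; ring

/-- Coefficients of the filter which maps the sequence to its wavelet coefficients at scale `j`. -/
noncomputable def filterCoeff (φ ψ : ℝ → ℝ) (j : ℕ) (m : ℕ) : ℝ :=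
  ∫ t, φ (t - m) * waveletFun ψ j 0 t

/-- Length of the filter at scale `j`. -/
def filterLength (T j : ℕ) : ℕ := (2 ^ j + 1) * T

/-- Generating polynomial of the filter at scale `j`. -/
noncomputable def filterPoly (φ ψ : ℝ → ℝ) (T j : ℕ) : Polynomial ℝ :=
  ∑ m ∈ Finset.range (filterLength T j), Polynomial.C (filterCoeff φ ψ j m) * Polynomial.X ^ m

/-- Transfer function of the filter at scale `j`. -/
noncomputable def transferFun (φ ψ : ℝ → ℝ) (T j : ℕ) (ξ : ℝ) : ℂ :=
  ∑ m ∈ Finset.range (filterLength T j),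
    (filterCoeff φ ψ j m : ℂ) * Complex.exp (Complex.I * m * ξ)

theorem waveletFun_ne_zero {ψ : ℝ → ℝ} {T : ℕ} (hψ : Function.support ψ ⊆ Set.Ioo 0 (T : ℝ))
    {j : ℕ} {t : ℝ} (ht : waveletFun ψ j 0 t ≠ 0) : 0 < t ∧ t < 2 ^ j * T := by
  unfold waveletFun at ht
  rw [two_rpow_neg_natCast] at ht
  have h := hψ (right_ne_zero_of_mul ht)
  rw [Int.cast_zero, sub_zero, inv_mul_eq_div] at h
  have hp : (0 : ℝ) < 2 ^ j := by positivity
  exact ⟨(div_pos_iff_of_pos_right hp).1 h.1, by rw [mul_comm]; exact (div_lt_iff₀ hp).1 h.2⟩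

theorem mem_range_filterLength {φ ψ : ℝ → ℝ} {T : ℕ}
    (hφ : Function.support φ ⊆ Set.Ioo (-(T : ℝ)) 0)
    (hψ : Function.support ψ ⊆ Set.Ioo 0 (T : ℝ)) {j : ℕ} {t : ℝ} {m : ℤ}
    (h1 : φ (t - m) ≠ 0) (h2 : waveletFun ψ j 0 t ≠ 0) :
    ∃ m' ∈ Finset.range (filterLength T j), (m' : ℤ) = m := by
  have h3 := hφ h1
  have h4 := waveletFun_ne_zero hψ h2
  have a : (0 : ℝ) < m := by linarith [h3.2, h4.1]
  have b : (m : ℝ) < (2 ^ j + 1) * T := by linarith [h3.1, h4.2]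
  have a' : 0 < m := by exact_mod_cast a
  lift m to ℕ using a'.le
  refine ⟨m, ?_, rfl⟩
  rw [Finset.mem_range, filterLength]
  exact_mod_cast b

section Filter

variable {φ ψ : ℝ → ℝ} {α : ℝ} {M : ℕ}

theorem integrable_waveletFun (hW : WaveletAssumptions φ ψ α M) (j : ℕ) :
    Integrable (waveletFun ψ j 0) := by
  unfold waveletFun
  simp only [Int.cast_zero, sub_zero]
  exact (hW.integrable_psi.comp_mul_left' (by positivity)).const_mul _

theorem memLp_waveletFun (hW : WaveletAssumptions φ ψ α M) (j : ℕ) :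
    MemLp (waveletFun ψ j 0) 2 := by
  rw [memLp_two_iff_integrable_sq (integrable_waveletFun hW j).1]
  unfold waveletFun
  simp only [Int.cast_zero, sub_zero, mul_pow]
  exact (hW.memLp_psi.integrable_sq.comp_mul_left' (by positivity)).const_mul _

theorem integrable_mul_waveletFun (hW : WaveletAssumptions φ ψ α M) (j : ℕ) (m : ℝ) :
    Integrable fun t => φ (t - m) * waveletFun ψ j 0 t :=
  (hW.memLp_phi.comp_measurePreserving (measurePreserving_sub_right volume m)).integrable_mul
    (memLp_waveletFun hW j)

theorem integral_comp_waveletFun (ψ : ℝ → ℝ) (j : ℕ) {E : Type*} [NormedAddCommGroup E]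
    [NormedSpace ℝ E] (F : ℝ → E) :
    ∫ t, waveletFun ψ j 0 t • F t =
      ((2 : ℝ) ^ (-(j : ℝ) / 2) * 2 ^ j) • ∫ t, ψ t • F (2 ^ j * t) := by
  have hp : (0 : ℝ) < 2 ^ j := by positivity
  have := Measure.integral_comp_mul_left (fun t => ψ t • F (2 ^ j * t)) ((2 : ℝ) ^ j)⁻¹
  rw [inv_inv, abs_of_pos hp] at this
  rw [mul_smul, ← this, ← integral_smul]
  congr 1 with t
  unfold waveletFun
  rw [two_rpow_neg_natCast, Int.cast_zero, sub_zero, mul_smul, mul_inv_cancel_left₀ hp.ne']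

theorem fourier_waveletFun (ψ : ℝ → ℝ) (j : ℕ) (ξ : ℝ) :
    fourier (waveletFun ψ j 0) ξ =
      (((2 : ℝ) ^ (-(j : ℝ) / 2) * 2 ^ j : ℝ) : ℂ) * fourier ψ (2 ^ j * ξ) := by
  have := integral_comp_waveletFun ψ j fun t => Complex.exp (-(Complex.I * ξ * t))
  simp only [Complex.real_smul] at this
  rw [fourier_eq, this, fourier_eq]
  congr 2 with t
  congr 2
  push_cast; ring

/-- Translating by 2^j k reduces to location 0, where the supports of φ(· - m) and of the dilated
wavelet meet only for finitely many m, all of them positive. -/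
theorem waveletCoeff_eq_sum (hW : WaveletAssumptions φ ψ α M) {T : ℕ}
    (hφ : Function.support φ ⊆ Set.Ioo (-(T : ℝ)) 0)
    (hψ : Function.support ψ ⊆ Set.Ioo 0 (T : ℝ)) (x : ℤ → ℝ) (j : ℕ) (k : ℤ) :
    waveletCoeff φ ψ x j k =
      ∑ m ∈ Finset.range (filterLength T j), filterCoeff φ ψ j m * x (2 ^ j * k + m) := by
  unfold waveletCoeff
  rw [← integral_add_right_eq_self _ ((2 : ℝ) ^ j * k)]
  have h : ∀ t, (∑' l : ℤ, x l * φ (t + 2 ^ j * k - l)) * waveletFun ψ j k (t + 2 ^ j * k) =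
      ∑ m ∈ Finset.range (filterLength T j),
        x (2 ^ j * k + m) * (φ (t - m) * waveletFun ψ j 0 t) := by
    intro t
    rw [waveletFun_eq_sub, add_sub_cancel_right]
    by_cases h0 : waveletFun ψ j 0 t = 0
    · simp [h0]
    simp only [← mul_assoc]
    rw [← Finset.sum_mul]
    congr 1
    rw [← (Equiv.addLeft (2 ^ j * k : ℤ)).tsum_eq]
    set e : ℕ ↪ ℤ := ⟨Nat.cast, Nat.cast_injective⟩
    rw [tsum_eq_sum (s := (Finset.range (filterLength T j)).map e), Finset.sum_map]
    · refine Finset.sum_congr rfl fun m _ => ?_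
      simp only [Equiv.coe_addLeft, e, Function.Embedding.coeFn_mk]
      congr 2
      push_cast; ring
    · intro m hm
      by_contra hne
      have h1 := right_ne_zero_of_mul hne
      have e1 : t + 2 ^ j * k - ((Equiv.addLeft (2 ^ j * k : ℤ) m : ℤ) : ℝ) = t - m := by
        simp only [Equiv.coe_addLeft]
        push_cast; ring
      rw [e1] at h1
      obtain ⟨m', hm', rfl⟩ := mem_range_filterLength hφ hψ h1 h0
      exact hm (Finset.mem_map.2 ⟨m', hm', rfl⟩)
  simp only [h]
  rw [integral_finsetSum _ fun (m : ℕ) _ =>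
    (integrable_mul_waveletFun hW j (m : ℝ)).const_mul (x (2 ^ j * k + m))]
  refine Finset.sum_congr rfl fun m _ => ?_
  rw [integral_const_mul, filterCoeff, mul_comm]

theorem integral_pow_mul_waveletFun (hW : WaveletAssumptions φ ψ α M) (j : ℕ) {m : ℕ}
    (hm : m < M) : ∫ t, waveletFun ψ j 0 t * t ^ m = 0 := by
  have := integral_comp_waveletFun ψ j fun t => t ^ m
  simp only [smul_eq_mul, mul_pow] at this
  rw [this]
  have e : ∀ t, ψ t * ((2 ^ j) ^ m * t ^ m) = (2 ^ j) ^ m * (t ^ m * ψ t) := fun t => by ring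
  simp only [e]
  rw [integral_const_mul, hW.vanishing_moments m hm, mul_zero, mul_zero]

/-- The sum is the wavelet coefficient of the sequence l ↦ l^r. Interpolating that sequence with φ
gives a polynomial of degree r < M, and the wavelet annihilates it. -/
theorem sum_filterCoeff_mul_pow (hW : WaveletAssumptions φ ψ α M) {T : ℕ}
    (hφ : Function.support φ ⊆ Set.Ioo (-(T : ℝ)) 0)
    (hψ : Function.support ψ ⊆ Set.Ioo 0 (T : ℝ)) (j : ℕ) {r : ℕ} (hr : r < M) :
    ∑ m ∈ Finset.range (filterLength T j), filterCoeff φ ψ j m * (m : ℝ) ^ r = 0 := by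
  obtain ⟨p, hpd, hp⟩ := hW.polynomial_reproduction r hr
  have h1 : waveletCoeff φ ψ (fun l => (l : ℝ) ^ r) j 0 = 0 := by
    unfold waveletCoeff
    have e1 : ∫ t, (∑' l : ℤ, (l : ℝ) ^ r * φ (t - l)) * waveletFun ψ j 0 t =
        ∫ t, ∑ b ∈ Finset.range (r + 1), p.coeff b * (waveletFun ψ j 0 t * t ^ b) := by
      refine integral_congr_ae ?_
      filter_upwards [hp] with t ht
      rw [ht, Polynomial.eval_eq_sum_range, Polynomial.natDegree_eq_of_degree_eq_some hpd,
        Finset.sum_mul]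
      exact Finset.sum_congr rfl fun b _ => by ring
    have hint : ∀ b : ℕ, Integrable fun t => waveletFun ψ j 0 t * t ^ b := by
      intro b
      have := (integrable_mul_pow_of_bounded_support (f := fun t => (waveletFun ψ j 0 t : ℂ))
        (T := 2 ^ j * T) (integrable_waveletFun hW j).ofReal (fun t ht => by
          have := waveletFun_ne_zero hψ (show waveletFun ψ j 0 t ≠ 0 by simpa using ht)
          rw [abs_of_pos this.1]; exact this.2.le) b).re
      refine this.congr (ae_of_all _ fun t => ?_)
      simp only [RCLike.re_eq_complex_re]
      rw [← Complex.ofReal_pow, ← Complex.ofReal_mul, Complex.ofReal_re]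
    rw [e1, integral_finsetSum _ fun b _ => (hint b).const_mul _]
    refine Finset.sum_eq_zero fun b hb => ?_
    rw [integral_const_mul, integral_pow_mul_waveletFun hW j
      (by have := Finset.mem_range.1 hb; omega), mul_zero]
  rw [waveletCoeff_eq_sum hW hφ hψ] at h1
  simpa using h1

theorem sum_filterCoeff_mul_eval (hW : WaveletAssumptions φ ψ α M) {T : ℕ}
    (hφ : Function.support φ ⊆ Set.Ioo (-(T : ℝ)) 0)
    (hψ : Function.support ψ ⊆ Set.Ioo 0 (T : ℝ)) (j : ℕ) (p : Polynomial ℝ)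
    (hp : p.natDegree < M) :
    ∑ m ∈ Finset.range (filterLength T j), filterCoeff φ ψ j m * p.eval (m : ℝ) = 0 := by
  simp only [Polynomial.eval_eq_sum_range, Finset.mul_sum]
  rw [Finset.sum_comm]
  refine Finset.sum_eq_zero fun b hb => ?_
  have := sum_filterCoeff_mul_pow hW hφ hψ j (r := b) (by have := Finset.mem_range.1 hb; omega)
  have e : ∀ m : ℕ, filterCoeff φ ψ j m * (p.coeff b * (m : ℝ) ^ b) =
    p.coeff b * (filterCoeff φ ψ j m * (m : ℝ) ^ b) := fun m => by ring
  simp only [e, ← Finset.mul_sum, this, mul_zero]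

/-- The r-th derivative at 1 is the sum of the filter coefficients against a falling factorial of
degree r; all of these with r < M are zero, so 1 is a root of multiplicity at least M. -/
theorem exists_filterPoly_eq (hW : WaveletAssumptions φ ψ α M) {T : ℕ}
    (hφ : Function.support φ ⊆ Set.Ioo (-(T : ℝ)) 0)
    (hψ : Function.support ψ ⊆ Set.Ioo 0 (T : ℝ)) (j : ℕ) :
    ∃ Q : Polynomial ℝ, filterPoly φ ψ T j = (Polynomial.X - 1) ^ M * Q := by
  rcases Nat.eq_zero_or_pos M with rfl | hM
  · exact ⟨filterPoly φ ψ T j, by simp⟩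
  by_cases h0 : filterPoly φ ψ T j = 0
  · exact ⟨0, by simp [h0]⟩
  change (Polynomial.X - 1) ^ M ∣ filterPoly φ ψ T j
  rw [← Polynomial.C_1, ← Polynomial.le_rootMultiplicity_iff h0]
  have : M - 1 < Polynomial.rootMultiplicity 1 (filterPoly φ ψ T j) := by
    rw [Polynomial.lt_rootMultiplicity_iff_isRoot_iterate_derivative h0]
    intro r hr
    rw [Polynomial.IsRoot, filterPoly, Polynomial.iterate_derivative_sum,
      Polynomial.eval_finsetSum]
    rw [← sum_filterCoeff_mul_eval hW hφ hψ j (descPochhammer ℝ r) (by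
      rw [descPochhammer_natDegree]; omega)]
    refine Finset.sum_congr rfl fun m _ => ?_
    rw [Polynomial.iterate_derivative_C_mul, Polynomial.iterate_derivative_X_pow_eq_natCast_mul,
      descPochhammer_eval_eq_descFactorial]
    simp
  omega

/-- The Poisson summation formula for the transfer function. -/
theorem hasSum_transferFun (hW : WaveletAssumptions φ ψ α M) {T : ℕ}
    (hφ : Function.support φ ⊆ Set.Ioo (-(T : ℝ)) 0)
    (hψ : Function.support ψ ⊆ Set.Ioo 0 (T : ℝ)) (j : ℕ) (ξ : ℝ) :
    HasSum (fun k : ℤ => fourier φ (ξ - 2 * Real.pi * k) *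
      (starRingEnd ℂ) (fourier (waveletFun ψ j 0) (ξ - 2 * Real.pi * k)))
      (transferFun φ ψ T j ξ) := by
  have hE : ∀ f : ℝ → ℝ, Integrable f → Integrable fun t : ℝ => (f t : ℂ) * Complex.exp
      (-(Complex.I * ((-ξ : ℝ) : ℂ) * t)) := fun f hf =>
    integrable_mul_exp_neg (f := fun t => (f t : ℂ)) hf.ofReal (-ξ)
  have hE2 : ∀ f : ℝ → ℝ, MemLp f 2 → Integrable f → MemLp (fun t : ℝ => (f t : ℂ) * Complex.exp
      (-(Complex.I * ((-ξ : ℝ) : ℂ) * t))) 2 := fun f hf hf1 =>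
    hf.of_le (hE f hf1).1 (ae_of_all _ fun t => by
      rw [norm_mul, norm_exp_neg_I_mul, mul_one, Complex.norm_real])
  obtain ⟨e, he⟩ : ∃ e : ℕ ↪ ℤ, ∀ m, e m = -(m : ℤ) :=
    ⟨⟨fun m => -(m : ℤ), fun a b h => by simpa using h⟩, fun _ => rfl⟩
  -- Both functions carry the modulation e^{iξt}. It turns the integer frequencies of the Poisson
  -- formula into the shifts ξ - 2πk and leaves a phase e^{imξ} on the m-th filter coefficient. The
  -- shifts in the formula are negatives of filter indices, hence the embedding m ↦ -m.
  have key := hasSum_integral_mul_integral_exp (R := 2 ^ j * T)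
    (hE2 φ hW.memLp_phi hW.integrable_phi)
    (hE2 _ (memLp_waveletFun hW j) (integrable_waveletFun hW j)) (hE φ hW.integrable_phi)
    (hE _ (integrable_waveletFun hW j)) (fun t ht => ?_) (fun t ht => ?_)
    ((Finset.range (filterLength T j)).map e) (fun m t h1 h2 => ?_)
  · convert key using 1
    · funext k
      have h1 : ∀ f : ℝ → ℝ, ∫ t : ℝ, (f t : ℂ) * Complex.exp (-(Complex.I * ((-ξ : ℝ) : ℂ) * t)) *
          Complex.exp (-(2 * Real.pi * Complex.I * k * t)) =
          fourier f (-(ξ - 2 * Real.pi * k)) := by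
        intro f
        rw [fourier_eq]
        congr 1 with t
        rw [mul_assoc, ← Complex.exp_add]
        congr 2
        push_cast; ring
      rw [h1, h1, conj_fourier, conj_fourier, neg_neg]
    · rw [Finset.sum_map, transferFun]
      refine Finset.sum_congr rfl fun m _ => ?_
      rw [filterCoeff, ← integral_complex_ofReal, ← integral_mul_const]
      congr 1 with t
      simp only [he, map_mul, Complex.conj_ofReal, ← Complex.exp_conj,
        map_neg, Complex.conj_I]
      push_cast
      rw [← sub_eq_add_neg, mul_mul_mul_comm, ← Complex.exp_add]
      congr 2
      ring
  · have := hφ (show φ t ≠ 0 by intro h0; apply ht; simp [h0])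
    rw [abs_of_neg this.2]
    have h1 : (1 : ℝ) ≤ 2 ^ j := one_le_pow₀ (by norm_num)
    push_cast
    nlinarith [this.1, (Nat.cast_nonneg T : (0 : ℝ) ≤ T)]
  · have := waveletFun_ne_zero hψ (show waveletFun ψ j 0 t ≠ 0 by intro h0; apply ht; simp [h0])
    rw [abs_of_pos this.1]
    push_cast
    exact this.2.le
  · have h3 : φ (t - ((-m : ℤ) : ℝ)) ≠ 0 := by
      intro h0; apply h1
      rw [Int.cast_neg, sub_neg_eq_add] at h0
      simp [h0]
    obtain ⟨m', hm', h4⟩ := mem_range_filterLength hφ hψ h3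
      (show waveletFun ψ j 0 t ≠ 0 by intro h0; apply h2; simp [h0])
    refine Finset.mem_map.2 ⟨m', hm', ?_⟩
    rw [he, h4, neg_neg]

/-- The main term is k = 0 in the Poisson series; the other terms are aliasing. In them φ̂(ξ - 2πk)
= O(|ξ|^M) uniformly in k, by the vanishing modulated moments, while the wavelet factor is O(2^{-jα}
|k|^{-α}), summable because α > 1. -/
theorem exists_norm_transferFun_sub_le (hW : WaveletAssumptions φ ψ α M) {T : ℕ}
    (hφ : Function.support φ ⊆ Set.Ioo (-(T : ℝ)) 0)
    (hψ : Function.support ψ ⊆ Set.Ioo 0 (T : ℝ)) :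
    ∃ C : ℝ, 0 ≤ C ∧ ∀ (j : ℕ) (ξ : ℝ), |ξ| ≤ Real.pi →
      ‖(((2 : ℝ) ^ (-(j : ℝ) / 2) : ℝ) : ℂ) * transferFun φ ψ T j ξ -
        fourier φ ξ * (starRingEnd ℂ) (fourier ψ (2 ^ j * ξ))‖ ≤
        C * ((2 : ℝ) ^ j) ^ (-α) * |ξ| ^ M := by
  obtain ⟨B, hB0, hB⟩ := exists_norm_fourier_wavelet_le hW hψ
  have hα := hW.one_lt_alpha
  have hpi := Real.pi_pos
  set A := (T : ℝ) ^ M * Real.exp (T * Real.pi) * ∫ t, ‖φ t‖ with hA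
  have hI0 : 0 ≤ ∫ t, ‖φ t‖ := integral_nonneg fun t => norm_nonneg _
  have hsum := Real.summable_abs_int_rpow hα
  have hSF : ∀ (k : ℤ) (ξ : ℝ), k ≠ 0 → |ξ| ≤ Real.pi →
      ‖fourier φ (ξ - 2 * Real.pi * k)‖ ≤ A * |ξ| ^ M := by
    intro k ξ hk hξ
    have hi : Integrable fun t : ℝ =>
        (φ t : ℂ) * Complex.exp (2 * Real.pi * Complex.I * k * t) := by
      have := integrable_mul_exp_neg (f := fun t => (φ t : ℂ)) hW.integrable_phi.ofReal
        (-(2 * Real.pi * k))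
      refine this.congr (ae_of_all _ fun t => ?_)
      simp only
      congr 2; push_cast; ring
    have h := norm_integral_mul_exp_le hi (T := T) (fun t ht => by
      have := hφ (show φ t ≠ 0 by intro h0; apply ht; simp [h0])
      rw [abs_of_neg this.2]; linarith [this.1])
      (fun m hm => integral_mul_exp_mul_pow_eq_zero hW hφ hm hk) ξ
    have e1 : ∫ t : ℝ, (φ t : ℂ) * Complex.exp (2 * Real.pi * Complex.I * k * t) *
        Complex.exp (-(Complex.I * ξ * t)) = fourier φ (ξ - 2 * Real.pi * k) := by
      rw [fourier_eq]
      congr 1 with t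
      rw [mul_assoc, ← Complex.exp_add]
      congr 2
      push_cast; ring
    have e2 : ∀ t : ℝ, ‖(φ t : ℂ) * Complex.exp (2 * Real.pi * Complex.I * k * t)‖ = ‖φ t‖ := by
      intro t
      rw [norm_mul, show 2 * Real.pi * Complex.I * k * (t : ℂ) =
        ((2 * Real.pi * k * t : ℝ) : ℂ) * Complex.I by push_cast; ring,
        Complex.norm_exp_ofReal_mul_I, mul_one, Complex.norm_real]
    rw [e1] at h
    simp only [e2] at h
    refine h.trans ?_
    rw [hA, mul_pow]
    have : Real.exp (T * |ξ|) ≤ Real.exp (T * Real.pi) := by gcongr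
    calc _ = (T : ℝ) ^ M * Real.exp (T * |ξ|) * (∫ t, ‖φ t‖) * |ξ| ^ M := by ring
      _ ≤ _ := by gcongr
  refine ⟨A * B * ∑' k : ℤ, |(k : ℝ)| ^ (-α), by positivity, fun j ξ hξ => ?_⟩
  have hs := (hasSum_transferFun hW hφ hψ j ξ).mul_left (((2 : ℝ) ^ (-(j : ℝ) / 2) : ℝ) : ℂ)
  have e0 : ∀ k : ℤ, (((2 : ℝ) ^ (-(j : ℝ) / 2) : ℝ) : ℂ) * (fourier φ (ξ - 2 * Real.pi * k) *
      (starRingEnd ℂ) (fourier (waveletFun ψ j 0) (ξ - 2 * Real.pi * k))) =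
      fourier φ (ξ - 2 * Real.pi * k) *
        (starRingEnd ℂ) (fourier ψ (2 ^ j * (ξ - 2 * Real.pi * k))) := by
    intro k
    rw [fourier_waveletFun, map_mul, Complex.conj_ofReal]
    have : (((2 : ℝ) ^ (-(j : ℝ) / 2) : ℝ) : ℂ) *
        (((2 : ℝ) ^ (-(j : ℝ) / 2) * 2 ^ j : ℝ) : ℂ) = 1 := by
      rw [← Complex.ofReal_mul, ← mul_assoc, two_rpow_neg_half_mul_self,
        inv_mul_cancel₀ (by positivity), Complex.ofReal_one]
    linear_combination (fourier φ (ξ - 2 * Real.pi * k) *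
        (starRingEnd ℂ) (fourier ψ (2 ^ j * (ξ - 2 * Real.pi * k)))) * this
  simp only [e0] at hs
  have hs' := hasSum_ite_sub_hasSum hs 0
  simp only [Int.cast_zero, mul_zero, sub_zero] at hs'
  refine hs'.norm_le_of_bounded (hsum.hasSum.mul_left (A * |ξ| ^ M * B * ((2 : ℝ) ^ j) ^ (-α)))
    (fun k => ?_) |>.trans_eq (by ring)
  have hrhs : 0 ≤ A * |ξ| ^ M * B * ((2 : ℝ) ^ j) ^ (-α) * |(k : ℝ)| ^ (-α) := by positivity
  split_ifs with hk
  · simpa using hrhs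
  have hk1 : (1 : ℝ) ≤ |(k : ℝ)| := by exact_mod_cast Int.one_le_abs hk
  -- For |ξ| ≤ π the distance to 2πk is at least 2π|k| - π ≥ |k|.
  have hlow : |(k : ℝ)| ≤ |ξ - 2 * Real.pi * k| := by
    have h1 := abs_sub_abs_le_abs_sub (2 * Real.pi * k) ξ
    rw [abs_sub_comm, abs_mul, abs_of_pos (by positivity : 0 < 2 * Real.pi)] at h1
    have := Real.pi_gt_three
    nlinarith
  rw [norm_mul, RCLike.norm_conj]
  have hψb : ‖fourier ψ (2 ^ j * (ξ - 2 * Real.pi * k))‖ ≤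
      B * (((2 : ℝ) ^ j) ^ (-α) * |(k : ℝ)| ^ (-α)) := by
    refine (hB _).trans (mul_le_mul_of_nonneg_left ?_ hB0.le)
    rw [← Real.mul_rpow (by positivity) (by positivity)]
    unfold decayEnv
    have h2 : (1 + |2 ^ j * (ξ - 2 * Real.pi * k)|) ^ (-α) ≤ ((2 : ℝ) ^ j * |(k : ℝ)|) ^ (-α) := by
      refine Real.rpow_le_rpow_of_nonpos (by positivity) ?_ (by linarith)
      rw [abs_mul, abs_of_pos (by positivity : (0 : ℝ) < 2 ^ j)]
      have : (2 : ℝ) ^ j * |(k : ℝ)| ≤ 2 ^ j * |ξ - 2 * Real.pi * k| := by gcongr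
      linarith
    have h3 : min 1 |2 ^ j * (ξ - 2 * Real.pi * k)| ^ M ≤ 1 :=
      pow_le_one₀ (by positivity) (min_le_left _ _)
    calc _ ≤ 1 * (1 + |2 ^ j * (ξ - 2 * Real.pi * k)|) ^ (-α) := by gcongr
      _ ≤ _ := by rw [one_mul]; exact h2
  calc _ ≤ (A * |ξ| ^ M) * (B * (((2 : ℝ) ^ j) ^ (-α) * |(k : ℝ)| ^ (-α))) :=
        mul_le_mul (hSF k ξ hk hξ) hψb (norm_nonneg _) (by positivity)
    _ = _ := by ring

end Filter

/-! ### Covariances of the wavelet coefficients -/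

/-- The linear functional on polynomials sending `X ^ m` to `x (N + m)`. -/
noncomputable def shiftEval (x : ℤ → ℝ) (N : ℤ) : Polynomial ℝ →ₗ[ℝ] ℝ :=
  Polynomial.lsum fun m => LinearMap.mulRight ℝ (x (N + m))

theorem shiftEval_monomial (x : ℤ → ℝ) (N : ℤ) (m : ℕ) (c : ℝ) :
    shiftEval x N (Polynomial.monomial m c) = c * x (N + m) := by
  simp [shiftEval, Polynomial.lsum_apply, Polynomial.sum_monomial_index]

theorem shiftEval_eq_sum (x : ℤ → ℝ) (N : ℤ) (Q : Polynomial ℝ) :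
    shiftEval x N Q = ∑ m ∈ Finset.range (Q.natDegree + 1), Q.coeff m * x (N + m) := by
  conv_lhs => rw [Q.as_sum_range' (Q.natDegree + 1) (Nat.lt_succ_self _)]
  simp only [map_sum, shiftEval_monomial]

/-- Multiplication by X - 1 is a forward difference, and `diff` is a backward one; this accounts for
the shift of the base point by 1. -/
theorem shiftEval_X_sub_one_mul (x : ℤ → ℝ) (N : ℤ) (Q : Polynomial ℝ) :
    shiftEval x N ((Polynomial.X - 1) * Q) = shiftEval (diff x) (N + 1) Q := by
  induction Q using Polynomial.induction_on' with
  | add p q hp hq => rw [mul_add, map_add, map_add, hp, hq]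
  | monomial m c =>
    rw [sub_mul, one_mul, Polynomial.X_mul_monomial, map_sub, shiftEval_monomial,
      shiftEval_monomial, shiftEval_monomial, diff, ← mul_sub]
    rw [show N + ((m + 1 : ℕ) : ℤ) = N + 1 + m by push_cast; ring,
      show N + 1 + (m : ℤ) - 1 = N + m by ring]

theorem shiftEval_X_sub_one_pow_mul (x : ℤ → ℝ) (N : ℤ) (M : ℕ) (Q : Polynomial ℝ) :
    shiftEval x N ((Polynomial.X - 1) ^ M * Q) = shiftEval (diff^[M] x) (N + M) Q := by
  induction M generalizing x N with
  | zero => simp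
  | succ M ih =>
    rw [pow_succ', mul_assoc, shiftEval_X_sub_one_mul, ih, Function.iterate_succ_apply,
      show N + ((M + 1 : ℕ) : ℤ) = N + 1 + M by push_cast; ring]

theorem shiftEval_filterPoly (φ ψ : ℝ → ℝ) (T j : ℕ) (x : ℤ → ℝ) (N : ℤ) :
    shiftEval x N (filterPoly φ ψ T j) =
      ∑ m ∈ Finset.range (filterLength T j), filterCoeff φ ψ j m * x (N + m) := by
  simp only [filterPoly, map_sum, Polynomial.C_mul_X_pow_eq_monomial, shiftEval_monomial]

theorem eval_filterPoly (φ ψ : ℝ → ℝ) (T j : ℕ) (ξ : ℝ) :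
    Polynomial.aeval (Complex.exp (Complex.I * ξ)) (filterPoly φ ψ T j) =
      transferFun φ ψ T j ξ := by
  simp only [filterPoly, map_sum, map_mul, Polynomial.aeval_C, map_pow, Polynomial.aeval_X,
    transferFun, ← Complex.exp_nat_mul]
  refine Finset.sum_congr rfl fun m _ => ?_
  rw [Complex.coe_algebraMap]
  congr 2; ring

theorem iterate_diff_apply {Ω : Type*} (X : ℤ → Ω → ℝ) (M : ℕ) (k : ℤ) (ω : Ω) :
    diff^[M] (fun k => X k ω) k = (diff^[M] X) k ω := by
  induction M generalizing X k with
  | zero => rfl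
  | succ M ih =>
    rw [Function.iterate_succ_apply, Function.iterate_succ_apply, ← ih]
    rfl

section WaveletProcess

variable {Ω : Type*} [MeasurableSpace Ω] {P : Measure Ω} {φ ψ : ℝ → ℝ} {α : ℝ} {M : ℕ}
  {T : ℕ} {d : ℝ} {fstar : ℝ → ℝ} {X : ℤ → Ω → ℝ}

theorem isGaussianProcess_waveletCoeff (hW : WaveletAssumptions φ ψ α M)
    (hφ : Function.support φ ⊆ Set.Ioo (-(T : ℝ)) 0)
    (hψ : Function.support ψ ⊆ Set.Ioo 0 (T : ℝ)) (hX : IsGaussianProcess X P) :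
    IsGaussianProcess (fun (p : ℕ × ℤ) ω => waveletCoeff φ ψ (fun k => X k ω) p.1 p.2) P := by
  classical
  refine hX.of_isGaussianProcess fun p => ?_
  have hmem : ∀ m : ℕ, m ∈ Finset.range (filterLength T p.1) → 2 ^ p.1 * p.2 + (m : ℤ) ∈
      (Finset.range (filterLength T p.1)).image fun m : ℕ => 2 ^ p.1 * p.2 + (m : ℤ) :=
    fun m hm => Finset.mem_image_of_mem _ hm
  refine ⟨(Finset.range (filterLength T p.1)).image fun m : ℕ => 2 ^ p.1 * p.2 + (m : ℤ),
    ∑ m ∈ (Finset.range (filterLength T p.1)).attach, filterCoeff φ ψ p.1 m •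
      ContinuousLinearMap.proj ⟨2 ^ p.1 * p.2 + ((m : ℕ) : ℤ), hmem m m.2⟩, fun ω => ?_⟩
  rw [waveletCoeff_eq_sum hW hφ hψ, ← Finset.sum_attach]
  simp [Finset.restrict]

/-- The process itself need not be stationary; only its differences are accessible spectrally. The
same polynomial Q serves in time and in frequency, so the factor (e^{iξ} - 1)^M can later cancel the
differencing weight. -/
theorem exists_waveletCoeff_eq_diff (hW : WaveletAssumptions φ ψ α M)
    (hφ : Function.support φ ⊆ Set.Ioo (-(T : ℝ)) 0)
    (hψ : Function.support ψ ⊆ Set.Ioo 0 (T : ℝ)) (j : ℕ) :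
    ∃ Q : Polynomial ℝ, (∀ (x : ℤ → ℝ) (k : ℤ), waveletCoeff φ ψ x j k =
      ∑ m ∈ Finset.range (Q.natDegree + 1), Q.coeff m * (diff^[M] x) (2 ^ j * k + M + m)) ∧
      ∀ ξ : ℝ, transferFun φ ψ T j ξ = (Complex.exp (Complex.I * ξ) - 1) ^ M *
        ∑ m ∈ Finset.range (Q.natDegree + 1), (Q.coeff m : ℂ) * Complex.exp (Complex.I * m * ξ) := by
  obtain ⟨Q, hQ⟩ := exists_filterPoly_eq hW hφ hψ j
  refine ⟨Q, fun x k => ?_, fun ξ => ?_⟩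
  · rw [waveletCoeff_eq_sum hW hφ hψ, ← shiftEval_filterPoly, hQ, shiftEval_X_sub_one_pow_mul,
      shiftEval_eq_sum]
  · rw [← eval_filterPoly, hQ, map_mul, map_pow, map_sub, Polynomial.aeval_X, map_one,
      Polynomial.aeval_eq_sum_range]
    congr 1
    refine Finset.sum_congr rfl fun m _ => ?_
    rw [← Complex.exp_nat_mul, Complex.real_smul]
    congr 2; ring

theorem integral_waveletCoeff (hW : WaveletAssumptions φ ψ α M)
    (hφ : Function.support φ ⊆ Set.Ioo (-(T : ℝ)) 0)
    (hψ : Function.support ψ ⊆ Set.Ioo 0 (T : ℝ)) (hX : HasMemoryParameter P X d fstar)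
    (hd : d ≤ M) (hcentered : ∀ k : ℤ, P[diff^[M] X k] = 0) [IsProbabilityMeasure P]
    (j : ℕ) (k : ℤ) :
    ∫ ω, waveletCoeff φ ψ (fun k => X k ω) j k ∂P = 0 := by
  obtain ⟨Q, hQ, -⟩ := exists_waveletCoeff_eq_diff hW hφ hψ j
  have hY := hX.density M (by linarith)
  simp only [hQ, iterate_diff_apply]
  rw [integral_finsetSum _ fun m _ => ((hY.memLp _).integrable (by norm_num)).const_mul _]
  exact Finset.sum_eq_zero fun m _ => by rw [integral_const_mul, hcentered, mul_zero]

theorem norm_exp_I_sub_one (ξ : ℝ) :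
    ‖Complex.exp (Complex.I * ξ) - 1‖ = ‖1 - Complex.exp (-(Complex.I * ξ))‖ := by
  have : Complex.exp (Complex.I * ξ) - 1 =
      Complex.exp (Complex.I * ξ) * (1 - Complex.exp (-(Complex.I * ξ))) := by
    rw [mul_sub, ← Complex.exp_add]; simp
  rw [this, norm_mul, mul_comm Complex.I, Complex.norm_exp_ofReal_mul_I, one_mul]

theorem norm_one_sub_exp_pos {ξ : ℝ} (h : ξ ∈ Set.Ioo (-Real.pi) Real.pi) (h0 : ξ ≠ 0) :
    0 < ‖1 - Complex.exp (-(Complex.I * ξ))‖ := by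
  rw [norm_pos_iff, sub_ne_zero]
  intro he
  rw [eq_comm, Complex.exp_eq_one_iff] at he
  obtain ⟨n, hn⟩ := he
  have h1 : ξ = -(2 * Real.pi * n) := by
    have := congrArg Complex.im hn
    simp at this
    linarith
  have hpi := Real.pi_pos
  have h2 : |(n : ℝ)| < 1 := by
    rw [abs_lt]
    constructor <;> nlinarith [h.1, h.2]
  have h3 : n = 0 := by
    rw [← Int.abs_lt_one_iff]; exact_mod_cast h2
  exact h0 (by rw [h1, h3]; simp)

/-- Spectral representation of the covariances of wavelet coefficients. -/
theorem covariance_waveletCoeff (hW : WaveletAssumptions φ ψ α M)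
    (hφ : Function.support φ ⊆ Set.Ioo (-(T : ℝ)) 0)
    (hψ : Function.support ψ ⊆ Set.Ioo 0 (T : ℝ)) (hX : HasMemoryParameter P X d fstar)
    (hd : d ≤ M) [IsProbabilityMeasure P] (j i : ℕ) (k l : ℤ) :
    ((cov[fun ω => waveletCoeff φ ψ (fun k => X k ω) j k,
        fun ω => waveletCoeff φ ψ (fun k => X k ω) i l; P] : ℝ) : ℂ) =
      ∫ ξ in Set.Ioo (-Real.pi) Real.pi,
        Complex.exp (Complex.I * ((2 ^ j * k - 2 ^ i * l : ℤ) : ℂ) * ξ) *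
        (transferFun φ ψ T j ξ * (starRingEnd ℂ) (transferFun φ ψ T i ξ)) *
        ((‖1 - Complex.exp (-(Complex.I * ξ))‖ ^ (-2 * d) * fstar ξ : ℝ) : ℂ) := by
  obtain ⟨Q, hQ, hQt⟩ := exists_waveletCoeff_eq_diff hW hφ hψ j
  obtain ⟨R, hR, hRt⟩ := exists_waveletCoeff_eq_diff hW hφ hψ i
  have hY := hX.density M (by linarith)
  set g : ℝ → ℝ := fun ξ => ‖1 - Complex.exp (-(Complex.I * ξ))‖ ^ (2 * ((M : ℝ) - d)) * fstar ξ
    with hg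
  simp only [hQ, hR, iterate_diff_apply]
  rw [covariance_fun_sum_fun_sum' (fun m _ => (hY.memLp _).const_mul _)
    (fun m _ => (hY.memLp _).const_mul _)]
  have hcov : ∀ p q : ℤ, ((cov[(diff^[M] X) p, (diff^[M] X) q; P] : ℝ) : ℂ) =
      ∫ ξ in Set.Ioo (-Real.pi) Real.pi,
        Complex.exp (Complex.I * ((p - q : ℤ) : ℂ) * ξ) * (g ξ : ℂ) := by
    intro p q
    have := hY.cov_eq q (p - q)
    rwa [add_sub_cancel] at this
  have hgI : Integrable (fun ξ => (g ξ : ℂ)) (volume.restrict (Set.Ioo (-Real.pi) Real.pi)) :=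
    hY.integrableOn.ofReal
  have hI : ∀ p : ℤ, Integrable (fun ξ : ℝ => Complex.exp (Complex.I * (p : ℂ) * ξ) * (g ξ : ℂ))
      (volume.restrict (Set.Ioo (-Real.pi) Real.pi)) := by
    intro p
    refine hgI.bdd_mul (c := 1) (by fun_prop) (ae_of_all _ fun ξ => ?_)
    rw [show Complex.I * (p : ℂ) * (ξ : ℂ) = ((p * ξ : ℝ) : ℂ) * Complex.I by push_cast; ring,
      Complex.norm_exp_ofReal_mul_I]
  simp only [Complex.ofReal_sum, covariance_const_mul_left, covariance_const_mul_right,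
    Complex.ofReal_mul, hcov]
  simp only [← integral_const_mul]
  have hI2 : ∀ m m' : ℕ, Integrable (fun ξ : ℝ => (R.coeff m' : ℂ) * ((Q.coeff m : ℂ) *
      (Complex.exp (Complex.I *
        (((2 ^ j * k + M + m) - (2 ^ i * l + M + m') : ℤ) : ℂ) * ξ) * (g ξ : ℂ))))
      (volume.restrict (Set.Ioo (-Real.pi) Real.pi)) :=
    fun m m' => ((hI _).const_mul _).const_mul _
  rw [Finset.sum_congr rfl fun m _ => (integral_finsetSum _ fun m' _ => hI2 m m').symm]
  rw [← integral_finsetSum _ fun m _ => integrable_finsetSum _ fun m' _ => hI2 m m']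
  refine integral_congr_ae ?_
  have h0 : ∀ᵐ ξ ∂(volume.restrict (Set.Ioo (-Real.pi) Real.pi)), ξ ≠ 0 :=
    ae_restrict_of_ae (Measure.ae_ne volume 0)
  filter_upwards [h0, ae_restrict_mem measurableSet_Ioo] with ξ hξ0 hξ
  have hp := norm_one_sub_exp_pos hξ hξ0
  -- The M-fold differencing contributes |1 - e^{-iξ}|^{2M} to the density. Splitting it off
  -- restores the exponent -2d and completes the two transfer functions; adding exponents requires a
  -- nonzero base, hence ξ ≠ 0.
  have hgξ : (g ξ : ℂ) = (Complex.exp (Complex.I * ξ) - 1) ^ M *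
      (starRingEnd ℂ) ((Complex.exp (Complex.I * ξ) - 1) ^ M) *
      (((‖1 - Complex.exp (-(Complex.I * ξ))‖ ^ (-2 * d) : ℝ) : ℂ) * (fstar ξ : ℂ)) := by
    rw [← Complex.ofReal_mul, Complex.mul_conj, Complex.normSq_eq_norm_sq, norm_pow, norm_exp_I_sub_one, hg,
      ← Complex.ofReal_mul, ← mul_assoc, ← pow_mul, ← Real.rpow_natCast, ← Real.rpow_add hp]
    congr 4
    push_cast; ring_nf
  rw [hQt, hRt, map_mul, map_sum, hgξ]
  have hexp : ∀ m m' : ℕ, Complex.exp (Complex.I *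
        (((2 ^ j * k + M + m) - (2 ^ i * l + M + m') : ℤ) : ℂ) * ξ) =
      Complex.exp (Complex.I * ((2 ^ j * k - 2 ^ i * l : ℤ) : ℂ) * ξ) *
        Complex.exp (Complex.I * m * ξ) * (starRingEnd ℂ) (Complex.exp (Complex.I * m' * ξ)) := by
    intro m m'
    rw [← Complex.exp_conj, ← Complex.exp_add, ← Complex.exp_add]
    congr 1
    simp
    ring
  simp only [hexp, map_mul, Complex.conj_ofReal]
  generalize ((‖1 - Complex.exp (-(Complex.I * ξ))‖ ^ (-2 * d) : ℝ) : ℂ) * (fstar ξ : ℂ) = c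
  generalize (Complex.exp (Complex.I * ξ) - 1) ^ M = b
  generalize Complex.exp (Complex.I * ((2 ^ j * k - 2 ^ i * l : ℤ) : ℂ) * ξ) = e
  rw [show ∀ A B : ℂ, e * (b * A * ((starRingEnd ℂ) b * B)) * c =
    A * B * (e * b * (starRingEnd ℂ) b * c) from fun A B => by ring, Finset.sum_mul_sum,
    Finset.sum_mul]
  refine Finset.sum_congr rfl fun m _ => ?_
  rw [Finset.sum_mul]
  refine Finset.sum_congr rfl fun m' _ => ?_
  ring

end WaveletProcess

/-! ### The rescaled spectral kernel -/

theorem rpow_le_two_rpow_abs {t p : ℝ} (h1 : 1 ≤ t) (h2 : t ≤ 2) : t ^ p ≤ 2 ^ |p| :=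
  (Real.rpow_le_rpow_of_exponent_le h1 (le_abs_self p)).trans
    (Real.rpow_le_rpow (by linarith) h2 (abs_nonneg p))

/-- Near 0 the factor |ξ|^{2M} compensates |ξ|^{-2d} because d ≤ M. For |ξ| ≥ 1, |ξ| and 1 + |ξ|
differ by a factor at most 2; the absolute value in the constant covers both signs of d. -/
theorem abs_rpow_mul_decayEnv_sq_le {M : ℕ} {α d : ℝ} (hd : d ≤ M) {ξ : ℝ} (h0 : ξ ≠ 0) :
    |ξ| ^ (-2 * d) * decayEnv M α ξ ^ 2 ≤
      2 ^ |2 * d| * (1 + |ξ|) ^ (-(2 * d + 2 * α)) := by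
  have hp : 0 < |ξ| := abs_pos.2 h0
  have hx : 0 < 1 + |ξ| := by linarith
  have hsplit : (1 + |ξ|) ^ (-(2 * d + 2 * α)) =
      (1 + |ξ|) ^ (-(2 * d)) * ((1 + |ξ|) ^ (-α)) ^ 2 := by
    rw [← Real.rpow_natCast, ← Real.rpow_mul hx.le, ← Real.rpow_add hx]
    congr 1; push_cast; ring
  rw [decayEnv, mul_pow, hsplit, ← mul_assoc, ← mul_assoc]
  refine mul_le_mul_of_nonneg_right ?_ (by positivity)
  rcases le_total |ξ| 1 with h | h
  · rw [min_eq_right h, ← pow_mul, ← Real.rpow_natCast, ← Real.rpow_add hp]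
    have h1 : |ξ| ^ (-2 * d + ((M * 2 : ℕ) : ℝ)) ≤ 1 :=
      Real.rpow_le_one hp.le h (by push_cast; linarith)
    refine h1.trans ?_
    rw [Real.rpow_neg hx.le, ← div_eq_mul_inv, one_le_div (Real.rpow_pos_of_pos hx _)]
    exact rpow_le_two_rpow_abs (by linarith) (by linarith)
  · rw [min_eq_left h, one_pow, one_pow, mul_one, Real.rpow_neg hx.le, ← div_eq_mul_inv,
      le_div_iff₀ (Real.rpow_pos_of_pos hx _), neg_mul, Real.rpow_neg hp.le, inv_mul_eq_div,
      ← Real.div_rpow hx.le hp.le]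
    refine rpow_le_two_rpow_abs ?_ ?_
    · rw [le_div_iff₀ hp]; linarith
    · rw [div_le_iff₀ hp]; linarith

/-- Contracting the frequency only improves the zero at the origin and costs at most 2^{uα} in the
decay; thus both scales share one envelope. -/
theorem decayEnv_two_rpow_neg_mul_le (M u : ℕ) {α : ℝ} (hα : 0 ≤ α) (ξ : ℝ) :
    decayEnv M α (2 ^ (-(u : ℝ)) * ξ) ≤ ((2 : ℝ) ^ u) ^ α * decayEnv M α ξ := by
  have hu : (1 : ℝ) ≤ 2 ^ u := one_le_pow₀ (by norm_num)
  have hx : 0 < 1 + |ξ| := by positivity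
  rw [decayEnv, decayEnv, two_rpow_neg_natCast, abs_mul, abs_inv, abs_of_pos (by positivity : (0 : ℝ) < 2 ^ u),
    inv_mul_eq_div]
  have h1 : |ξ| / 2 ^ u ≤ |ξ| := div_le_self (abs_nonneg _) hu
  have h2 : (1 + |ξ| / 2 ^ u) ^ (-α) ≤ ((1 + |ξ|) / 2 ^ u) ^ (-α) := by
    refine Real.rpow_le_rpow_of_nonpos (by positivity) ?_ (by linarith)
    rw [add_div]
    have : 1 / (2 : ℝ) ^ u ≤ 1 := by rw [div_le_one (by positivity)]; exact hu
    linarith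
  rw [Real.div_rpow hx.le (by positivity), Real.rpow_neg (x := (2 : ℝ) ^ u) (by positivity),
    div_inv_eq_mul] at h2
  calc min 1 (|ξ| / 2 ^ u) ^ M * (1 + |ξ| / 2 ^ u) ^ (-α)
      ≤ min 1 |ξ| ^ M * ((1 + |ξ|) ^ (-α) * (2 ^ u) ^ α) := by gcongr
    _ = _ := by ring

/-- Puts the aliasing error in the form of a relative error ((1+|ξ|)/N)^β times the envelope. Inside
the band (1+|ξ|)/N ≤ 1 + π, so the surplus exponent α + M - β ≥ 0 is absorbed in a constant. -/
theorem rpow_neg_mul_abs_div_pow_le {M : ℕ} {α β N ξ : ℝ} (hαβ : β ≤ α + M) (hN : 1 ≤ N)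
    (hξ : |ξ| ≤ N * Real.pi) :
    N ^ (-α) * |ξ / N| ^ M ≤
      (1 + Real.pi) ^ (α + M - β) * (((1 + |ξ|) / N) ^ β * decayEnv M α ξ) := by
  have hN0 : 0 < N := by linarith
  have hx : 0 < 1 + |ξ| := by positivity
  have hpi := Real.pi_pos
  have h1 : |ξ| ≤ min 1 |ξ| * (1 + |ξ|) := by
    rcases le_total |ξ| 1 with h | h
    · rw [min_eq_right h]; nlinarith [abs_nonneg ξ]
    · rw [min_eq_left h]; linarith
  have h2 : ((1 + |ξ|) / N) ^ (α + M - β) ≤ (1 + Real.pi) ^ (α + M - β) := by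
    refine Real.rpow_le_rpow (by positivity) ?_ (by linarith)
    rw [div_le_iff₀ hN0]; nlinarith
  have h3 : N ^ (-α) * ((1 + |ξ|) / N) ^ M =
      ((1 + |ξ|) / N) ^ (α + M - β) * ((1 + |ξ|) / N) ^ β * (1 + |ξ|) ^ (-α) := by
    rw [← Real.rpow_add (by positivity), sub_add_cancel, Real.rpow_add (by positivity),
      Real.rpow_natCast, Real.div_rpow hx.le hN0.le, Real.rpow_neg hN0.le, Real.rpow_neg hx.le]
    field_simp
  rw [abs_div, abs_of_pos hN0]
  calc N ^ (-α) * (|ξ| / N) ^ M ≤ N ^ (-α) * (min 1 |ξ| * (1 + |ξ|) / N) ^ M := by gcongr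
    _ = min 1 |ξ| ^ M * (N ^ (-α) * ((1 + |ξ|) / N) ^ M) := by rw [mul_div_assoc, mul_pow]; ring
    _ = ((1 + |ξ|) / N) ^ (α + M - β) * (((1 + |ξ|) / N) ^ β * decayEnv M α ξ) := by
      rw [h3, decayEnv]; ring
    _ ≤ _ := by
      have := decayEnv_nonneg M α ξ
      gcongr

theorem exists_abs_rpow_sub_one_le {c : ℝ} (hc : 0 < c) (p : ℝ) :
    ∃ C : ℝ, 0 ≤ C ∧ ∀ s, c ≤ s → s ≤ 1 → |s ^ p - 1| ≤ C * (1 - s) := by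
  refine ⟨|p| / c * Real.exp (|p| / c), by positivity, fun s hcs hs => ?_⟩
  have hs0 : 0 < s := hc.trans_le hcs
  have hlog : |Real.log s| ≤ (1 - s) / c := by
    rw [abs_of_nonpos (Real.log_nonpos hs0.le hs)]
    have h1 := Real.one_sub_inv_le_log_of_pos hs0
    have h2 : s⁻¹ - 1 ≤ (1 - s) / c := by
      rw [show s⁻¹ - 1 = (1 - s) / s by field_simp]
      exact div_le_div_of_nonneg_left (by linarith) hc hcs
    linarith
  have hpl : |Real.log s * p| ≤ |p| / c * (1 - s) := by
    rw [abs_mul, mul_comm]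
    calc |p| * |Real.log s| ≤ |p| * ((1 - s) / c) := by gcongr
      _ = _ := by ring
  have hpl2 : |Real.log s * p| ≤ |p| / c :=
    hpl.trans (mul_le_of_le_one_right (by positivity) (by linarith))
  rw [Real.rpow_def_of_pos hs0]
  have h3 : |Real.exp (Real.log s * p) - 1| ≤ |Real.log s * p| * Real.exp |Real.log s * p| := by
    have := Complex.norm_exp_sub_sum_le_norm_mul_exp ((Real.log s * p : ℝ) : ℂ) 1
    rw [show Complex.exp ((Real.log s * p : ℝ) : ℂ) - ∑ m ∈ Finset.range 1,
        ((Real.log s * p : ℝ) : ℂ) ^ m / (m.factorial : ℂ) =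
        ((Real.exp (Real.log s * p) - 1 : ℝ) : ℂ) by simp, Complex.norm_real, Complex.norm_real,
      pow_one] at this
    exact this
  calc _ ≤ |Real.log s * p| * Real.exp |Real.log s * p| := h3
    _ ≤ |p| / c * (1 - s) * Real.exp (|p| / c) := by gcongr
    _ = _ := by ring

theorem norm_one_sub_exp_eq (ξ : ℝ) :
    ‖1 - Complex.exp (-(Complex.I * ξ))‖ = 2 * |Real.sin (ξ / 2)| := by
  rw [← norm_exp_I_sub_one, Complex.norm_exp_I_mul_ofReal_sub_one, norm_mul, Real.norm_eq_abs,
    Real.norm_eq_abs, abs_two]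

/-- The ratio is sin(|ξ|/2)/(|ξ|/2), which lies between 2/π and 1 by Jordan's inequality, and is 1 +
O(ξ²) by the cubic lower bound for sine. On an interval away from 0 the power map is Lipschitz. -/
theorem exists_abs_norm_one_sub_exp_div_rpow_sub_one_le (p : ℝ) :
    ∃ C : ℝ, 0 ≤ C ∧ ∀ ξ, ξ ≠ 0 → |ξ| ≤ Real.pi →
      |(‖1 - Complex.exp (-(Complex.I * ξ))‖ / |ξ|) ^ p - 1| ≤ C * ξ ^ 2 := by
  have hpi := Real.pi_pos
  obtain ⟨C, hC, h⟩ := exists_abs_rpow_sub_one_le (c := 2 / Real.pi) (by positivity) p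
  refine ⟨C, hC, fun ξ h0 hξ => ?_⟩
  have hp : 0 < |ξ| := abs_pos.2 h0
  rw [norm_one_sub_exp_eq]
  have habs : |Real.sin (ξ / 2)| = Real.sin (|ξ| / 2) := by
    rcases le_total 0 ξ with h | h
    · rw [abs_of_nonneg h] at hξ ⊢
      exact abs_of_nonneg (Real.sin_nonneg_of_nonneg_of_le_pi (by linarith) (by linarith))
    · rw [abs_of_nonpos h] at hξ ⊢
      rw [neg_div, Real.sin_neg]
      refine abs_of_nonpos ?_
      have := Real.sin_nonneg_of_nonneg_of_le_pi (x := -ξ / 2) (by linarith) (by linarith)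
      rw [neg_div, Real.sin_neg] at this
      linarith
  rw [habs]
  have hlow := Real.mul_le_sin (x := |ξ| / 2) (by linarith) (by linarith)
  have hup := Real.sin_le (x := |ξ| / 2) (by linarith)
  refine (h _ ?_ ?_).trans (mul_le_mul_of_nonneg_left ?_ hC)
  · rw [le_div_iff₀ hp]; linarith
  · rw [div_le_one hp]; linarith
  · rw [← sq_abs]
    rcases le_total |ξ| 1 with h1 | h1
    · have h2 := Real.sin_gt_sub_cube (x := |ξ| / 2) (by linarith)
      rw [sub_le_iff_le_add, ← sub_le_iff_le_add', le_div_iff₀ hp]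
      nlinarith [pow_pos hp 3]
    · have : 0 ≤ 2 * Real.sin (|ξ| / 2) / |ξ| := by
        have : 0 ≤ Real.sin (|ξ| / 2) := le_trans (by positivity) hlow
        positivity
      nlinarith

/-- Bookkeeping for the product of two approximate transfer functions and a weight: each source of
error has relative size ρ, and since ρ ≤ A the quadratic errors are again O(ρ). The scaling function
enters the main term only through |p|², which is close to 1. -/
theorem norm_mul_conj_mul_sub_le {A ρ E w : ℝ} {H H' p a a' : ℂ} (hρ0 : 0 ≤ ρ) (hρ : ρ ≤ A)
    (hH : ‖H - p * a‖ ≤ A * (ρ * E)) (hH' : ‖H' - p * a'‖ ≤ A * (ρ * E))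
    (hp : ‖p‖ ≤ A) (hp1 : |‖p‖ ^ 2 - 1| ≤ A * ρ) (ha : ‖a‖ ≤ A * E) (ha' : ‖a'‖ ≤ A * E)
    (hw : |w - 1| ≤ A * ρ) :
    ‖H * (starRingEnd ℂ) H' * w - a * (starRingEnd ℂ) a'‖ ≤
      ((1 + A ^ 2) * (3 * A ^ 3) + (2 + A ^ 2) * A ^ 3) * (ρ * E ^ 2) := by
  have hA : 0 ≤ A := hρ0.trans hρ
  have hρA : A * ρ ≤ A ^ 2 := by rw [sq]; gcongr
  have hw' : |w| ≤ 1 + A ^ 2 := by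
    have := abs_add_le (w - 1) 1
    rw [sub_add_cancel, abs_one] at this
    linarith
  have key : H * (starRingEnd ℂ) H' * w - a * (starRingEnd ℂ) a' =
      w * ((H - p * a) * (starRingEnd ℂ) (H' - p * a') +
        ((H - p * a) * (starRingEnd ℂ) (p * a') + p * a * (starRingEnd ℂ) (H' - p * a'))) +
      ((w * (‖p‖ ^ 2 - 1) + (w - 1) : ℝ) : ℂ) * (a * (starRingEnd ℂ) a') := by
    have : ((‖p‖ ^ 2 : ℝ) : ℂ) = p * (starRingEnd ℂ) p := by
      rw [Complex.mul_conj, Complex.normSq_eq_norm_sq]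
    push_cast at this ⊢
    rw [this]
    simp only [map_sub, map_mul]
    ring
  rw [key]
  have hr : |w * (‖p‖ ^ 2 - 1) + (w - 1)| ≤ (2 + A ^ 2) * (A * ρ) := by
    refine (abs_add_le _ _).trans ?_
    rw [abs_mul]
    calc |w| * |‖p‖ ^ 2 - 1| + |w - 1| ≤ (1 + A ^ 2) * (A * ρ) + A * ρ := by gcongr
      _ = _ := by ring
  have hpa : ‖p * a‖ ≤ A * (A * E) := by rw [norm_mul]; gcongr
  have hpa' : ‖p * a'‖ ≤ A * (A * E) := by rw [norm_mul]; gcongr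
  have hE : 0 ≤ A * (ρ * E) := (norm_nonneg _).trans hH
  have hE2 : 0 ≤ A * (A * E) := (norm_nonneg _).trans hpa
  have hE3 : 0 ≤ A * E := (norm_nonneg _).trans ha
  calc _ ≤ |w| * (‖H - p * a‖ * ‖H' - p * a'‖ + (‖H - p * a‖ * ‖p * a'‖ +
        ‖p * a‖ * ‖H' - p * a'‖)) + |w * (‖p‖ ^ 2 - 1) + (w - 1)| * (‖a‖ * ‖a'‖) := by
        refine (norm_add_le _ _).trans (add_le_add ?_ ?_)
        · rw [norm_mul, Complex.norm_real, Real.norm_eq_abs]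
          refine mul_le_mul_of_nonneg_left ?_ (abs_nonneg _)
          refine (norm_add_le _ _).trans (add_le_add ?_ ((norm_add_le _ _).trans (add_le_add ?_ ?_)))
          all_goals rw [norm_mul, Complex.norm_conj]
        · rw [norm_mul, norm_mul, Complex.norm_conj, Complex.norm_real, Real.norm_eq_abs]
    _ ≤ (1 + A ^ 2) * ((A * (ρ * E)) * (A * (ρ * E)) + ((A * (ρ * E)) * (A * (A * E)) +
        (A * (A * E)) * (A * (ρ * E)))) + (2 + A ^ 2) * (A * ρ) * ((A * E) * (A * E)) := by
        gcongr
    _ ≤ (1 + A ^ 2) * (A ^ 3 * (ρ * E ^ 2) + 2 * A ^ 3 * (ρ * E ^ 2)) +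
        (2 + A ^ 2) * A ^ 3 * (ρ * E ^ 2) := by
        have : (A * (ρ * E)) * (A * (ρ * E)) ≤ A ^ 3 * (ρ * E ^ 2) := by
          calc _ = A ^ 2 * (ρ * E ^ 2) * ρ := by ring
            _ ≤ A ^ 2 * (ρ * E ^ 2) * A := by gcongr
            _ = _ := by ring
        have h2 : (A * (ρ * E)) * (A * (A * E)) + (A * (A * E)) * (A * (ρ * E)) =
          2 * A ^ 3 * (ρ * E ^ 2) := by ring
        have h3 : (2 + A ^ 2) * (A * ρ) * ((A * E) * (A * E)) =
          (2 + A ^ 2) * A ^ 3 * (ρ * E ^ 2) := by ring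
        rw [h2, h3]
        gcongr
    _ = _ := by ring

/-- The entry of `eVec` of index `v`. -/
noncomputable def phase (u v : ℕ) (ξ : ℝ) : ℂ :=
  (((2 : ℝ) ^ (-(u : ℝ) / 2) : ℝ) : ℂ) *
    Complex.exp (-(Complex.I * (v : ℂ) * (((2 : ℝ) ^ (-(u : ℝ)) * ξ : ℝ) : ℂ)))

theorem norm_phase_le (u v : ℕ) (ξ : ℝ) : ‖phase u v ξ‖ ≤ 1 := by
  rw [phase, norm_mul, Complex.norm_real, Real.norm_of_nonneg (by positivity),
    show -(Complex.I * (v : ℂ) * (((2 : ℝ) ^ (-(u : ℝ)) * ξ : ℝ) : ℂ)) =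
      ((-(v * (2 ^ (-(u : ℝ)) * ξ)) : ℝ) : ℂ) * Complex.I by push_cast; ring,
    Complex.norm_exp_ofReal_mul_I, mul_one]
  refine Real.rpow_le_one_of_one_le_of_nonpos (by norm_num) ?_
  have : (0 : ℝ) ≤ u := u.cast_nonneg
  linarith

theorem continuous_phase (u v : ℕ) : Continuous (phase u v) := by
  unfold phase; fun_prop

/-- The limiting kernel, whose periodization is a coordinate of `DInf`. -/
noncomputable def limitKernel (ψ : ℝ → ℝ) (d : ℝ) (u v : ℕ) (ξ : ℝ) : ℂ :=
  ((|ξ| ^ (-2 * d) : ℝ) : ℂ) * (starRingEnd ℂ) (fourier ψ ξ) *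
    fourier ψ ((2 : ℝ) ^ (-(u : ℝ)) * ξ) * phase u v ξ

/-- The kernel representing, after rescaling, the covariances of the wavelet coefficients at
scales `i + u` and `i`. -/
noncomputable def scaleKernel (φ ψ : ℝ → ℝ) (T : ℕ) (d : ℝ) (fstar : ℝ → ℝ) (u i v : ℕ) :
    ℝ → ℂ :=
  Set.indicator (Set.Ioo (-(2 ^ (i + u) * Real.pi)) (2 ^ (i + u) * Real.pi)) fun ξ =>
    (((2 : ℝ) ^ (-((i + u : ℕ) : ℝ) / 2) : ℝ) : ℂ) * transferFun φ ψ T (i + u) (ξ / 2 ^ (i + u)) *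
    (starRingEnd ℂ) ((((2 : ℝ) ^ (-(i : ℝ) / 2) : ℝ) : ℂ) *
      transferFun φ ψ T i (ξ / 2 ^ (i + u))) *
    ((((2 : ℝ) ^ (i + u)) ^ (-2 * d) *
      ‖1 - Complex.exp (-(Complex.I * (ξ / 2 ^ (i + u) : ℝ)))‖ ^ (-2 * d) *
      (fstar (ξ / 2 ^ (i + u)) / fstar 0) : ℝ) : ℂ) * phase u v ξ

/-! ### Size of the limiting kernel and rate of convergence of the rescaled kernel -/

section Kernel

variable {φ ψ : ℝ → ℝ} {α β L : ℝ} {M : ℕ} {T : ℕ} {d : ℝ} {fstar : ℝ → ℝ}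

theorem exists_norm_limitKernel_le (hW : WaveletAssumptions φ ψ α M)
    (hψ : Function.support ψ ⊆ Set.Ioo 0 (T : ℝ)) (hd : d ≤ M) (u : ℕ) :
    ∃ C : ℝ, 0 ≤ C ∧ ∀ (v : ℕ) (ξ : ℝ), ξ ≠ 0 →
      ‖limitKernel ψ d u v ξ‖ ≤ C * (1 + |ξ|) ^ (-(2 * d + 2 * α)) := by
  obtain ⟨B, hB0, hB⟩ := exists_norm_fourier_wavelet_le hW hψ
  have hα := hW.one_lt_alpha
  refine ⟨B * (B * (2 ^ u) ^ α) * 2 ^ |2 * d|, by positivity, fun v ξ h0 => ?_⟩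
  have hE := decayEnv_nonneg M α ξ
  have h2 : ‖fourier ψ ((2 : ℝ) ^ (-(u : ℝ)) * ξ)‖ ≤ B * ((2 ^ u) ^ α * decayEnv M α ξ) :=
    (hB _).trans (mul_le_mul_of_nonneg_left
      (decayEnv_two_rpow_neg_mul_le M u (by linarith) ξ) hB0.le)
  rw [limitKernel, norm_mul, norm_mul, norm_mul, Complex.norm_real,
    Real.norm_of_nonneg (by positivity), Complex.norm_conj]
  calc _ ≤ |ξ| ^ (-2 * d) * (B * decayEnv M α ξ) * (B * ((2 ^ u) ^ α * decayEnv M α ξ)) * 1 := by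
        gcongr
        · exact hB ξ
        · exact norm_phase_le u v ξ
    _ = B * (B * (2 ^ u) ^ α) * (|ξ| ^ (-2 * d) * decayEnv M α ξ ^ 2) := by ring
    _ ≤ B * (B * (2 ^ u) ^ α) * (2 ^ |2 * d| * (1 + |ξ|) ^ (-(2 * d + 2 * α))) :=
        mul_le_mul_of_nonneg_left (abs_rpow_mul_decayEnv_sq_le hd h0) (by positivity)
    _ = _ := by ring

/-- The smoothness class gives relative error O(|ξ|^β) for the short-range density; the sine factor
contributes O(ξ²), which is O(|ξ|^β) on [-π, π] because β ≤ 2. -/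
theorem exists_abs_weight_sub_one_le (hβ : β ∈ Set.Ioc (0 : ℝ) 2)
    (hf : fstar ∈ smoothClass β L) (hf0 : 0 < fstar 0) (hL : 0 < L) (d : ℝ) :
    ∃ C : ℝ, 0 ≤ C ∧ ∀ ξ, ξ ≠ 0 → |ξ| ≤ Real.pi →
      |(‖1 - Complex.exp (-(Complex.I * ξ))‖ / |ξ|) ^ (-2 * d) * (fstar ξ / fstar 0) - 1| ≤
        C * |ξ| ^ β := by
  obtain ⟨C, hC, h⟩ := exists_abs_norm_one_sub_exp_div_rpow_sub_one_le (-2 * d)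
  have hpi := Real.pi_pos
  refine ⟨C * Real.pi ^ (2 - β) * (1 + L * Real.pi ^ β) + L, by positivity, fun ξ h0 hξ => ?_⟩
  have hp : 0 < |ξ| := abs_pos.2 h0
  obtain ⟨-, -, hf3⟩ := hf ξ ⟨by linarith [neg_abs_le ξ], by linarith [le_abs_self ξ]⟩
  have h1 : |fstar ξ / fstar 0 - 1| ≤ L * |ξ| ^ β := by
    rw [div_sub_one hf0.ne', abs_div, abs_of_pos hf0, div_le_iff₀ hf0]
    linarith
  have h2 : |fstar ξ / fstar 0| ≤ 1 + L * Real.pi ^ β := by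
    have := abs_add_le (fstar ξ / fstar 0 - 1) 1
    rw [sub_add_cancel, abs_one] at this
    have h3 : L * |ξ| ^ β ≤ L * Real.pi ^ β := by
      have := hβ.1.le
      gcongr
    linarith
  have h3 : C * ξ ^ 2 ≤ C * Real.pi ^ (2 - β) * |ξ| ^ β := by
    have : ξ ^ 2 = |ξ| ^ (2 - β) * |ξ| ^ β := by
      rw [← Real.rpow_add hp, sub_add_cancel, ← sq_abs]
      exact_mod_cast (Real.rpow_natCast |ξ| 2).symm
    rw [this, mul_assoc]
    have := hβ.2
    gcongr
  set q := (‖1 - Complex.exp (-(Complex.I * ξ))‖ / |ξ|) ^ (-2 * d)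
  set r := fstar ξ / fstar 0
  calc |q * r - 1| = |(q - 1) * r + (r - 1)| := by congr 1; ring
    _ ≤ |q - 1| * |r| + |r - 1| := by
        refine (abs_add_le _ _).trans ?_
        rw [abs_mul]
    _ ≤ (C * Real.pi ^ (2 - β) * |ξ| ^ β) * (1 + L * Real.pi ^ β) + L * |ξ| ^ β := by
        gcongr
        exact (h ξ h0 hξ).trans h3
    _ = _ := by ring

set_option maxHeartbeats 1000000 in
/-- Uniform approximation of the rescaled kernel by its limit. -/
theorem exists_norm_scaleKernel_sub_le (hW : WaveletAssumptions φ ψ α M) (hM : 1 ≤ M)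
    (hφ : Function.support φ ⊆ Set.Ioo (-(T : ℝ)) 0)
    (hψ : Function.support ψ ⊆ Set.Ioo 0 (T : ℝ)) (hβ : β ∈ Set.Ioc (0 : ℝ) 2) (hL : 0 < L)
    (hd : d ≤ M) (hf : fstar ∈ smoothClass β L) (hf0 : 0 < fstar 0) (u : ℕ) :
    ∃ C : ℝ, 0 ≤ C ∧ ∀ (i v : ℕ) (ξ : ℝ), ξ ≠ 0 →
      ‖scaleKernel φ ψ T d fstar u i v ξ - limitKernel ψ d u v ξ‖ ≤
        C * ((2 : ℝ) ^ (i + u)) ^ (-β) * (1 + |ξ|) ^ (-(2 * d + 2 * α - β)) := by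
  obtain ⟨B, hB0, hB⟩ := exists_norm_fourier_wavelet_le hW hψ
  obtain ⟨C1, hC1, h1⟩ := exists_norm_transferFun_sub_le hW hφ hψ
  obtain ⟨C2, hC2, h2⟩ := exists_abs_norm_fourier_sq_sub_one_le hW hφ
  obtain ⟨C3, hC3, h3⟩ := exists_abs_weight_sub_one_le hβ hf hf0 hL d
  obtain ⟨C4, hC4, h4⟩ := exists_norm_limitKernel_le hW hψ hd u
  have hα := hW.one_lt_alpha
  have hpi := Real.pi_pos
  have hI0 : 0 ≤ ∫ t, ‖φ t‖ := integral_nonneg fun t => norm_nonneg _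
  have hαβ : β ≤ α + M := by
    have : (1 : ℝ) ≤ M := by exact_mod_cast hM
    linarith [hβ.2]
  have hu1 : 1 ≤ ((2 : ℝ) ^ u) ^ α :=
    Real.one_le_rpow (one_le_pow₀ (by norm_num)) (by linarith)
  set D := (1 + Real.pi) ^ (α + M - β) with hD
  have hD0 : 0 ≤ D := by positivity
  -- One constant dominating all error constants, as the product estimate `norm_mul_conj_mul_sub_le`
  -- expects.
  obtain ⟨A, hA1, hA2, hA3, hA4, hA5, hA6⟩ : ∃ A : ℝ, (1 + Real.pi) ^ β ≤ A ∧
      C1 * ((2 ^ u) ^ α * D) ≤ A ∧ (∫ t, ‖φ t‖) ≤ A ∧ C2 * (1 + Real.pi) ^ (2 - β) ≤ A ∧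
      C3 ≤ A ∧ B * (2 ^ u) ^ α ≤ A := by
    have p1 : 0 ≤ (1 + Real.pi) ^ β := by positivity
    have p2 : 0 ≤ C1 * ((2 ^ u) ^ α * D) := by positivity
    have p4 : 0 ≤ C2 * (1 + Real.pi) ^ (2 - β) := by positivity
    have p6 : 0 ≤ B * ((2 : ℝ) ^ u) ^ α := by positivity
    generalize (1 + Real.pi) ^ β = q1 at *
    generalize C1 * ((2 ^ u) ^ α * D) = q2 at *
    generalize C2 * (1 + Real.pi) ^ (2 - β) = q4 at *
    generalize B * ((2 : ℝ) ^ u) ^ α = q6 at *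
    exact ⟨q1 + q2 + (∫ t, ‖φ t‖) + q4 + C3 + q6, by linarith, by linarith, by linarith,
      by linarith, by linarith, by linarith⟩
  have hA0 : 0 ≤ A := hI0.trans hA3
  set C5 := ((1 + A ^ 2) * (3 * A ^ 3) + (2 + A ^ 2) * A ^ 3) * 2 ^ |2 * d| with hC5
  have hC50 : 0 ≤ C5 := by positivity
  refine ⟨C5 + C4, by positivity, fun i v ξ h0 => ?_⟩
  set N : ℝ := 2 ^ (i + u) with hN
  have hN1 : 1 ≤ N := one_le_pow₀ (by norm_num)
  have hN0 : 0 < N := by linarith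
  have hx : 0 < 1 + |ξ| := by positivity
  have hp : 0 < |ξ| := abs_pos.2 h0
  have hE := decayEnv_nonneg M α ξ
  -- The relative error ρ = ((1+|ξ|)/N)^β trades β powers of decay for the rate N^{-β}.
  have hρ : ((1 + |ξ|) / N) ^ β * (1 + |ξ|) ^ (-(2 * d + 2 * α)) =
      N ^ (-β) * (1 + |ξ|) ^ (-(2 * d + 2 * α - β)) := by
    rw [Real.div_rpow hx.le hN0.le, div_eq_mul_inv, ← Real.rpow_neg hN0.le, mul_right_comm,
      ← Real.rpow_add hx, mul_comm]
    congr 2; ring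
  have hrhs : 0 ≤ N ^ (-β) * (1 + |ξ|) ^ (-(2 * d + 2 * α - β)) := by positivity
  rw [mul_assoc, add_mul]
  by_cases hmem : ξ ∈ Set.Ioo (-(N * Real.pi)) (N * Real.pi)
  · refine le_trans ?_ (le_add_of_nonneg_right (mul_nonneg hC4 hrhs))
    have hξ : |ξ| ≤ N * Real.pi := (abs_lt.2 hmem).le
    have hlm : |ξ / N| ≤ Real.pi := by
      rw [abs_div, abs_of_pos hN0, div_le_iff₀ hN0]; linarith
    have hlm0 : ξ / N ≠ 0 := div_ne_zero h0 hN0.ne'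
    set ρ := ((1 + |ξ|) / N) ^ β with hρd
    have hρ0 : 0 ≤ ρ := by positivity
    have hy : (1 + |ξ|) / N ≤ 1 + Real.pi := by
      rw [div_le_iff₀ hN0]; nlinarith
    have hρA : ρ ≤ A := (Real.rpow_le_rpow (by positivity) hy hβ.1.le).trans hA1
    have hR := rpow_neg_mul_abs_div_pow_le (M := M) hαβ hN1 hξ
    have hlam : |ξ / N| ≤ (1 + |ξ|) / N := by
      rw [abs_div, abs_of_pos hN0]
      gcongr
      linarith
    rw [scaleKernel, Set.indicator_of_mem (by exact hmem), limitKernel, ← sub_mul, norm_mul]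
    refine (mul_le_of_le_one_right (norm_nonneg _) (norm_phase_le u v ξ)).trans ?_
    -- The homogeneous factor |ξ|^{-2d} of the limit is extracted, leaving a weight close to 1.
    have hw : N ^ (-2 * d) * ‖1 - Complex.exp (-(Complex.I * (ξ / N : ℝ)))‖ ^ (-2 * d) *
        (fstar (ξ / N) / fstar 0) = |ξ| ^ (-2 * d) *
        ((‖1 - Complex.exp (-(Complex.I * (ξ / N : ℝ)))‖ / |ξ / N|) ^ (-2 * d) *
          (fstar (ξ / N) / fstar 0)) := by
      rw [← mul_assoc, ← Real.mul_rpow hN0.le (norm_nonneg _),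
        ← Real.mul_rpow (abs_nonneg _) (by positivity), abs_div, abs_of_pos hN0]
      congr 2
      field_simp
    rw [hw]
    have hψ2 : (2 : ℝ) ^ i * (ξ / N) = (2 : ℝ) ^ (-(u : ℝ)) * ξ := by
      rw [two_rpow_neg_natCast, hN, pow_add]; field_simp
    have hψ1 : (2 : ℝ) ^ (i + u) * (ξ / N) = ξ := by rw [← hN]; field_simp
    have hH1 := h1 (i + u) (ξ / N) hlm
    have hH2 := h1 i (ξ / N) hlm
    rw [hψ1] at hH1
    rw [hψ2] at hH2
    have key := norm_mul_conj_mul_sub_le (A := A) (ρ := ρ) (E := decayEnv M α ξ)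
      (w := (‖1 - Complex.exp (-(Complex.I * (ξ / N : ℝ)))‖ / |ξ / N|) ^ (-2 * d) *
          (fstar (ξ / N) / fstar 0))
      (H := (((2 : ℝ) ^ (-((i + u : ℕ) : ℝ) / 2) : ℝ) : ℂ) * transferFun φ ψ T (i + u) (ξ / N))
      (H' := (((2 : ℝ) ^ (-(i : ℝ) / 2) : ℝ) : ℂ) * transferFun φ ψ T i (ξ / N))
      (p := fourier φ (ξ / N)) (a := (starRingEnd ℂ) (fourier ψ ξ))
      (a' := (starRingEnd ℂ) (fourier ψ ((2 : ℝ) ^ (-(u : ℝ)) * ξ))) hρ0 hρA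
      ?_ ?_ ((norm_fourier_le φ _).trans hA3) ?_ ?_ ?_ ?_
    · rw [Complex.conj_conj] at key
      rw [Complex.ofReal_mul]
      set H := (((2 : ℝ) ^ (-((i + u : ℕ) : ℝ) / 2) : ℝ) : ℂ) * transferFun φ ψ T (i + u) (ξ / N)
      set H' := (((2 : ℝ) ^ (-(i : ℝ) / 2) : ℝ) : ℂ) * transferFun φ ψ T i (ξ / N)
      set w := (‖1 - Complex.exp (-(Complex.I * (ξ / N : ℝ)))‖ / |ξ / N|) ^ (-2 * d) *
          (fstar (ξ / N) / fstar 0)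
      rw [show ∀ a c : ℂ, H * (starRingEnd ℂ) H' * (((|ξ| ^ (-2 * d) : ℝ) : ℂ) * (w : ℂ)) -
          ((|ξ| ^ (-2 * d) : ℝ) : ℂ) * a * c = ((|ξ| ^ (-2 * d) : ℝ) : ℂ) *
          (H * (starRingEnd ℂ) H' * w - a * c) from fun a c => by ring, norm_mul,
        Complex.norm_real, Real.norm_of_nonneg (by positivity)]
      calc _ ≤ |ξ| ^ (-2 * d) * (((1 + A ^ 2) * (3 * A ^ 3) + (2 + A ^ 2) * A ^ 3) *
            (ρ * decayEnv M α ξ ^ 2)) := by gcongr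
        _ = ((1 + A ^ 2) * (3 * A ^ 3) + (2 + A ^ 2) * A ^ 3) *
            (ρ * (|ξ| ^ (-2 * d) * decayEnv M α ξ ^ 2)) := by ring
        _ ≤ ((1 + A ^ 2) * (3 * A ^ 3) + (2 + A ^ 2) * A ^ 3) *
            (ρ * (2 ^ |2 * d| * (1 + |ξ|) ^ (-(2 * d + 2 * α)))) :=
            mul_le_mul_of_nonneg_left (mul_le_mul_of_nonneg_left
              (abs_rpow_mul_decayEnv_sq_le hd h0) hρ0) (by positivity)
        _ = C5 * (ρ * (1 + |ξ|) ^ (-(2 * d + 2 * α))) := by rw [hC5]; ring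
        _ = _ := by rw [hρ]
    · refine hH1.trans ?_
      rw [← hN, mul_assoc]
      calc C1 * (N ^ (-α) * |ξ / N| ^ M) ≤ C1 * (D * (ρ * decayEnv M α ξ)) := by gcongr
        _ ≤ C1 * ((2 ^ u) ^ α * D) * (ρ * decayEnv M α ξ) := by
          rw [mul_assoc]
          refine mul_le_mul_of_nonneg_left ?_ hC1
          rw [mul_assoc]
          exact le_mul_of_one_le_left (by positivity) hu1
        _ ≤ _ := by gcongr
    · refine hH2.trans ?_
      have : ((2 : ℝ) ^ i) ^ (-α) = (2 ^ u) ^ α * N ^ (-α) := by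
        rw [hN, pow_add, Real.mul_rpow (by positivity) (by positivity),
          Real.rpow_neg (x := (2 : ℝ) ^ u) (by positivity)]
        field_simp
      rw [this]
      calc C1 * ((2 ^ u) ^ α * N ^ (-α)) * |ξ / N| ^ M
          = C1 * (2 ^ u) ^ α * (N ^ (-α) * |ξ / N| ^ M) := by ring
        _ ≤ C1 * (2 ^ u) ^ α * (D * (ρ * decayEnv M α ξ)) := by gcongr
        _ = C1 * ((2 ^ u) ^ α * D) * (ρ * decayEnv M α ξ) := by ring
        _ ≤ _ := by gcongr
    · refine (h2 _).trans ?_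
      have h5 : (ξ / N) ^ 2 ≤ (1 + Real.pi) ^ (2 - β) * ρ := by
        calc (ξ / N) ^ 2 = |ξ / N| ^ 2 := (sq_abs _).symm
          _ ≤ ((1 + |ξ|) / N) ^ 2 := by gcongr
          _ = ((1 + |ξ|) / N) ^ (2 - β) * ρ := by
            rw [hρd, ← Real.rpow_add (by positivity), sub_add_cancel]
            exact_mod_cast (Real.rpow_natCast _ 2).symm
          _ ≤ _ := by
            refine mul_le_mul_of_nonneg_right ?_ hρ0
            exact Real.rpow_le_rpow (by positivity) hy (by linarith [hβ.2])
      calc C2 * (ξ / N) ^ 2 ≤ C2 * ((1 + Real.pi) ^ (2 - β) * ρ) := by gcongr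
        _ = C2 * (1 + Real.pi) ^ (2 - β) * ρ := by ring
        _ ≤ A * ρ := by gcongr
    · rw [Complex.norm_conj]
      refine (hB ξ).trans (mul_le_mul_of_nonneg_right ?_ hE)
      exact (le_mul_of_one_le_right hB0.le hu1).trans hA6
    · rw [Complex.norm_conj]
      refine (hB _).trans ?_
      calc _ ≤ B * ((2 ^ u) ^ α * decayEnv M α ξ) :=
            mul_le_mul_of_nonneg_left (decayEnv_two_rpow_neg_mul_le M u (by linarith) ξ) hB0.le
        _ = B * (2 ^ u) ^ α * decayEnv M α ξ := by ring
        _ ≤ _ := by gcongr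
    · refine (h3 _ hlm0 hlm).trans ?_
      exact (mul_le_mul_of_nonneg_left (Real.rpow_le_rpow (abs_nonneg _) hlam hβ.1.le) hC3).trans
        (mul_le_mul_of_nonneg_right hA5 hρ0)
  -- Outside the band only the limiting kernel remains; there |ξ| ≥ Nπ, so ρ ≥ 1 and the size bound
  -- on the limit already suffices.
  · refine le_trans ?_ (le_add_of_nonneg_left (mul_nonneg hC50 hrhs))
    rw [scaleKernel, Set.indicator_of_notMem (by exact hmem), zero_sub, norm_neg, ← hρ]
    refine (h4 v ξ h0).trans (mul_le_mul_of_nonneg_left ?_ hC4)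
    refine le_mul_of_one_le_left (by positivity) (Real.one_le_rpow ?_ hβ.1.le)
    have : N * Real.pi ≤ |ξ| := by
      by_contra hlt
      exact hmem (abs_lt.1 (not_le.1 hlt))
    rw [le_div_iff₀ hN0]
    nlinarith [Real.pi_gt_three]

end Kernel

/-! ### Fourier coefficients of functions on the line -/

theorem summable_one_add_abs_int_rpow {p : ℝ} (hp : 1 < p) :
    Summable fun l : ℤ => (1 + |(l : ℝ)|) ^ (-p) := by
  refine Summable.of_norm_bounded_eventually (Real.summable_abs_int_rpow hp) ?_
  have : {(0 : ℤ)}ᶜ ∈ (cofinite : Filter ℤ) := (Set.finite_singleton 0).compl_mem_cofinite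
  filter_upwards [this] with l hl
  have hl0 : 0 < |(l : ℝ)| := abs_pos.2 (by exact_mod_cast hl)
  rw [Real.norm_of_nonneg (by positivity)]
  exact Real.rpow_le_rpow_of_nonpos hl0 (by linarith) (by linarith)

theorem integrable_one_add_abs_rpow {p : ℝ} (hp : 1 < p) :
    Integrable fun ξ : ℝ => (1 + |ξ|) ^ (-p) :=
  integrable_one_add_norm (E := ℝ) (by simpa using hp)

theorem one_add_abs_int_le {x : ℝ} (hx : x ∈ Set.Ioc (-Real.pi) Real.pi) (l : ℤ) :
    1 + |(l : ℝ)| ≤ 1 + |x + 2 * l * Real.pi| := by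
  rcases eq_or_ne l 0 with rfl | hl
  · simp
  have h1 : (1 : ℝ) ≤ |(l : ℝ)| := by exact_mod_cast Int.one_le_abs hl
  have h2 : |x| ≤ Real.pi := abs_le.2 ⟨hx.1.le, hx.2⟩
  have h3 : |2 * l * Real.pi| = 2 * |(l : ℝ)| * Real.pi := by
    rw [abs_mul, abs_mul, abs_two, abs_of_pos Real.pi_pos]
  have h4 := abs_sub_abs_le_abs_sub (2 * l * Real.pi) (-x)
  rw [sub_neg_eq_add, abs_neg, h3, add_comm] at h4
  nlinarith [Real.pi_gt_three]

theorem add_two_mul_int_mul_pi_ne_zero {x : ℝ} (hx : x ∈ Set.Ioc (-Real.pi) Real.pi)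
    (h0 : x ≠ 0) (l : ℤ) : x + 2 * l * Real.pi ≠ 0 := by
  rcases eq_or_ne l 0 with rfl | hl
  · simpa using h0
  intro h
  have := one_add_abs_int_le hx l
  rw [h, abs_zero] at this
  have h1 : (1 : ℝ) ≤ |(l : ℝ)| := by exact_mod_cast Int.one_le_abs hl
  linarith

/-! ### Parseval's identity for 2π-periodizations -/

section Periodization

variable {G : ℝ → ℂ} {B p : ℝ}

theorem norm_add_two_mul_int_mul_pi_le (hp : 1 < p) (hB0 : 0 ≤ B)
    (hB : ∀ ξ, ξ ≠ 0 → ‖G ξ‖ ≤ B * (1 + |ξ|) ^ (-p)) {x : ℝ}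
    (hx : x ∈ Set.Ioc (-Real.pi) Real.pi) (h0 : x ≠ 0) (l : ℤ) :
    ‖G (x + 2 * l * Real.pi)‖ ≤ B * (1 + |(l : ℝ)|) ^ (-p) := by
  refine (hB _ (add_two_mul_int_mul_pi_ne_zero hx h0 l)).trans ?_
  refine mul_le_mul_of_nonneg_left ?_ hB0
  exact Real.rpow_le_rpow_of_nonpos (by positivity) (one_add_abs_int_le hx l) (by linarith)

theorem summable_add_two_mul_int_mul_pi (hp : 1 < p) (hB0 : 0 ≤ B)
    (hB : ∀ ξ, ξ ≠ 0 → ‖G ξ‖ ≤ B * (1 + |ξ|) ^ (-p)) {x : ℝ}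
    (hx : x ∈ Set.Ioc (-Real.pi) Real.pi) (h0 : x ≠ 0) :
    Summable fun l : ℤ => G (x + 2 * l * Real.pi) :=
  Summable.of_norm_bounded ((summable_one_add_abs_int_rpow hp).mul_left B)
    (norm_add_two_mul_int_mul_pi_le hp hB0 hB hx h0)

theorem norm_tsum_add_two_mul_int_mul_pi_le (hp : 1 < p) (hB0 : 0 ≤ B)
    (hB : ∀ ξ, ξ ≠ 0 → ‖G ξ‖ ≤ B * (1 + |ξ|) ^ (-p)) {x : ℝ}
    (hx : x ∈ Set.Ioc (-Real.pi) Real.pi) (h0 : x ≠ 0) :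
    ‖∑' l : ℤ, G (x + 2 * l * Real.pi)‖ ≤ B * ∑' l : ℤ, (1 + |(l : ℝ)|) ^ (-p) := by
  rw [← tsum_mul_left]
  exact tsum_of_norm_bounded ((summable_one_add_abs_int_rpow hp).mul_left B).hasSum
    (norm_add_two_mul_int_mul_pi_le hp hB0 hB hx h0)

theorem integrable_mul_exp_int (hG : Integrable G) (τ : ℤ) :
    Integrable fun ξ : ℝ => G ξ * Complex.exp (Complex.I * τ * ξ) := by
  refine hG.mul_bdd (c := 1) (by fun_prop) (ae_of_all _ fun ξ => ?_)
  rw [show Complex.I * (τ : ℂ) * (ξ : ℂ) = ((τ * ξ : ℝ) : ℂ) * Complex.I by push_cast; ring,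
    Complex.norm_exp_ofReal_mul_I]

theorem memLp_tsum_add_two_mul_int_mul_pi (hG : Integrable G) (hp : 1 < p) (hB0 : 0 ≤ B)
    (hB : ∀ ξ, ξ ≠ 0 → ‖G ξ‖ ≤ B * (1 + |ξ|) ^ (-p)) (q : ENNReal) :
    MemLp (fun x : ℝ => ∑' l : ℤ, G (x + 2 * l * Real.pi)) q
      (volume.restrict (Set.Ioc (-Real.pi) Real.pi)) := by
  have hsum : ∀ᵐ x ∂(volume.restrict (Set.Ioc (-Real.pi) Real.pi)),
      Summable fun l : ℤ => G (x + 2 * l * Real.pi) := by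
    filter_upwards [ae_restrict_of_ae (Measure.ae_ne volume 0),
      ae_restrict_mem measurableSet_Ioc] with x h0 hx
    exact summable_add_two_mul_int_mul_pi hp hB0 hB hx h0
  have hmeas : AEStronglyMeasurable (fun x : ℝ => ∑' l : ℤ, G (x + 2 * l * Real.pi))
      (volume.restrict (Set.Ioc (-Real.pi) Real.pi)) :=
    aestronglyMeasurable_tsum_int (fun l =>
      ((hG.comp_add_right (2 * l * Real.pi)).aestronglyMeasurable).restrict) hsum
  refine MemLp.of_bound hmeas (B * ∑' l : ℤ, (1 + |(l : ℝ)|) ^ (-p)) ?_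
  filter_upwards [ae_restrict_of_ae (Measure.ae_ne volume 0),
    ae_restrict_mem measurableSet_Ioc] with x h0 hx
  exact norm_tsum_add_two_mul_int_mul_pi_le hp hB0 hB hx h0

/-- Integer frequencies do not see shifts by 2π, so these integrals are, up to the factor 2π and a
sign of τ, the Fourier coefficients of the periodization, which is bounded and thus in L². -/
theorem hasSum_sq_integral_mul_exp (hG : Integrable G) (hp : 1 < p) (hB0 : 0 ≤ B)
    (hB : ∀ ξ, ξ ≠ 0 → ‖G ξ‖ ≤ B * (1 + |ξ|) ^ (-p)) :
    HasSum (fun τ : ℤ => ‖∫ ξ, G ξ * Complex.exp (Complex.I * τ * ξ)‖ ^ 2)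
      (2 * Real.pi * ∫ x in Set.Ioc (-Real.pi) Real.pi,
        ‖∑' l : ℤ, G (x + 2 * l * Real.pi)‖ ^ 2) := by
  have hpi := Real.pi_pos
  have hab : -Real.pi < Real.pi := by linarith
  have hcoef : ∀ τ : ℤ, ∫ ξ, G ξ * Complex.exp (Complex.I * τ * ξ) =
      (2 * Real.pi) * fourierCoeffOn hab (fun x : ℝ => ∑' l : ℤ, G (x + 2 * l * Real.pi)) (-τ) := by
    intro τ
    rw [← integral_eq_integral_tsum_add_two_pi (integrable_mul_exp_int hG τ),
      fourierCoeffOn_eq_integral, intervalIntegral.integral_of_le hab.le, Complex.real_smul]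
    have h2 : (2 * Real.pi : ℂ) * (((1 / (Real.pi - -Real.pi) : ℝ)) : ℂ) = 1 := by
      rw [show (1 / (Real.pi - -Real.pi) : ℝ) = (2 * Real.pi)⁻¹ by rw [one_div]; congr 1; ring]
      push_cast
      exact mul_inv_cancel₀ (by exact_mod_cast (by positivity : (2 * Real.pi : ℝ) ≠ 0))
    rw [← mul_assoc, h2, one_mul]
    refine integral_congr_ae (ae_of_all _ fun x => ?_)
    simp only [smul_eq_mul]
    rw [fourier_coe_apply, ← tsum_mul_left]
    refine tsum_congr fun l => ?_
    rw [mul_comm]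
    congr 1
    rw [show Complex.I * τ * ((x + 2 * l * Real.pi : ℝ) : ℂ) =
      Complex.I * τ * x + ((τ * l : ℤ) : ℂ) * (2 * Real.pi * Complex.I) by push_cast; ring,
      Complex.exp_add, Complex.exp_int_mul_two_pi_mul_I, mul_one]
    congr 1
    push_cast
    have : (Real.pi : ℂ) ≠ 0 := by exact_mod_cast hpi.ne'
    field_simp
    ring
  have key := hasSum_sq_fourierCoeffOn hab
    (memLp_tsum_add_two_mul_int_mul_pi hG hp hB0 hB 2)
  rw [intervalIntegral.integral_of_le hab.le] at key
  have key2 := ((Equiv.neg ℤ).hasSum_iff.2 key).mul_left ((2 * Real.pi) ^ 2)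
  have hval : (2 * Real.pi) ^ 2 * ((Real.pi - -Real.pi)⁻¹ •
      ∫ x in Set.Ioc (-Real.pi) Real.pi, ‖∑' l : ℤ, G (x + 2 * l * Real.pi)‖ ^ 2) =
      2 * Real.pi * ∫ x in Set.Ioc (-Real.pi) Real.pi,
        ‖∑' l : ℤ, G (x + 2 * l * Real.pi)‖ ^ 2 := by
    rw [smul_eq_mul, ← mul_assoc, sub_neg_eq_add, ← two_mul, sq, mul_assoc (2 * Real.pi),
      mul_inv_cancel₀ (by positivity), mul_one]
  rw [← hval]
  refine key2.congr_fun fun τ => ?_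
  rw [hcoef]
  simp only [Function.comp_apply, Equiv.neg_apply]
  rw [norm_mul, mul_pow]
  congr 2
  rw [← Complex.ofReal_ofNat, ← Complex.ofReal_mul, Complex.norm_real,
    Real.norm_of_nonneg (by positivity)]

/-- Turns a pointwise kernel bound into an ℓ² bound on covariances. Applied to the difference of
kernels with B of order 2^{-βj}, it gives convergence in ℓ². -/
theorem tsum_sq_integral_mul_exp_le (hG : Integrable G) (hp : 1 < p) (hB0 : 0 ≤ B)
    (hB : ∀ ξ, ξ ≠ 0 → ‖G ξ‖ ≤ B * (1 + |ξ|) ^ (-p)) :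
    ∑' τ : ℤ, ‖∫ ξ, G ξ * Complex.exp (Complex.I * τ * ξ)‖ ^ 2 ≤
      (2 * Real.pi) ^ 2 * (∑' l : ℤ, (1 + |(l : ℝ)|) ^ (-p)) ^ 2 * B ^ 2 := by
  have hpi := Real.pi_pos
  rw [(hasSum_sq_integral_mul_exp hG hp hB0 hB).tsum_eq]
  set S := ∑' l : ℤ, (1 + |(l : ℝ)|) ^ (-p)
  have : ∫ x in Set.Ioc (-Real.pi) Real.pi, ‖∑' l : ℤ, G (x + 2 * l * Real.pi)‖ ^ 2 ≤
      ∫ x in Set.Ioc (-Real.pi) Real.pi, (B * S) ^ 2 := by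
    refine integral_mono_ae ?_ (integrable_const _) ?_
    · exact (memLp_tsum_add_two_mul_int_mul_pi hG hp hB0 hB 2).integrable_norm_pow (by norm_num)
    · filter_upwards [ae_restrict_of_ae (Measure.ae_ne volume 0),
        ae_restrict_mem measurableSet_Ioc] with x h0 hx
      have := norm_tsum_add_two_mul_int_mul_pi_le hp hB0 hB hx h0
      gcongr
  rw [setIntegral_const, Real.volume_real_Ioc_of_le (by linarith), smul_eq_mul] at this
  calc _ ≤ 2 * Real.pi * ((Real.pi - -Real.pi) * (B * S) ^ 2) := by gcongr
    _ = _ := by ring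

end Periodization

/-! ### Fourier coefficients and total mass of the limiting kernel -/

section Kernel

variable {φ ψ : ℝ → ℝ} {α β L : ℝ} {M : ℕ} {T : ℕ} {d : ℝ} {fstar : ℝ → ℝ}

theorem integrable_limitKernel (hW : WaveletAssumptions φ ψ α M)
    (hψ : Function.support ψ ⊆ Set.Ioo 0 (T : ℝ)) (hd : d ≤ M) (hdα : 1 < 2 * d + 2 * α)
    (u v : ℕ) : Integrable (limitKernel ψ d u v) := by
  obtain ⟨C, hC, h⟩ := exists_norm_limitKernel_le hW hψ hd u
  refine ((integrable_one_add_abs_rpow hdα).const_mul C).mono' ?_ ?_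
  · have h1 := continuous_fourier hW.integrable_psi
    have h2 := continuous_phase u v
    unfold limitKernel
    refine Measurable.aestronglyMeasurable ?_
    have h3 : Measurable fun ξ : ℝ => ((|ξ| ^ (-2 * d) : ℝ) : ℂ) := by fun_prop
    have h4 : Continuous fun ξ => (starRingEnd ℂ) (fourier ψ ξ) := Complex.continuous_conj.comp h1
    have h5 : Continuous fun ξ => fourier ψ ((2 : ℝ) ^ (-(u : ℝ)) * ξ) := by fun_prop
    exact ((h3.mul h4.measurable).mul h5.measurable).mul h2.measurable
  · filter_upwards [Measure.ae_ne volume 0] with ξ hξ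
    exact h v ξ hξ

/-- The squared norm of `DInf` in terms of the periodized limiting kernels. -/
theorem norm_DInf_sq (hW : WaveletAssumptions φ ψ α M)
    (hψ : Function.support ψ ⊆ Set.Ioo 0 (T : ℝ)) (hd : d ≤ M) (hdα : 1 < 2 * d + 2 * α)
    (u : ℕ) {x : ℝ} (hx : x ∈ Set.Ioc (-Real.pi) Real.pi) (h0 : x ≠ 0) :
    ‖DInf ψ u d x‖ ^ 2 =
      ∑ v ∈ Finset.range (2 ^ u), ‖∑' l : ℤ, limitKernel ψ d u v (x + 2 * l * Real.pi)‖ ^ 2 := by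
  obtain ⟨C, hC, h⟩ := exists_norm_limitKernel_le hW hψ hd u
  have hs : HasSum (fun l : ℤ =>
      (((|x + 2 * l * Real.pi| ^ (-2 * d) : ℝ) : ℂ) *
      (starRingEnd ℂ) (fourier ψ (x + 2 * l * Real.pi)) *
      fourier ψ ((2 : ℝ) ^ (-(u : ℝ)) * (x + 2 * l * Real.pi))) • eVec u (x + 2 * l * Real.pi))
      (WithLp.toLp 2 fun v : Fin (2 ^ u) =>
        ∑' l : ℤ, limitKernel ψ d u v (x + 2 * l * Real.pi)) := by
    have h1 : HasSum (fun (l : ℤ) (v : Fin (2 ^ u)) => limitKernel ψ d u v (x + 2 * l * Real.pi))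
        (fun v : Fin (2 ^ u) => ∑' l : ℤ, limitKernel ψ d u v (x + 2 * l * Real.pi)) :=
      Pi.hasSum.2 fun v => (summable_add_two_mul_int_mul_pi hdα hC (h v) hx h0).hasSum
    exact h1.mapL ((PiLp.continuousLinearEquiv 2 ℂ fun _ : Fin (2 ^ u) => ℂ).symm :
      (Fin (2 ^ u) → ℂ) →L[ℂ] EuclideanSpace ℂ (Fin (2 ^ u)))
  rw [DInf, hs.tsum_eq, EuclideanSpace.norm_sq_eq, Finset.sum_range]

theorem hasSum_sq_integral_limitKernel (hW : WaveletAssumptions φ ψ α M)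
    (hψ : Function.support ψ ⊆ Set.Ioo 0 (T : ℝ)) (hd : d ≤ M) (hdα : 1 < 2 * d + 2 * α)
    (u : ℕ) :
    HasSum (fun τ : ℤ => ∑ v ∈ Finset.range (2 ^ u),
        ‖∫ ξ, limitKernel ψ d u v ξ * Complex.exp (Complex.I * τ * ξ)‖ ^ 2)
      (2 * Real.pi * ∫ x in Set.Ioo (-Real.pi) Real.pi, ‖DInf ψ u d x‖ ^ 2) := by
  obtain ⟨C, hC, h⟩ := exists_norm_limitKernel_le hW hψ hd u
  have hi := integrable_limitKernel hW hψ hd hdα u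
  have key := hasSum_sum (s := Finset.range (2 ^ u)) fun v _ =>
    hasSum_sq_integral_mul_exp (hi v) hdα hC (h v)
  convert key using 1
  rw [← Finset.mul_sum, ← integral_finsetSum _ fun v _ =>
    (memLp_tsum_add_two_mul_int_mul_pi (hi v) hdα hC (h v) 2).integrable_norm_pow (by norm_num),
    ← integral_Ioc_eq_integral_Ioo]
  congr 1
  refine integral_congr_ae ?_
  filter_upwards [ae_restrict_of_ae (Measure.ae_ne volume 0),
    ae_restrict_mem measurableSet_Ioc] with x h0 hx
  exact norm_DInf_sq hW hψ hd hdα u hx h0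

theorem integral_limitKernel_zero (ψ : ℝ → ℝ) (d : ℝ) :
    ∫ ξ, limitKernel ψ d 0 0 ξ = (Kpsi ψ d : ℂ) := by
  rw [Kpsi, ← integral_complex_ofReal]
  refine integral_congr_ae (ae_of_all _ fun ξ => ?_)
  simp only [limitKernel, phase]
  simp only [Nat.cast_zero, neg_zero, zero_div, Real.rpow_zero, one_mul, mul_zero, zero_mul,
    Complex.exp_zero, Complex.ofReal_one, mul_one]
  rw [mul_assoc, mul_comm ((starRingEnd ℂ) _), Complex.mul_conj, Complex.normSq_eq_norm_sq]
  push_cast; ring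

/-- If the integral vanished, ψ̂ would be zero almost everywhere, hence everywhere by continuity.
All Fourier coefficients of ψ on (0, T] would then vanish, and Parseval would contradict ∫ψ² = 1. -/
theorem Kpsi_pos (hW : WaveletAssumptions φ ψ α M)
    (hψ : Function.support ψ ⊆ Set.Ioo 0 (T : ℝ)) (hT : 1 ≤ T) (hd : d ≤ M)
    (hdα : 1 < 2 * d + 2 * α) : 0 < Kpsi ψ d := by
  have hnn : ∀ ξ : ℝ, 0 ≤ |ξ| ^ (-2 * d) * ‖fourier ψ ξ‖ ^ 2 := fun ξ => by positivity
  refine lt_of_le_of_ne (integral_nonneg hnn) fun h0 => ?_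
  have hT0 : (0 : ℝ) < T := by exact_mod_cast hT
  have hint : Integrable fun ξ : ℝ => |ξ| ^ (-2 * d) * ‖fourier ψ ξ‖ ^ 2 := by
    refine (integrable_limitKernel hW hψ hd hdα 0 0).norm.congr (ae_of_all _ fun ξ => ?_)
    simp only [limitKernel, phase]
    simp only [Nat.cast_zero, neg_zero, zero_div, Real.rpow_zero, one_mul, mul_zero, zero_mul,
      Complex.exp_zero, Complex.ofReal_one, mul_one]
    rw [norm_mul, norm_mul, Complex.norm_conj, Complex.norm_real,
      Real.norm_of_nonneg (by positivity)]
    ring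
  have hz := (integral_eq_zero_iff_of_nonneg hnn hint).1 h0.symm
  have hz2 : fourier ψ =ᵐ[volume] 0 := by
    filter_upwards [hz, Measure.ae_ne volume 0] with ξ h1 h2
    have h3 : |ξ| ^ (-2 * d) ≠ 0 := (Real.rpow_pos_of_pos (abs_pos.2 h2) _).ne'
    simpa only [Pi.zero_apply, mul_eq_zero, h3, false_or, ne_eq, OfNat.ofNat_ne_zero,
      not_false_eq_true, pow_eq_zero_iff, norm_eq_zero] using h1
  have hz3 : fourier ψ = 0 :=
    (continuous_fourier hW.integrable_psi).ae_eq_iff_eq volume continuous_const |>.1 hz2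
  have hmem : MemLp (fun t => (ψ t : ℂ)) 2 (volume.restrict (Set.Ioc 0 (T : ℝ))) :=
    (hW.memLp_psi.ofReal).restrict _
  have key := hasSum_sq_fourierCoeffOn hT0 hmem
  have hcoef : ∀ n : ℤ, fourierCoeffOn hT0 (fun t => (ψ t : ℂ)) n = 0 := by
    intro n
    rw [fourierCoeffOn_eq_integral, intervalIntegral.integral_of_le hT0.le]
    have h1 : ∫ x in Set.Ioc 0 (T : ℝ),
        _root_.fourier (-n) (x : AddCircle ((T : ℝ) - 0)) • (ψ x : ℂ) =
        fourier ψ (2 * Real.pi * n / T) := by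
      rw [fourier, setIntegral_eq_integral_of_forall_compl_eq_zero]
      · refine integral_congr_ae (ae_of_all _ fun x => ?_)
        simp only [smul_eq_mul]
        rw [fourier_coe_apply, mul_comm]
        congr 2
        push_cast
        rw [sub_zero]
        ring
      · intro x hx
        have : ψ x = 0 := by
          by_contra hne
          exact hx (Set.Ioo_subset_Ioc_self (hψ hne))
        simp [this]
    rw [h1, hz3]
    simp
  simp only [hcoef, norm_zero, ne_eq, OfNat.ofNat_ne_zero, not_false_eq_true, zero_pow] at key
  have h2 := key.unique hasSum_zero
  rw [intervalIntegral.integral_of_le hT0.le, setIntegral_eq_integral_of_forall_compl_eq_zero] at h2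
  · simp only [Complex.norm_real, Real.norm_eq_abs, sq_abs, hW.integral_psi_sq, sub_zero,
      smul_eq_mul, mul_one, inv_eq_zero] at h2
    exact hT0.ne' h2
  · intro x hx
    have : ψ x = 0 := by
      by_contra hne
      exact hx (Set.Ioo_subset_Ioc_self (hψ hne))
    simp [this]

end Kernel

/-! ### Covariances in terms of the rescaled kernel -/

/-- Integrand of the spectral representation of the covariances of wavelet coefficients. -/
noncomputable def covDensity (φ ψ : ℝ → ℝ) (T : ℕ) (d : ℝ) (fstar : ℝ → ℝ) (j i : ℕ) (a : ℤ)
    (ξ : ℝ) : ℂ :=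
  Complex.exp (Complex.I * (a : ℂ) * ξ) *
    (transferFun φ ψ T j ξ * (starRingEnd ℂ) (transferFun φ ψ T i ξ)) *
    ((‖1 - Complex.exp (-(Complex.I * ξ))‖ ^ (-2 * d) * fstar ξ : ℝ) : ℂ)

section Kernel

variable {φ ψ : ℝ → ℝ} {α β L : ℝ} {M : ℕ} {T : ℕ} {d : ℝ} {fstar : ℝ → ℝ}

/-- Writing the finer location as 2^u l + v, the substitution ξ ↦ ξ/2^{i+u} turns the lag 2^{i+u}k -
2^i(2^u l + v) into k - l, and the leftover depends on v alone: it is the phase. For fixed v the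
covariance is therefore Toeplitz in (k, l). -/
theorem scaleKernel_mul_exp_eq (hf0 : fstar 0 ≠ 0) (i u v : ℕ) (k l : ℤ) (ξ : ℝ) :
    ((fstar 0 * ((2 : ℝ) ^ (i + u)) ^ (2 * d) : ℝ) : ℂ) *
      (scaleKernel φ ψ T d fstar u i v ξ * Complex.exp (Complex.I * ((k - l : ℤ) : ℂ) * ξ)) =
    (((2 : ℝ) ^ (i + u) : ℝ) : ℂ)⁻¹ * Set.indicator (Set.Ioo (-Real.pi) Real.pi)
      (covDensity φ ψ T d fstar (i + u) i (2 ^ (i + u) * k - 2 ^ i * (2 ^ u * l + v)))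
      (ξ / 2 ^ (i + u)) := by
  set N : ℝ := 2 ^ (i + u) with hN
  have hN0 : 0 < N := by positivity
  have hmem : ξ / N ∈ Set.Ioo (-Real.pi) Real.pi ↔
      ξ ∈ Set.Ioo (-(N * Real.pi)) (N * Real.pi) := by
    rw [Set.mem_Ioo, Set.mem_Ioo, lt_div_iff₀ hN0, div_lt_iff₀ hN0, neg_mul, mul_comm Real.pi]
  by_cases h : ξ ∈ Set.Ioo (-(N * Real.pi)) (N * Real.pi)
  · rw [Set.indicator_of_mem (hmem.2 h), scaleKernel, Set.indicator_of_mem (by exact h), phase,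
      covDensity]
    have h1 : ((2 : ℝ) ^ (-((i + u : ℕ) : ℝ) / 2)) * (2 : ℝ) ^ (-(i : ℝ) / 2) *
        (2 : ℝ) ^ (-(u : ℝ) / 2) = N⁻¹ := by
      rw [← Real.rpow_add (by norm_num), ← Real.rpow_add (by norm_num), hN,
        ← two_rpow_neg_natCast]
      congr 1; push_cast; ring
    have h2 : N ^ (2 * d) * N ^ (-2 * d) = 1 := by
      rw [← Real.rpow_add hN0]; simp
    have h3 : Complex.exp (-(Complex.I * (v : ℂ) * (((2 : ℝ) ^ (-(u : ℝ)) * ξ : ℝ) : ℂ))) *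
        Complex.exp (Complex.I * ((k - l : ℤ) : ℂ) * ξ) =
        Complex.exp (Complex.I * ((2 ^ (i + u) * k - 2 ^ i * (2 ^ u * l + v) : ℤ) : ℂ) *
          ((ξ / N : ℝ) : ℂ)) := by
      rw [← Complex.exp_add, two_rpow_neg_natCast, hN]
      congr 1
      push_cast
      have : (2 : ℂ) ^ u ≠ 0 := pow_ne_zero _ two_ne_zero
      have : (2 : ℂ) ^ i ≠ 0 := pow_ne_zero _ two_ne_zero
      rw [pow_add]
      field_simp
      ring
    rw [← h3, ← Complex.ofReal_inv, ← h1, map_mul, Complex.conj_ofReal]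
    have h2' : (((N ^ (2 * d) : ℝ)) : ℂ) * ((N ^ (-2 * d) : ℝ) : ℂ) = 1 := by
      rw [← Complex.ofReal_mul, h2, Complex.ofReal_one]
    have h4 : (fstar 0 : ℂ) * (fstar 0 : ℂ)⁻¹ = 1 :=
      mul_inv_cancel₀ (by exact_mod_cast hf0)
    clear_value N
    simp only [← hN]
    rw [Complex.ofReal_mul (fstar 0), Complex.ofReal_mul (N ^ (-2 * d) * _),
      Complex.ofReal_mul (N ^ (-2 * d)), Complex.ofReal_div (fstar (ξ / N)), div_eq_mul_inv (fstar _ : ℂ),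
      Complex.ofReal_mul (‖_‖ ^ (-2 * d)), Complex.ofReal_mul (2 ^ _ * 2 ^ _),
      Complex.ofReal_mul ((2 : ℝ) ^ (-((i + u : ℕ) : ℝ) / 2))]
    generalize ((N ^ (2 * d) : ℝ) : ℂ) = A at *
    generalize ((N ^ (-2 * d) : ℝ) : ℂ) = A' at *
    generalize (fstar 0 : ℂ) = F at *
    generalize ((2 ^ (-((i + u : ℕ) : ℝ) / 2) : ℝ) : ℂ) = a
    generalize ((2 ^ (-(i : ℝ) / 2) : ℝ) : ℂ) = b
    generalize ((2 ^ (-(u : ℝ) / 2) : ℝ) : ℂ) = c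
    generalize Complex.exp (-(Complex.I * (v : ℂ) * (((2 : ℝ) ^ (-(u : ℝ)) * ξ : ℝ) : ℂ))) = e
    generalize Complex.exp (Complex.I * ((k - l : ℤ) : ℂ) * ξ) = e'
    generalize transferFun φ ψ T (i + u) (ξ / N) = H
    generalize (starRingEnd ℂ) (transferFun φ ψ T i (ξ / N)) = H'
    generalize ((‖1 - Complex.exp (-(Complex.I * (ξ / N : ℝ)))‖ ^ (-2 * d) : ℝ) : ℂ) = w
    generalize ((fstar (ξ / N) : ℝ) : ℂ) = f
    linear_combination (F * F⁻¹ * (a * H * b * H' * w * f * c * e * e')) * h2' +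
      (a * H * b * H' * w * f * c * e * e') * h4
  · rw [Set.indicator_of_notMem (fun hm => h (hmem.1 hm)), scaleKernel,
      Set.indicator_of_notMem (by exact h)]
    simp

theorem covariance_waveletCoeff_eq_scaleKernel {Ω : Type*} [MeasurableSpace Ω] {P : Measure Ω}
    [IsProbabilityMeasure P] {X : ℤ → Ω → ℝ} (hW : WaveletAssumptions φ ψ α M)
    (hφ : Function.support φ ⊆ Set.Ioo (-(T : ℝ)) 0)
    (hψ : Function.support ψ ⊆ Set.Ioo 0 (T : ℝ)) (hX : HasMemoryParameter P X d fstar)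
    (hd : d ≤ M) (hf0 : fstar 0 ≠ 0) (i u v : ℕ) (k l : ℤ) :
    ((cov[fun ω => waveletCoeff φ ψ (fun k => X k ω) (i + u) k,
        fun ω => waveletCoeff φ ψ (fun k => X k ω) i (2 ^ u * l + v); P] : ℝ) : ℂ) =
      ((fstar 0 * ((2 : ℝ) ^ (i + u)) ^ (2 * d) : ℝ) : ℂ) *
        ∫ ξ, scaleKernel φ ψ T d fstar u i v ξ * Complex.exp (Complex.I * ((k - l : ℤ) : ℂ) * ξ) := by
  rw [covariance_waveletCoeff hW hφ hψ hX hd, ← integral_const_mul]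
  simp only [scaleKernel_mul_exp_eq hf0]
  rw [integral_const_mul, Measure.integral_comp_div, integral_indicator measurableSet_Ioo,
    abs_of_pos (by positivity), Complex.real_smul, ← mul_assoc,
    inv_mul_cancel₀ (by exact_mod_cast (by positivity : (2 : ℝ) ^ (i + u) ≠ 0)), one_mul]
  rfl

/-- The possible singularity at 0 is harmless because the zeros of the transfer functions convert
the density into the integrable one of the M-th difference, multiplied by trigonometric polynomials.
-/
theorem integrableOn_covDensity {Ω : Type*} [MeasurableSpace Ω] {P : Measure Ω}
    {X : ℤ → Ω → ℝ} (hW : WaveletAssumptions φ ψ α M)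
    (hφ : Function.support φ ⊆ Set.Ioo (-(T : ℝ)) 0)
    (hψ : Function.support ψ ⊆ Set.Ioo 0 (T : ℝ)) (hX : HasMemoryParameter P X d fstar)
    (hd : d ≤ M) (j i : ℕ) (a : ℤ) :
    IntegrableOn (covDensity φ ψ T d fstar j i a) (Set.Ioo (-Real.pi) Real.pi) := by
  obtain ⟨Q, -, hQt⟩ := exists_waveletCoeff_eq_diff hW hφ hψ j
  obtain ⟨R, -, hRt⟩ := exists_waveletCoeff_eq_diff hW hφ hψ i
  have hY := (hX.density M (by linarith)).integrableOn
  have hc : Continuous fun ξ : ℝ => Complex.exp (Complex.I * (a : ℂ) * ξ) *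
      ((∑ m ∈ Finset.range (Q.natDegree + 1), (Q.coeff m : ℂ) * Complex.exp (Complex.I * m * ξ)) *
      (starRingEnd ℂ) (∑ m ∈ Finset.range (R.natDegree + 1),
        (R.coeff m : ℂ) * Complex.exp (Complex.I * m * ξ))) := by
    refine Continuous.mul (by fun_prop) (Continuous.mul (by fun_prop) ?_)
    exact Complex.continuous_conj.comp (by fun_prop)
  have hY' : IntegrableOn (fun ξ : ℝ => ((‖1 - Complex.exp (-(Complex.I * ξ))‖ ^
      (2 * ((M : ℝ) - d)) * fstar ξ : ℝ) : ℂ)) (Set.Icc (-Real.pi) Real.pi) :=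
    Integrable.ofReal ((integrableOn_Icc_iff_integrableOn_Ioo (by simp) (by simp)).2 hY)
  have hI := hY'.continuousOn_mul hc.continuousOn isCompact_Icc
  refine (hI.mono_set Set.Ioo_subset_Icc_self).congr ?_
  filter_upwards [ae_restrict_of_ae (Measure.ae_ne volume 0),
    ae_restrict_mem measurableSet_Ioo] with ξ hξ0 hξ
  have hp := norm_one_sub_exp_pos hξ hξ0
  have hg : ((‖1 - Complex.exp (-(Complex.I * ξ))‖ ^ (2 * ((M : ℝ) - d)) * fstar ξ : ℝ) : ℂ) =
      (Complex.exp (Complex.I * ξ) - 1) ^ M *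
      (starRingEnd ℂ) ((Complex.exp (Complex.I * ξ) - 1) ^ M) *
      ((‖1 - Complex.exp (-(Complex.I * ξ))‖ ^ (-2 * d) * fstar ξ : ℝ) : ℂ) := by
    rw [Complex.mul_conj, Complex.normSq_eq_norm_sq, norm_pow, norm_exp_I_sub_one,
      ← Complex.ofReal_mul, ← mul_assoc, ← pow_mul, ← Real.rpow_natCast, ← Real.rpow_add hp]
    congr 4
    push_cast; ring
  simp only [covDensity]
  rw [hQt, hRt, map_mul]
  refine Eq.trans (congrArg (_ * ·) hg) ?_
  ring

theorem integrable_scaleKernel {Ω : Type*} [MeasurableSpace Ω] {P : Measure Ω}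
    {X : ℤ → Ω → ℝ} (hW : WaveletAssumptions φ ψ α M)
    (hφ : Function.support φ ⊆ Set.Ioo (-(T : ℝ)) 0)
    (hψ : Function.support ψ ⊆ Set.Ioo 0 (T : ℝ)) (hX : HasMemoryParameter P X d fstar)
    (hd : d ≤ M) (hf0 : fstar 0 ≠ 0) (u i v : ℕ) :
    Integrable (scaleKernel φ ψ T d fstar u i v) := by
  have hN : (0 : ℝ) < 2 ^ (i + u) := by positivity
  have h1 := ((integrableOn_covDensity hW hφ hψ hX hd (i + u) i
    (2 ^ (i + u) * 0 - 2 ^ i * (2 ^ u * 0 + v))).integrable_indicator measurableSet_Ioo).comp_div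
    hN.ne'
  have hc : ((fstar 0 * ((2 : ℝ) ^ (i + u)) ^ (2 * d) : ℝ) : ℂ) ≠ 0 := by
    exact_mod_cast mul_ne_zero hf0 (Real.rpow_pos_of_pos hN _).ne'
  refine ((h1.const_mul (((2 : ℝ) ^ (i + u) : ℝ) : ℂ)⁻¹).const_mul
    ((fstar 0 * ((2 : ℝ) ^ (i + u)) ^ (2 * d) : ℝ) : ℂ)⁻¹).congr (ae_of_all _ fun ξ => ?_)
  simp only
  rw [← scaleKernel_mul_exp_eq hf0 i u v 0 0 ξ, inv_mul_cancel_left₀ hc]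
  simp

end Kernel

/-! ### Averages of squared Toeplitz arrays -/

/-- Number of `k < m` with `0 ≤ k - τ < q`. -/
def toeplitzCount (m q : ℕ) (τ : ℤ) : ℕ :=
  ((Finset.range m).filter fun k : ℕ => τ ≤ k ∧ (k : ℤ) < q + τ).card

theorem toeplitzCount_le (m q : ℕ) (τ : ℤ) : toeplitzCount m q τ ≤ m := by
  simpa [toeplitzCount] using
    Finset.card_filter_le (Finset.range m) fun k : ℕ => τ ≤ k ∧ (k : ℤ) < q + τ

/-- A shift by τ loses at most |τ| indices at each end, so for fixed τ the count is m - O(1). -/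
theorem le_toeplitzCount_add {m q : ℕ} (h : m ≤ q) (τ : ℤ) :
    m ≤ toeplitzCount m q τ + 2 * τ.natAbs := by
  have hsub : Finset.Ico τ.toNat (min m (q + τ).toNat) ⊆
      (Finset.range m).filter fun k : ℕ => τ ≤ k ∧ (k : ℤ) < q + τ := by
    intro k hk
    simp only [Finset.mem_Ico, lt_min_iff, Finset.mem_filter, Finset.mem_range] at hk ⊢
    omega
  have := Finset.card_le_card hsub
  rw [Nat.card_Ico] at this
  unfold toeplitzCount
  omega

theorem sum_range_sub_eq_tsum (h : ℤ → ℝ) (k : ℕ) (q : ℕ) :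
    HasSum (fun τ : ℤ => if τ ≤ k ∧ (k : ℤ) < q + τ then h τ else 0)
      (∑ l ∈ Finset.range q, h (k - l)) := by
  have hinj : Set.InjOn (fun l : ℕ => (k : ℤ) - l) (Finset.range q) := by
    intro a _ b _ hab
    simpa using hab
  have key := hasSum_sum_of_ne_finset_zero (f := fun τ : ℤ =>
    if τ ≤ k ∧ (k : ℤ) < q + τ then h τ else 0) (L := SummationFilter.unconditional ℤ)
    (s := (Finset.range q).image fun l : ℕ => (k : ℤ) - l) ?_
  · rw [Finset.sum_image hinj] at key
    convert key using 1
    refine Finset.sum_congr rfl fun l hl => ?_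
    rw [if_pos]
    have := Finset.mem_range.1 hl
    omega
  · intro τ hτ
    rw [if_neg]
    intro hc
    refine hτ (Finset.mem_image.2 ⟨(k - τ).toNat, Finset.mem_range.2 ?_, ?_⟩) <;> omega

theorem hasSum_toeplitzCount_mul (h : ℤ → ℝ) (m q : ℕ) :
    HasSum (fun τ : ℤ => (toeplitzCount m q τ : ℝ) * h τ)
      (∑ k ∈ Finset.range m, ∑ l ∈ Finset.range q, h (k - l)) := by
  convert hasSum_sum (s := Finset.range m) fun k _ => sum_range_sub_eq_tsum h k q using 1
  ext τ
  rw [← Finset.sum_filter, Finset.sum_const, nsmul_eq_mul, toeplitzCount]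

theorem abs_norm_sq_sub_norm_sq_le {x y : ℂ} {δ : ℝ} (hδ : 0 < δ) :
    |‖x‖ ^ 2 - ‖y‖ ^ 2| ≤ (1 + δ⁻¹) * ‖x - y‖ ^ 2 + δ * ‖y‖ ^ 2 := by
  have h1 : |‖x‖ - ‖y‖| ≤ ‖x - y‖ := abs_norm_sub_norm_le x y
  have h2 : ‖x‖ + ‖y‖ ≤ ‖x - y‖ + 2 * ‖y‖ := by
    have := norm_le_norm_add_norm_sub' x y
    linarith
  have h3 : 2 * (‖x - y‖ * ‖y‖) ≤ δ⁻¹ * ‖x - y‖ ^ 2 + δ * ‖y‖ ^ 2 := by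
    have : 0 ≤ δ⁻¹ * (‖x - y‖ - δ * ‖y‖) ^ 2 := by positivity
    have e : δ⁻¹ * (‖x - y‖ - δ * ‖y‖) ^ 2 =
        δ⁻¹ * ‖x - y‖ ^ 2 + δ * ‖y‖ ^ 2 - 2 * (‖x - y‖ * ‖y‖) := by
      field_simp
      ring
    linarith
  calc |‖x‖ ^ 2 - ‖y‖ ^ 2| = |‖x‖ - ‖y‖| * (‖x‖ + ‖y‖) := by
        rw [sq_sub_sq, abs_mul, abs_of_nonneg (by positivity : 0 ≤ ‖x‖ + ‖y‖), mul_comm]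
    _ ≤ ‖x - y‖ * (‖x - y‖ + 2 * ‖y‖) := by gcongr
    _ = ‖x - y‖ ^ 2 + 2 * (‖x - y‖ * ‖y‖) := by ring
    _ ≤ _ := by linarith

/-- The average is a sum over lags τ with weights in [0, 1] that tend to 1 for fixed τ. Dominated
convergence treats the limiting sequence y, and the ℓ² distance ε of x to y, uniform over lags,
treats the difference. -/
theorem tendsto_toeplitz_average {m q : ℕ → ℕ} (hm : Tendsto (fun n => (m n : ℝ)) atTop atTop)
    (hq : ∀ n, m n ≤ q n) {x : ℕ → ℤ → ℂ} {y : ℤ → ℂ} (hy : Summable fun τ => ‖y τ‖ ^ 2)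
    (hs : ∀ n, Summable fun τ => ‖x n τ - y τ‖ ^ 2) {ε : ℕ → ℝ} (hε : ∀ n, 0 < ε n)
    (hε0 : Tendsto ε atTop (𝓝 0)) (hle : ∀ n, ∑' τ, ‖x n τ - y τ‖ ^ 2 ≤ ε n) :
    Tendsto (fun n => (m n : ℝ)⁻¹ * ∑ k ∈ Finset.range (m n), ∑ l ∈ Finset.range (q n),
      ‖x n (k - l)‖ ^ 2) atTop (𝓝 (∑' τ, ‖y τ‖ ^ 2)) := by
  set a : ℕ → ℤ → ℝ := fun n τ => (m n : ℝ)⁻¹ * toeplitzCount (m n) (q n) τ with ha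
  have ha0 : ∀ n τ, 0 ≤ a n τ := fun n τ => by positivity
  have ha1 : ∀ n τ, a n τ ≤ 1 := fun n τ => by
    have : (toeplitzCount (m n) (q n) τ : ℝ) ≤ m n := by exact_mod_cast toeplitzCount_le _ _ τ
    exact inv_mul_le_one_of_le₀ this (by positivity)
  have halim : ∀ τ, Tendsto (fun n => a n τ) atTop (𝓝 1) := by
    intro τ
    have h1 : Tendsto (fun n => 1 - 2 * (τ.natAbs : ℝ) * (m n : ℝ)⁻¹) atTop (𝓝 1) := by
      simpa using (tendsto_const_nhds (x := (1 : ℝ))).sub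
        ((tendsto_inv_atTop_zero.comp hm).const_mul (2 * (τ.natAbs : ℝ)))
    refine tendsto_of_tendsto_of_tendsto_of_le_of_le' h1 tendsto_const_nhds ?_
      (Eventually.of_forall fun n => ha1 n τ)
    filter_upwards [hm.eventually_gt_atTop 0] with n hn
    have : (m n : ℝ) ≤ toeplitzCount (m n) (q n) τ + 2 * τ.natAbs := by
      exact_mod_cast le_toeplitzCount_add (hq n) τ
    simp only [ha]
    rw [inv_mul_eq_div, ← div_eq_mul_inv, le_div_iff₀ hn, sub_mul, div_mul_cancel₀ _ hn.ne']
    linarith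
  have hform : ∀ n, (m n : ℝ)⁻¹ * ∑ k ∈ Finset.range (m n), ∑ l ∈ Finset.range (q n),
      ‖x n (k - l)‖ ^ 2 = ∑' τ, a n τ * ‖x n τ‖ ^ 2 := by
    intro n
    rw [← (hasSum_toeplitzCount_mul (fun τ => ‖x n τ‖ ^ 2) (m n) (q n)).tsum_eq, ← tsum_mul_left]
    exact tsum_congr fun τ => by rw [ha]; ring
  simp only [hform]
  have hsum1 : ∀ n, Summable fun τ => a n τ * ‖x n τ‖ ^ 2 := by
    intro n
    refine ((hasSum_toeplitzCount_mul (fun τ => ‖x n τ‖ ^ 2) (m n) (q n)).summable.mul_left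
      (m n : ℝ)⁻¹).congr fun τ => ?_
    rw [ha]; ring
  have hsum2 : ∀ n, Summable fun τ => a n τ * ‖y τ‖ ^ 2 := fun n =>
    Summable.of_nonneg_of_le (fun τ => mul_nonneg (ha0 n τ) (by positivity))
      (fun τ => mul_le_of_le_one_left (by positivity) (ha1 n τ)) hy
  have hlim : Tendsto (fun n => ∑' τ, a n τ * ‖y τ‖ ^ 2) atTop (𝓝 (∑' τ, ‖y τ‖ ^ 2)) := by
    refine tendsto_tsum_of_dominated_convergence hy (fun τ => ?_)
      (Eventually.of_forall fun n τ => ?_)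
    · simpa using (halim τ).mul_const (‖y τ‖ ^ 2)
    · rw [Real.norm_of_nonneg (mul_nonneg (ha0 n τ) (by positivity))]
      exact mul_le_of_le_one_left (by positivity) (ha1 n τ)
  have hdiff : Tendsto (fun n => ∑' τ, a n τ * ‖x n τ‖ ^ 2 - ∑' τ, a n τ * ‖y τ‖ ^ 2) atTop
      (𝓝 0) := by
    have hb : Tendsto (fun n => ε n + √(ε n) + √(ε n) * ∑' τ, ‖y τ‖ ^ 2) atTop (𝓝 0) := by
      have h1 : Tendsto (fun n => √(ε n)) atTop (𝓝 0) := by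
        simpa using hε0.sqrt
      simpa using (hε0.add h1).add (h1.mul_const _)
    refine squeeze_zero_norm (fun n => ?_) hb
    -- Young's parameter √ε balances (1 + δ⁻¹)ε against δ‖y‖²; it must be positive, which is why ε
    -- is assumed so.
    have hδ : 0 < √(ε n) := Real.sqrt_pos.2 (hε n)
    rw [← (hsum1 n).tsum_sub (hsum2 n)]
    have hbd : HasSum (fun τ => (1 + (√(ε n))⁻¹) * ‖x n τ - y τ‖ ^ 2 + √(ε n) * ‖y τ‖ ^ 2)
        ((1 + (√(ε n))⁻¹) * ∑' τ, ‖x n τ - y τ‖ ^ 2 + √(ε n) * ∑' τ, ‖y τ‖ ^ 2) :=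
      ((hs n).hasSum.mul_left _).add (hy.hasSum.mul_left _)
    refine (tsum_of_norm_bounded hbd fun τ => ?_).trans ?_
    · rw [← mul_sub, norm_mul, Real.norm_of_nonneg (ha0 n τ)]
      exact (mul_le_of_le_one_left (norm_nonneg _) (ha1 n τ)).trans
        (abs_norm_sq_sub_norm_sq_le hδ)
    · have : (1 + (√(ε n))⁻¹) * ∑' τ, ‖x n τ - y τ‖ ^ 2 ≤ ε n + √(ε n) := by
        calc _ ≤ (1 + (√(ε n))⁻¹) * ε n := by
              gcongr
              exact hle n
          _ = _ := by
            rw [add_mul, one_mul, inv_mul_eq_div, Real.div_sqrt]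
      linarith
  simpa using hdiff.add hlim

theorem sum_range_eq_sum_mod {U : ℕ} (hU : 0 < U) (m : ℕ) (g : ℕ → ℝ) :
    ∑ l ∈ Finset.range m, g l =
      ∑ v ∈ Finset.range U, ∑ k ∈ Finset.range ((m + U - 1 - v) / U), g (U * k + v) := by
  have hlt : ∀ k v, v < U → (k < (m + U - 1 - v) / U ↔ U * k + v < m) := by
    intro k v hv
    rw [← Nat.succ_le_iff, Nat.le_div_iff_mul_le hU, Nat.succ_mul, mul_comm]
    omega
  rw [Finset.sum_sigma']
  refine Finset.sum_nbij' (fun l => ⟨l % U, l / U⟩) (fun p => U * p.2 + p.1) ?_ ?_ ?_ ?_ ?_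
  · intro l hl
    have hv := Nat.mod_lt l hU
    simp only [Finset.mem_sigma, Finset.mem_range] at hl ⊢
    refine ⟨hv, (hlt _ _ hv).2 ?_⟩
    rwa [Nat.div_add_mod]
  · intro p hp
    simp only [Finset.mem_sigma, Finset.mem_range] at hp ⊢
    exact (hlt _ _ hp.1).1 hp.2
  · intro l _
    exact Nat.div_add_mod l U
  · rintro ⟨v, k⟩ hp
    simp only [Finset.mem_sigma, Finset.mem_range] at hp
    simp only [Nat.mul_add_mod, Nat.mod_eq_of_lt hp.1, Sigma.mk.injEq, heq_eq_eq, true_and]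
    rw [Nat.mul_add_div hU, Nat.div_eq_of_lt hp.1, add_zero]
  · intro l _
    simp only [Nat.div_add_mod]

/-! ### Limits of variances and of averaged squared covariances -/

section WaveletProcess

variable {Ω : Type*} [MeasurableSpace Ω] {P : Measure Ω} {φ ψ : ℝ → ℝ} {α β L : ℝ} {M : ℕ}
  {T : ℕ} {d : ℝ} {fstar : ℝ → ℝ} {X : ℤ → Ω → ℝ}

theorem covariance_div_sq_eq [IsProbabilityMeasure P] (hW : WaveletAssumptions φ ψ α M)
    (hφ : Function.support φ ⊆ Set.Ioo (-(T : ℝ)) 0)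
    (hψ : Function.support ψ ⊆ Set.Ioo 0 (T : ℝ)) (hX : HasMemoryParameter P X d fstar)
    (hd : d ≤ M) (hf0 : 0 < fstar 0) (i u v : ℕ) (k l : ℤ) :
    (cov[fun ω => waveletCoeff φ ψ (fun k => X k ω) (i + u) k,
        fun ω => waveletCoeff φ ψ (fun k => X k ω) i (2 ^ u * l + v); P] /
      (fstar 0 * ((2 : ℝ) ^ (i + u)) ^ (2 * d))) ^ 2 =
      ‖∫ ξ, scaleKernel φ ψ T d fstar u i v ξ *
        Complex.exp (Complex.I * ((k - l : ℤ) : ℂ) * ξ)‖ ^ 2 := by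
  have h := covariance_waveletCoeff_eq_scaleKernel hW hφ hψ hX hd hf0.ne' i u v k l
  set A := fstar 0 * ((2 : ℝ) ^ (i + u)) ^ (2 * d) with hA
  have hA0 : 0 < A := by positivity
  have h2 := congrArg norm h
  rw [norm_mul, Complex.norm_real, Complex.norm_real, Real.norm_of_nonneg hA0.le,
    Real.norm_eq_abs] at h2
  rw [div_pow, ← sq_abs, h2, mul_pow, mul_div_cancel_left₀ _ (by positivity)]

/-- The case u = 0 and lag 0 of the kernel representation: the error is the integral of the kernel
difference, finite because 2d + 2α - β > 1. This is the source of the bias rate. -/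
theorem exists_abs_variance_div_sub_le [IsProbabilityMeasure P]
    (hW : WaveletAssumptions φ ψ α M) (hM : 1 ≤ M)
    (hφ : Function.support φ ⊆ Set.Ioo (-(T : ℝ)) 0)
    (hψ : Function.support ψ ⊆ Set.Ioo 0 (T : ℝ)) (hβ : β ∈ Set.Ioc (0 : ℝ) 2) (hL : 0 < L)
    (hd : d ∈ Set.Ioc ((1 + β) / 2 - α) (M : ℝ)) (hf : fstar ∈ smoothClass β L)
    (hf0 : 0 < fstar 0) (hX : HasMemoryParameter P X d fstar) :
    ∃ C : ℝ, 0 ≤ C ∧ ∀ (i : ℕ) (k : ℤ),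
      |cov[fun ω => waveletCoeff φ ψ (fun k => X k ω) i k,
        fun ω => waveletCoeff φ ψ (fun k => X k ω) i k; P] /
      (fstar 0 * ((2 : ℝ) ^ i) ^ (2 * d)) - Kpsi ψ d| ≤ C * ((2 : ℝ) ^ i) ^ (-β) := by
  obtain ⟨C, hC, h⟩ := exists_norm_scaleKernel_sub_le hW hM hφ hψ hβ hL hd.2 hf hf0 0
  have hp : 1 < 2 * d + 2 * α - β := by linarith [hd.1]
  have hdα : 1 < 2 * d + 2 * α := by linarith [hβ.1]
  have hI := integrable_one_add_abs_rpow hp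
  refine ⟨C * ∫ ξ : ℝ, (1 + |ξ|) ^ (-(2 * d + 2 * α - β)),
    mul_nonneg hC (integral_nonneg fun ξ => by positivity), fun i k => ?_⟩
  have hcov := covariance_waveletCoeff_eq_scaleKernel hW hφ hψ hX hd.2 hf0.ne' i 0 0 k k
  simp only [add_zero, pow_zero, one_mul, Nat.cast_zero, sub_self, Int.cast_zero, mul_zero,
    zero_mul, Complex.exp_zero, mul_one] at hcov
  have hA0 : 0 < fstar 0 * ((2 : ℝ) ^ i) ^ (2 * d) := by positivity
  have h1 := integrable_scaleKernel hW hφ hψ hX hd.2 hf0.ne' 0 i 0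
  have h2 := integrable_limitKernel hW hψ hd.2 hdα 0 0
  set A := fstar 0 * ((2 : ℝ) ^ i) ^ (2 * d)
  set c := cov[fun ω => waveletCoeff φ ψ (fun k => X k ω) i k,
        fun ω => waveletCoeff φ ψ (fun k => X k ω) i k; P]
  have hA0' : (A : ℂ) ≠ 0 := by exact_mod_cast hA0.ne'
  have e : ((c / A - Kpsi ψ d : ℝ) : ℂ) =
      ∫ ξ, (scaleKernel φ ψ T d fstar 0 i 0 ξ - limitKernel ψ d 0 0 ξ) := by
    rw [integral_sub h1 h2, integral_limitKernel_zero, Complex.ofReal_sub, Complex.ofReal_div,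
      hcov, mul_div_cancel_left₀ _ hA0']
  rw [← Real.norm_eq_abs, ← Complex.norm_real, e, mul_right_comm, ← integral_const_mul]
  refine norm_integral_le_of_norm_le (hI.const_mul _) ?_
  filter_upwards [Measure.ae_ne volume 0] with ξ hξ
  exact h i 0 ξ hξ

theorem tendsto_two_pow_rpow_neg {s : ℕ → ℕ} (hs : Tendsto s atTop atTop) {β : ℝ} (hβ : 0 < β) :
    Tendsto (fun n => ((2 : ℝ) ^ (s n)) ^ (-β)) atTop (𝓝 0) :=
  (tendsto_rpow_neg_atTop hβ).comp ((tendsto_pow_atTop_atTop_of_one_lt (by norm_num)).comp hs)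

set_option maxHeartbeats 1000000 in
/-- Averaged squared covariances across two scales converge to the squared norm of `DInf`. -/
theorem tendsto_average_covariance_sq [IsProbabilityMeasure P]
    (hW : WaveletAssumptions φ ψ α M) (hM : 1 ≤ M)
    (hφ : Function.support φ ⊆ Set.Ioo (-(T : ℝ)) 0)
    (hψ : Function.support ψ ⊆ Set.Ioo 0 (T : ℝ)) (hβ : β ∈ Set.Ioc (0 : ℝ) 2) (hL : 0 < L)
    (hd : d ∈ Set.Ioc ((1 + β) / 2 - α) (M : ℝ)) (hf : fstar ∈ smoothClass β L)
    (hf0 : 0 < fstar 0) (hX : HasMemoryParameter P X d fstar) (u : ℕ) {s m m' : ℕ → ℕ}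
    (hs : Tendsto s atTop atTop) (hm : Tendsto (fun n => (m n : ℝ)) atTop atTop)
    (hmm : ∀ n, 2 ^ u * m n ≤ m' n) :
    Tendsto (fun n => (m n : ℝ)⁻¹ * ∑ k ∈ Finset.range (m n), ∑ l ∈ Finset.range (m' n),
      (cov[fun ω => waveletCoeff φ ψ (fun k => X k ω) (s n + u) k,
        fun ω => waveletCoeff φ ψ (fun k => X k ω) (s n) l; P] /
      (fstar 0 * ((2 : ℝ) ^ (s n + u)) ^ (2 * d))) ^ 2) atTop
      (𝓝 (2 * Real.pi * ∫ x in Set.Ioo (-Real.pi) Real.pi, ‖DInf ψ u d x‖ ^ 2)) := by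
  obtain ⟨C, hC, h⟩ := exists_norm_scaleKernel_sub_le hW hM hφ hψ hβ hL hd.2 hf hf0 u
  obtain ⟨C', hC', h'⟩ := exists_norm_limitKernel_le hW hψ hd.2 u
  have hp : 1 < 2 * d + 2 * α - β := by linarith [hd.1]
  have hdα : 1 < 2 * d + 2 * α := by linarith [hβ.1]
  have hU : 0 < 2 ^ u := by positivity
  have h1 := fun i v => integrable_scaleKernel hW hφ hψ hX hd.2 hf0.ne' u i v
  have h2 := integrable_limitKernel hW hψ hd.2 hdα u
  -- Locations at the finer scale are sorted by residue v modulo 2^u; each class is a Toeplitz array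
  -- with its own kernel.
  have hform : ∀ n, (m n : ℝ)⁻¹ * ∑ k ∈ Finset.range (m n), ∑ l ∈ Finset.range (m' n),
      (cov[fun ω => waveletCoeff φ ψ (fun k => X k ω) (s n + u) k,
        fun ω => waveletCoeff φ ψ (fun k => X k ω) (s n) l; P] /
      (fstar 0 * ((2 : ℝ) ^ (s n + u)) ^ (2 * d))) ^ 2 =
      ∑ v ∈ Finset.range (2 ^ u), (m n : ℝ)⁻¹ * ∑ k ∈ Finset.range (m n),
        ∑ l ∈ Finset.range ((m' n + 2 ^ u - 1 - v) / 2 ^ u),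
        ‖∫ ξ, scaleKernel φ ψ T d fstar u (s n) v ξ *
          Complex.exp (Complex.I * (((k : ℤ) - (l : ℤ) : ℤ) : ℂ) * ξ)‖ ^ 2 := by
    intro n
    rw [← Finset.mul_sum, Finset.sum_comm (s := Finset.range (2 ^ u))]
    congr 1
    refine Finset.sum_congr rfl fun k _ => ?_
    rw [sum_range_eq_sum_mod hU]
    refine Finset.sum_congr rfl fun v _ => Finset.sum_congr rfl fun l _ => ?_
    rw [← covariance_div_sq_eq hW hφ hψ hX hd.2 hf0 (s n) u v k l]
    push_cast
    rfl
  simp only [hform]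
  rw [← (hasSum_sq_integral_limitKernel hW hψ hd.2 hdα u).tsum_eq, Summable.tsum_finsetSum
    fun v _ => (hasSum_sq_integral_mul_exp (h2 v) hdα hC' (h' v)).summable]
  refine tendsto_finsetSum _ fun v hv => ?_
  have hsub : ∀ n (τ : ℤ), (∫ ξ, scaleKernel φ ψ T d fstar u (s n) v ξ *
        Complex.exp (Complex.I * (τ : ℂ) * ξ)) -
      ∫ ξ, limitKernel ψ d u v ξ * Complex.exp (Complex.I * (τ : ℂ) * ξ) =
      ∫ ξ, (scaleKernel φ ψ T d fstar u (s n) v ξ - limitKernel ψ d u v ξ) *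
        Complex.exp (Complex.I * (τ : ℂ) * ξ) := by
    intro n τ
    rw [← integral_sub (integrable_mul_exp_int (h1 _ v) τ) (integrable_mul_exp_int (h2 v) τ)]
    simp only [sub_mul]
  have hCn : ∀ n, 0 ≤ C * ((2 : ℝ) ^ (s n + u)) ^ (-β) := fun n => by positivity
  set S := ∑' l : ℤ, (1 + |(l : ℝ)|) ^ (-(2 * d + 2 * α - β)) with hS
  refine tendsto_toeplitz_average (q := fun n => (m' n + 2 ^ u - 1 - v) / 2 ^ u)
    (x := fun n τ => ∫ ξ, scaleKernel φ ψ T d fstar u (s n) v ξ *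
          Complex.exp (Complex.I * (τ : ℂ) * ξ))
    -- The summand 1 makes ε strictly positive even if C = 0.
    (ε := fun n => ((2 * Real.pi) ^ 2 * S ^ 2 * C ^ 2 + 1) * (((2 : ℝ) ^ (s n + u)) ^ (-β)) ^ 2)
    hm (fun n => ?_) (hasSum_sq_integral_mul_exp (h2 v) hdα hC' (h' v)).summable
    (fun n => ?_) (fun n => by positivity) ?_ (fun n => ?_)
  · rw [Nat.le_div_iff_mul_le hU, mul_comm]
    have := hmm n
    have := Finset.mem_range.1 hv
    omega
  · simp only [hsub]
    exact (hasSum_sq_integral_mul_exp ((h1 _ v).sub (h2 v)) hp (hCn n) (h (s n) v)).summable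
  · have := (tendsto_two_pow_rpow_neg (tendsto_atTop_mono (fun n => Nat.le_add_right (s n) u) hs) hβ.1).pow 2
    simpa using this.const_mul ((2 * Real.pi) ^ 2 * S ^ 2 * C ^ 2 + 1)
  · simp only [hsub]
    refine (tsum_sq_integral_mul_exp_le ((h1 _ v).sub (h2 v)) hp (hCn n) (h (s n) v)).trans ?_
    rw [← hS, mul_pow C, ← mul_assoc]
    refine mul_le_mul_of_nonneg_right ?_ (by positivity)
    linarith

end WaveletProcess

/-! ### Sums of squares of a Gaussian process -/

section SumSq

variable {Ω ι : Type*} [MeasurableSpace Ω] {P : Measure Ω} {X : ι → Ω → ℝ}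

theorem memLp_four_sq_of_hasGaussianLaw {W : Ω → ℝ} (hW : HasGaussianLaw W P) :
    MemLp (fun ω => W ω ^ 2) 4 P := by
  refine memLp_four_of_integrable_pow (hW.aemeasurable.pow_const 2).aestronglyMeasurable ?_
  simpa only [← pow_mul] using integrable_pow_of_hasGaussianLaw hW 8

theorem memLp_four_sum_sq (hX : IsGaussianProcess X P) (f : ℕ → ι) (m : ℕ) :
    MemLp (fun ω => ∑ k ∈ Finset.range m, X (f k) ω ^ 2) 4 P :=
  memLp_finsetSum _ fun k _ => memLp_four_sq_of_hasGaussianLaw (hX.hasGaussianLaw_eval (f k))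

theorem integral_sum_sq (hX : IsGaussianProcess X P) (h0 : ∀ i, P[X i] = 0) (f : ℕ → ι) (m : ℕ) :
    ∫ ω, ∑ k ∈ Finset.range m, X (f k) ω ^ 2 ∂P = ∑ k ∈ Finset.range m, Var[X (f k); P] := by
  rw [integral_finsetSum _ fun k _ =>
    integrable_pow_of_hasGaussianLaw (hX.hasGaussianLaw_eval (f k)) 2]
  exact Finset.sum_congr rfl fun k _ =>
    integral_sq_of_hasGaussianLaw (hX.hasGaussianLaw_eval (f k)) (h0 _)

theorem covariance_sum_sq (hX : IsGaussianProcess X P) (h0 : ∀ i, P[X i] = 0) (f g : ℕ → ι)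
    (m m' : ℕ) :
    cov[fun ω => ∑ k ∈ Finset.range m, X (f k) ω ^ 2,
        fun ω => ∑ l ∈ Finset.range m', X (g l) ω ^ 2; P] =
      2 * ∑ k ∈ Finset.range m, ∑ l ∈ Finset.range m', cov[X (f k), X (g l); P] ^ 2 := by
  have := hX.isProbabilityMeasure
  have h2 : ∀ i, MemLp (fun ω => X i ω ^ 2) 2 P := fun i =>
    (memLp_four_sq_of_hasGaussianLaw (hX.hasGaussianLaw_eval i)).mono_exponent (by norm_num)
  rw [covariance_fun_sum_fun_sum' (fun k _ => h2 _) fun l _ => h2 _]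
  simp only [Finset.mul_sum]
  exact Finset.sum_congr rfl fun k _ => Finset.sum_congr rfl fun l _ =>
    covariance_sq_of_hasGaussianLaw hX.hasGaussianLaw_prodMk (h0 _) (h0 _)

theorem integral_sum_sq_sub_integral_pow_four_le (hX : IsGaussianProcess X P)
    (h0 : ∀ i, P[X i] = 0) (f : ℕ → ι) (m : ℕ) :
    ∫ ω, (∑ k ∈ Finset.range m, X (f k) ω ^ 2 - ∑ k ∈ Finset.range m, Var[X (f k); P]) ^ 4 ∂P ≤
      60 * (∑ k ∈ Finset.range m, ∑ l ∈ Finset.range m, cov[X (f k), X (f l); P] ^ 2) ^ 2 := by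
  have hG : HasGaussianLaw (fun ω => (fun k : Fin m => X (f k) ω)) P := by
    have h := (hX.comp_right fun k : Fin m => f k).hasGaussianLaw Finset.univ
    exact h.map (ContinuousLinearMap.pi fun k : Fin m =>
      ContinuousLinearMap.proj (R := ℝ) (φ := fun _ : (Finset.univ : Finset (Fin m)) => ℝ)
        ⟨k, Finset.mem_univ k⟩)
  have key := integral_sum_sq_sub_pow_four_le (W := fun k : Fin m => X (f k)) hG fun k => h0 _
  simpa only [Finset.sum_range] using key

theorem ae_ne_zero_of_hasGaussianLaw {W : Ω → ℝ} (hW : HasGaussianLaw W P)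
    (hv : 0 < Var[W; P]) : ∀ᵐ ω ∂P, W ω ≠ 0 := by
  have hmap := hW.map_eq_gaussianReal
  have hne : Var[W; P].toNNReal ≠ 0 := (Real.toNNReal_pos.2 hv).ne'
  have := nullSingletonClass_gaussianReal (μ := P[W]) hne
  have h : ∀ᵐ x ∂(P.map W), x ≠ 0 := by
    rw [hmap]
    exact Measure.ae_ne _ 0
  exact ae_of_ae_map hW.aemeasurable h

/-- Keeping only one square gives the average ≥ Z²/m with Z Gaussian of variance at least 1/2, hence
a power -1/4 of at most m^{1/4}|Z|^{-1/2}. The growth m^{1/4} is wasteful, but no information on the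
dependence is needed. -/
theorem integral_scaled_average_rpow_le (hX : IsGaussianProcess X P) (h0 : ∀ i, P[X i] = 0)
    (f : ℕ → ι) {m : ℕ} (hm : 0 < m) {s : ℝ} (hs : 0 < s) (hv : s / 2 ≤ Var[X (f 0); P]) :
    (∀ᵐ ω ∂P, 0 < s⁻¹ * ((m : ℝ)⁻¹ * ∑ k ∈ Finset.range m, X (f k) ω ^ 2)) ∧
    Integrable (fun ω => (s⁻¹ * ((m : ℝ)⁻¹ * ∑ k ∈ Finset.range m, X (f k) ω ^ 2)) ^
      (-(1 / 4) : ℝ)) P ∧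
    ∫ ω, (s⁻¹ * ((m : ℝ)⁻¹ * ∑ k ∈ Finset.range m, X (f k) ω ^ 2)) ^ (-(1 / 4) : ℝ) ∂P ≤
      (1 + (√Real.pi)⁻¹ * ∫ x in Set.Ioc (-1 : ℝ) 1, |x| ^ (-(1 / 2) : ℝ)) * √√m := by
  have hG := hX.hasGaussianLaw_eval (f 0)
  have hm0 : (0 : ℝ) < m := by exact_mod_cast hm
  have hsq : 0 < √s := Real.sqrt_pos.2 hs
  have hG' : HasGaussianLaw (fun ω => (√s)⁻¹ * X (f 0) ω) P := hG.fun_smul (√s)⁻¹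
  have hc0 : ∫ ω, (√s)⁻¹ * X (f 0) ω ∂P = 0 := by
    rw [integral_const_mul, h0, mul_zero]
  have hvar : (1 / 2 : ℝ) ≤ Var[fun ω => (√s)⁻¹ * X (f 0) ω; P] := by
    rw [variance_const_mul, inv_pow, Real.sq_sqrt hs.le, inv_mul_eq_div, le_div_iff₀ hs]
    linarith
  obtain ⟨hI, hle⟩ := integrable_abs_rpow_neg_half_of_hasGaussianLaw hG' hc0 (by norm_num) hvar
  rw [show 2 * Real.pi * (1 / 2) = Real.pi by ring] at hle
  have hne := ae_ne_zero_of_hasGaussianLaw hG (by linarith)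
  have hlow : ∀ ω, (m : ℝ)⁻¹ * ((√s)⁻¹ * X (f 0) ω) ^ 2 ≤
      s⁻¹ * ((m : ℝ)⁻¹ * ∑ k ∈ Finset.range m, X (f k) ω ^ 2) := by
    intro ω
    rw [mul_pow, inv_pow, Real.sq_sqrt hs.le, mul_left_comm]
    gcongr
    exact Finset.single_le_sum (f := fun k => X (f k) ω ^ 2) (fun k _ => sq_nonneg _)
      (Finset.mem_range.2 hm)
  have hpos : ∀ᵐ ω ∂P, 0 < (m : ℝ)⁻¹ * ((√s)⁻¹ * X (f 0) ω) ^ 2 := by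
    filter_upwards [hne] with ω hω
    have : (√s)⁻¹ * X (f 0) ω ≠ 0 := mul_ne_zero (inv_ne_zero hsq.ne') hω
    positivity
  have hbd : ∀ᵐ ω ∂P, (s⁻¹ * ((m : ℝ)⁻¹ * ∑ k ∈ Finset.range m, X (f k) ω ^ 2)) ^
      (-(1 / 4) : ℝ) ≤ √√m * |(√s)⁻¹ * X (f 0) ω| ^ (-(1 / 2) : ℝ) := by
    filter_upwards [hpos] with ω hω
    refine (Real.rpow_le_rpow_of_nonpos hω (hlow ω) (by norm_num)).trans_eq ?_
    have e : √√m = (m : ℝ) ^ (1 / 4 : ℝ) := by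
      rw [Real.sqrt_eq_rpow, Real.sqrt_eq_rpow, ← Real.rpow_mul hm0.le]
      norm_num
    rw [e, Real.mul_rpow (by positivity) (by positivity), Real.inv_rpow hm0.le,
      Real.rpow_neg hm0.le, inv_inv, ← sq_abs ((√s)⁻¹ * X (f 0) ω), ← Real.rpow_natCast,
      ← Real.rpow_mul (abs_nonneg _)]
    norm_num
  have hdom := hI.const_mul (√√m)
  have hmeas : AEStronglyMeasurable (fun ω => (s⁻¹ * ((m : ℝ)⁻¹ *
      ∑ k ∈ Finset.range m, X (f k) ω ^ 2)) ^ (-(1 / 4) : ℝ)) P := by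
    have h1 := (memLp_four_sum_sq hX f m).1.aemeasurable
    exact (((h1.const_mul _).const_mul _).pow_const _).aestronglyMeasurable
  have hint := hdom.mono' hmeas (by
    filter_upwards [hbd] with ω hω
    rwa [Real.norm_of_nonneg]
    refine Real.rpow_nonneg ?_ _
    exact le_trans (by positivity) (hlow ω))
  refine ⟨hpos.mono fun ω hω => hω.trans_le (hlow ω), hint, ?_⟩
  calc _ ≤ ∫ ω, √√m * |(√s)⁻¹ * X (f 0) ω| ^ (-(1 / 2) : ℝ) ∂P := integral_mono_ae hint hdom hbd
    _ ≤ _ := by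
      rw [integral_const_mul, mul_comm]
      gcongr

end SumSq

/-! ### Numbers of available coefficients -/

/-- Multiplying by 2^u before taking integer parts loses only boundary terms (2^u - 1)(T - 1) ≥ 0.
This guarantees that each residue class at the finer scale is at least as long as the coarse range.
-/
theorem two_pow_mul_numCoeff_le {T : ℕ} (hT : 1 ≤ T) (n i u : ℕ) :
    2 ^ u * numCoeff T n (i + u) ≤ numCoeff T n i := by
  have hT' : (1 : ℝ) ≤ T := by exact_mod_cast hT
  have hu : (1 : ℝ) ≤ 2 ^ u := one_le_pow₀ (by norm_num)
  unfold numCoeff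
  set y := (2 : ℝ) ^ (-((i + u : ℕ) : ℝ)) * ((n : ℝ) - T + 1) - T + 1 with hy
  rcases le_or_gt 0 y with h | h
  · have h1 := Nat.floor_le h
    refine Nat.le_floor ?_
    push_cast
    have e : (2 : ℝ) ^ u * ((2 : ℝ) ^ (-((i + u : ℕ) : ℝ)) * ((n : ℝ) - T + 1)) =
        (2 : ℝ) ^ (-(i : ℝ)) * ((n : ℝ) - T + 1) := by
      rw [two_rpow_neg_natCast, two_rpow_neg_natCast, pow_add]
      field_simp
    calc (2 : ℝ) ^ u * ⌊y⌋₊ ≤ 2 ^ u * y := by gcongr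
      _ = (2 : ℝ) ^ (-(i : ℝ)) * ((n : ℝ) - T + 1) - 2 ^ u * (T - 1) := by rw [← e, hy]; ring
      _ ≤ _ := by nlinarith
  · rw [Nat.floor_of_nonpos h.le, mul_zero]
    exact Nat.zero_le _

theorem tendsto_numCoeff_div {T : ℕ} {J : ℕ → ℕ} (i : ℕ)
    (hr : Tendsto (fun n : ℕ => (n : ℝ) * (2 : ℝ) ^ (-(J n : ℝ))) atTop atTop) :
    Tendsto (fun n : ℕ => (numCoeff T n (J n + i) : ℝ) / ((n : ℝ) * (2 : ℝ) ^ (-(J n : ℝ)))) atTop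
      (𝓝 ((2 : ℝ) ^ i)⁻¹) := by
  set r : ℕ → ℝ := fun n => (n : ℝ) * (2 : ℝ) ^ (-(J n : ℝ)) with hrdef
  set y : ℕ → ℝ := fun n => (2 : ℝ) ^ (-((J n + i : ℕ) : ℝ)) * ((n : ℝ) - T + 1) - T + 1 with hy
  have hinv : Tendsto (fun n => (r n)⁻¹) atTop (𝓝 0) := tendsto_inv_atTop_zero.comp hr
  have hn : Tendsto (fun n : ℕ => (n : ℝ)⁻¹) atTop (𝓝 0) := tendsto_inv_atTop_nhds_zero_nat
  have hyr : Tendsto (fun n => y n / r n) atTop (𝓝 ((2 : ℝ) ^ i)⁻¹) := by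
    have h1 : Tendsto (fun n : ℕ => ((2 : ℝ) ^ i)⁻¹ * (1 + (1 - (T : ℝ)) * (n : ℝ)⁻¹) +
        (1 - (T : ℝ)) * (r n)⁻¹) atTop (𝓝 ((2 : ℝ) ^ i)⁻¹) := by
      simpa using (((hn.const_mul (1 - (T : ℝ))).const_add 1).const_mul ((2 : ℝ) ^ i)⁻¹).add
        (hinv.const_mul (1 - (T : ℝ)))
    refine h1.congr' ?_
    filter_upwards [eventually_gt_atTop 0] with n hn0
    have hn0' : (n : ℝ) ≠ 0 := by positivity
    simp only [hy, hrdef]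
    rw [two_rpow_neg_natCast, two_rpow_neg_natCast, pow_add]
    field_simp
    ring
  have hlow : Tendsto (fun n => y n / r n - (r n)⁻¹) atTop (𝓝 ((2 : ℝ) ^ i)⁻¹) := by
    simpa using hyr.sub hinv
  have hypos : ∀ᶠ n in atTop, 0 < y n / r n := hyr.eventually (lt_mem_nhds (by positivity))
  refine tendsto_of_tendsto_of_tendsto_of_le_of_le' hlow hyr ?_ ?_
  · filter_upwards [hr.eventually_gt_atTop 0] with n hrn
    rw [← one_div, ← sub_div]
    have := Nat.lt_floor_add_one (y n)
    refine div_le_div_of_nonneg_right ?_ hrn.le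
    unfold numCoeff
    linarith
  · filter_upwards [hr.eventually_gt_atTop 0, hypos] with n hrn hyn
    refine div_le_div_of_nonneg_right ?_ hrn.le
    exact Nat.floor_le ((div_pos_iff_of_pos_right hrn).1 hyn).le

/-- The growth conditions on the lowest scale. -/
theorem scale_growth {J : ℕ → ℕ} {β : ℝ} (hβ : 0 < β)
    (hJ : Tendsto (fun n : ℕ => (n : ℝ) * (2 : ℝ) ^ (-((J n : ℝ) * (1 + 2 * β))) +
        (n : ℝ)⁻¹ * (2 : ℝ) ^ (J n : ℝ)) atTop (𝓝 0)) :
    Tendsto J atTop atTop ∧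
    Tendsto (fun n : ℕ => (n : ℝ) * (2 : ℝ) ^ (-(J n : ℝ))) atTop atTop ∧
    Tendsto (fun n : ℕ => (n : ℝ) * (2 : ℝ) ^ (-(J n : ℝ)) * (((2 : ℝ) ^ J n) ^ (-β)) ^ 2)
      atTop (𝓝 0) := by
  have h1 : Tendsto (fun n : ℕ => (n : ℝ) * (2 : ℝ) ^ (-((J n : ℝ) * (1 + 2 * β)))) atTop
      (𝓝 0) := by
    refine squeeze_zero (fun n => by positivity) (fun n => ?_) hJ
    exact le_add_of_nonneg_right (by positivity)
  have h2 : Tendsto (fun n : ℕ => (n : ℝ)⁻¹ * (2 : ℝ) ^ (J n : ℝ)) atTop (𝓝 0) := by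
    refine squeeze_zero (fun n => by positivity) (fun n => ?_) hJ
    exact le_add_of_nonneg_left (by positivity)
  refine ⟨?_, ?_, ?_⟩
  · refine tendsto_atTop.2 fun b => ?_
    have hb := (tendsto_natCast_atTop_atTop (R := ℝ)).eventually_ge_atTop
      ((2 : ℝ) ^ ((b : ℝ) * (1 + 2 * β)))
    filter_upwards [hb, h1.eventually (gt_mem_nhds zero_lt_one)] with n hn hlt
    rw [Real.rpow_neg (by norm_num), ← div_eq_mul_inv, div_lt_one (by positivity)] at hlt
    have h3 := (Real.rpow_lt_rpow_left_iff (by norm_num : (1 : ℝ) < 2)).1 (hn.trans_lt hlt)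
    have h4 : (b : ℝ) < J n := lt_of_mul_lt_mul_right h3 (by linarith)
    exact_mod_cast h4.le
  · have h3 : Tendsto (fun n : ℕ => (n : ℝ)⁻¹ * (2 : ℝ) ^ (J n : ℝ)) atTop (𝓝[>] 0) := by
      refine tendsto_nhdsWithin_iff.2 ⟨h2, ?_⟩
      filter_upwards [eventually_gt_atTop 0] with n hn
      have : (0 : ℝ) < n := by exact_mod_cast hn
      exact Set.mem_Ioi.2 (by positivity)
    refine (tendsto_inv_nhdsGT_zero.comp h3).congr fun n => ?_
    simp only [Function.comp_apply]
    rw [mul_inv, inv_inv, Real.rpow_neg (by norm_num)]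
  -- The product equals n 2^{-J(1+2β)} exactly.
  · refine h1.congr fun n => ?_
    rw [mul_assoc, ← Real.rpow_natCast (((2 : ℝ) ^ J n) ^ (-β)), ← Real.rpow_mul (by positivity),
      ← Real.rpow_natCast (2 : ℝ), ← Real.rpow_mul (by norm_num),
      ← Real.rpow_add (by norm_num)]
    congr 2
    push_cast
    ring

/-! ### The normalized empirical variances -/

/-- Asymptotic value of the variance of the wavelet coefficients at scale `j`. -/
noncomputable def limitVar (ψ : ℝ → ℝ) (d : ℝ) (fstar : ℝ → ℝ) (j : ℕ) : ℝ :=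
  fstar 0 * ((2 : ℝ) ^ j) ^ (2 * d) * Kpsi ψ d

/-- Empirical variance at scale `j` divided by its asymptotic mean. -/
noncomputable def normVar {Ω : Type*} (φ ψ : ℝ → ℝ) (T : ℕ) (d : ℝ) (fstar : ℝ → ℝ)
    (X : ℤ → Ω → ℝ) (n j : ℕ) (ω : Ω) : ℝ :=
  (limitVar ψ d fstar j)⁻¹ * ((numCoeff T n j : ℝ)⁻¹ *
    ∑ k ∈ Finset.range (numCoeff T n j), waveletCoeff φ ψ (fun k => X k ω) j (k : ℤ) ^ 2)

theorem log_limitVar {ψ : ℝ → ℝ} {d : ℝ} {fstar : ℝ → ℝ} (hf0 : 0 < fstar 0)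
    (hK : 0 < Kpsi ψ d) (j : ℕ) :
    Real.log (limitVar ψ d fstar j) =
      Real.log (fstar 0) + Real.log (Kpsi ψ d) + 2 * d * (j * Real.log 2) := by
  rw [limitVar, Real.log_mul (by positivity) hK.ne', Real.log_mul hf0.ne' (by positivity),
    Real.log_rpow (by positivity), Real.log_pow]
  ring

section WaveletProcess

variable {Ω : Type*} [MeasurableSpace Ω] {P : Measure Ω} {φ ψ : ℝ → ℝ}
  {α β L : ℝ} {M : ℕ} {T : ℕ} {d : ℝ} {fstar : ℝ → ℝ} {X : ℤ → Ω → ℝ}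

/-- The wavelet coefficients as a process indexed by scale and location. -/
noncomputable def coeffProcess (φ ψ : ℝ → ℝ) (X : ℤ → Ω → ℝ) (p : ℕ × ℤ) (ω : Ω) : ℝ :=
  waveletCoeff φ ψ (fun k => X k ω) p.1 p.2

theorem memLp_normVar (hG : IsGaussianProcess (coeffProcess φ ψ X) P) (n j : ℕ) :
    MemLp (normVar φ ψ T d fstar X n j) 4 P :=
  ((memLp_four_sum_sq hG (fun k => (j, (k : ℤ))) _).const_mul _).const_mul _

theorem integral_normVar (hG : IsGaussianProcess (coeffProcess φ ψ X) P)
    (h0 : ∀ p, P[coeffProcess φ ψ X p] = 0) (n j : ℕ) :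
    ∫ ω, normVar φ ψ T d fstar X n j ω ∂P = (limitVar ψ d fstar j)⁻¹ *
      ((numCoeff T n j : ℝ)⁻¹ * ∑ k ∈ Finset.range (numCoeff T n j),
        Var[coeffProcess φ ψ X (j, (k : ℤ)); P]) := by
  have := integral_sum_sq hG h0 (fun k => (j, (k : ℤ))) (numCoeff T n j)
  rw [← this, ← integral_const_mul, ← integral_const_mul]
  rfl

theorem abs_integral_normVar_sub_one_le (hG : IsGaussianProcess (coeffProcess φ ψ X) P)
    (h0 : ∀ p, P[coeffProcess φ ψ X p] = 0) (hf0 : 0 < fstar 0) (hK : 0 < Kpsi ψ d) {n j : ℕ}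
    (hm : 0 < numCoeff T n j) {δ : ℝ}
    (hδ : ∀ k : ℤ, |Var[coeffProcess φ ψ X (j, k); P] / (fstar 0 * ((2 : ℝ) ^ j) ^ (2 * d)) -
      Kpsi ψ d| ≤ δ) :
    |∫ ω, normVar φ ψ T d fstar X n j ω ∂P - 1| ≤ (Kpsi ψ d)⁻¹ * δ := by
  rw [integral_normVar hG h0, limitVar]
  set A := fstar 0 * ((2 : ℝ) ^ j) ^ (2 * d) with hA
  have hA0 : 0 < A := by positivity
  set m := numCoeff T n j
  have hm0 : (0 : ℝ) < m := by exact_mod_cast hm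
  set K := Kpsi ψ d
  have e : (A * K)⁻¹ * ((m : ℝ)⁻¹ * ∑ k ∈ Finset.range m,
      Var[coeffProcess φ ψ X (j, (k : ℤ)); P]) - 1 =
      K⁻¹ * ((m : ℝ)⁻¹ * ∑ k ∈ Finset.range m,
        (Var[coeffProcess φ ψ X (j, (k : ℤ)); P] / A - K)) := by
    rw [Finset.sum_sub_distrib, ← Finset.sum_div, Finset.sum_const, Finset.card_range,
      nsmul_eq_mul]
    field_simp
  rw [e, abs_mul, abs_of_pos (inv_pos.2 hK)]
  refine mul_le_mul_of_nonneg_left ?_ (inv_pos.2 hK).le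
  rw [abs_mul, abs_of_pos (inv_pos.2 hm0), inv_mul_le_iff₀ hm0]
  refine (Finset.abs_sum_le_sum_abs _ _).trans ?_
  refine (Finset.sum_le_sum (g := fun _ => δ) fun (k : ℕ) _ => hδ k).trans ?_
  rw [Finset.sum_const, Finset.card_range, nsmul_eq_mul]

/-- Both scales are normalized by the coarse-scale factor inside the square, matching the kernel
limit; the mismatch with the finer scale's own normalization is the factor 2^{2du}. -/
theorem covariance_normVar (hG : IsGaussianProcess (coeffProcess φ ψ X) P)
    (h0 : ∀ p, P[coeffProcess φ ψ X p] = 0) (hf0 : 0 < fstar 0) (n j u : ℕ) :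
    cov[normVar φ ψ T d fstar X n (j + u), normVar φ ψ T d fstar X n j; P] =
      2 * ((2 : ℝ) ^ u) ^ (2 * d) / Kpsi ψ d ^ 2 * (numCoeff T n j : ℝ)⁻¹ *
      ((numCoeff T n (j + u) : ℝ)⁻¹ * ∑ k ∈ Finset.range (numCoeff T n (j + u)),
        ∑ l ∈ Finset.range (numCoeff T n j),
        (cov[coeffProcess φ ψ X (j + u, (k : ℤ)), coeffProcess φ ψ X (j, (l : ℤ)); P] /
          (fstar 0 * ((2 : ℝ) ^ (j + u)) ^ (2 * d))) ^ 2) := by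
  have h := covariance_sum_sq hG h0 (fun k => (j + u, (k : ℤ))) (fun l => (j, (l : ℤ)))
    (numCoeff T n (j + u)) (numCoeff T n j)
  have e : cov[normVar φ ψ T d fstar X n (j + u), normVar φ ψ T d fstar X n j; P] =
      (limitVar ψ d fstar (j + u))⁻¹ * ((numCoeff T n (j + u) : ℝ)⁻¹ *
      ((limitVar ψ d fstar j)⁻¹ * ((numCoeff T n j : ℝ)⁻¹ *
      cov[fun ω => ∑ k ∈ Finset.range (numCoeff T n (j + u)),
          coeffProcess φ ψ X (j + u, (k : ℤ)) ω ^ 2,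
        fun ω => ∑ l ∈ Finset.range (numCoeff T n j),
          coeffProcess φ ψ X (j, (l : ℤ)) ω ^ 2; P]))) := by
    rw [← covariance_const_mul_right, ← covariance_const_mul_right, ← covariance_const_mul_left,
      ← covariance_const_mul_left]
    rfl
  rw [e, h]
  simp only [div_pow, ← Finset.sum_div]
  have hp : ((2 : ℝ) ^ (j + u)) ^ (2 * d) = ((2 : ℝ) ^ j) ^ (2 * d) * ((2 : ℝ) ^ u) ^ (2 * d) := by
    rw [pow_add, Real.mul_rpow (by positivity) (by positivity)]
  rw [limitVar, limitVar, hp]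
  have h1 : ((2 : ℝ) ^ j) ^ (2 * d) ≠ 0 := by positivity
  have h2 : ((2 : ℝ) ^ u) ^ (2 * d) ≠ 0 := by positivity
  have h3 := hf0.ne'
  generalize ((2 : ℝ) ^ j) ^ (2 * d) = a at *
  generalize ((2 : ℝ) ^ u) ^ (2 * d) = b at *
  generalize fstar 0 = f at *
  generalize (numCoeff T n j : ℝ) = m
  generalize (numCoeff T n (j + u) : ℝ) = m'
  rw [mul_inv, mul_inv, mul_inv, mul_inv, mul_inv, div_eq_mul_inv, div_eq_mul_inv, mul_pow,
    mul_pow, mul_inv, mul_inv]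
  field_simp

/-- Arranged so that the final squared factor is the convergent average of squared covariances at
equal scales, leaving the explicit rate m⁻². -/
theorem integral_normVar_sub_pow_four_le (hG : IsGaussianProcess (coeffProcess φ ψ X) P)
    (h0 : ∀ p, P[coeffProcess φ ψ X p] = 0) (n j : ℕ) :
    ∫ ω, (normVar φ ψ T d fstar X n j ω - ∫ ω, normVar φ ψ T d fstar X n j ω ∂P) ^ 4 ∂P ≤
      60 * (Kpsi ψ d ^ 4)⁻¹ * ((numCoeff T n j : ℝ)⁻¹) ^ 2 *
      ((numCoeff T n j : ℝ)⁻¹ * ∑ k ∈ Finset.range (numCoeff T n j),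
        ∑ l ∈ Finset.range (numCoeff T n j),
        (cov[coeffProcess φ ψ X (j, (k : ℤ)), coeffProcess φ ψ X (j, (l : ℤ)); P] /
          (fstar 0 * ((2 : ℝ) ^ j) ^ (2 * d))) ^ 2) ^ 2 := by
  have h := integral_sum_sq_sub_integral_pow_four_le hG h0 (fun k => (j, (k : ℤ)))
    (numCoeff T n j)
  rw [integral_normVar hG h0]
  set m := numCoeff T n j
  have e : ∀ ω, (normVar φ ψ T d fstar X n j ω - (limitVar ψ d fstar j)⁻¹ *
      ((m : ℝ)⁻¹ * ∑ k ∈ Finset.range m, Var[coeffProcess φ ψ X (j, (k : ℤ)); P])) ^ 4 =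
      ((limitVar ψ d fstar j)⁻¹ * (m : ℝ)⁻¹) ^ 4 *
      (∑ k ∈ Finset.range m, coeffProcess φ ψ X (j, (k : ℤ)) ω ^ 2 -
        ∑ k ∈ Finset.range m, Var[coeffProcess φ ψ X (j, (k : ℤ)); P]) ^ 4 := by
    intro ω
    rw [← mul_pow, ← mul_assoc, mul_sub]
    congr 2
    rw [mul_assoc]
    rfl
  simp only [e]
  rw [integral_const_mul]
  refine (mul_le_mul_of_nonneg_left h (by positivity)).trans_eq ?_
  simp only [div_pow, ← Finset.sum_div, limitVar]
  generalize ∑ k ∈ Finset.range m, ∑ l ∈ Finset.range m,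
    cov[coeffProcess φ ψ X (j, (k : ℤ)), coeffProcess φ ψ X (j, (l : ℤ)); P] ^ 2 = s
  generalize fstar 0 * ((2 : ℝ) ^ j) ^ (2 * d) = a
  generalize (m : ℝ) = b
  generalize Kpsi ψ d = c
  simp only [mul_inv, div_eq_mul_inv, mul_pow, inv_pow]
  ring

end WaveletProcess

theorem asympVar_apply_add (ψ : ℝ → ℝ) (d : ℝ) {ℓ : ℕ} {i j : Fin (ℓ + 1)} {u : ℕ}
    (h : (i : ℕ) = j + u) :
    asympVar ψ d ℓ i j = 2 * ((2 : ℝ) ^ u) ^ (2 * d) / Kpsi ψ d ^ 2 * 2 ^ (j : ℕ) *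
      (2 * Real.pi * ∫ x in Set.Ioo (-Real.pi) Real.pi, ‖DInf ψ u d x‖ ^ 2) := by
  have h1 : Nat.dist i j = u := by rw [h, Nat.dist]; omega
  have h2 : min (i : ℕ) (j : ℕ) = j := by omega
  rw [asympVar, Matrix.of_apply, h1, h2, ← Real.rpow_natCast (2 : ℝ) u,
    ← Real.rpow_mul (by norm_num), mul_comm (u : ℝ)]
  ring

theorem asympVar_comm (ψ : ℝ → ℝ) (d : ℝ) {ℓ : ℕ} (i j : Fin (ℓ + 1)) :
    asympVar ψ d ℓ i j = asympVar ψ d ℓ j i := by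
  rw [asympVar, Matrix.of_apply, Matrix.of_apply, Nat.dist_comm, min_comm]

/-- Decomposition of the estimation error in terms of the normalized empirical variances. -/
theorem dHat_sub_eq {Ω : Type*} {φ ψ : ℝ → ℝ} {T n : ℕ} {d : ℝ} {fstar : ℝ → ℝ}
    {X : ℤ → Ω → ℝ} {ℓ : ℕ} {w : Fin (ℓ + 1) → ℝ} (hw0 : ∑ i, w i = 0)
    (hw1 : 2 * Real.log 2 * ∑ i : Fin (ℓ + 1), ((i : ℕ) : ℝ) * w i = 1)
    (hf0 : 0 < fstar 0) (hK : 0 < Kpsi ψ d) {J : ℕ} {ω : Ω}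
    (hpos : ∀ i : Fin (ℓ + 1), 0 < normVar φ ψ T d fstar X n (J + i) ω) :
    dHat φ ψ T n w J (fun k => X k ω) - d =
      ∑ i, w i * Real.log (normVar φ ψ T d fstar X n (J + i) ω) := by
  -- The logarithm splits into noise, a part independent of i, which is killed by ∑ w_i = 0, and 2d
  -- log 2 · i, which the second condition on w turns into d.
  have hlog : ∀ i : Fin (ℓ + 1), Real.log (empVar φ ψ T n (fun k => X k ω) (J + i)) =
      Real.log (normVar φ ψ T d fstar X n (J + i) ω) +
        (Real.log (fstar 0) + Real.log (Kpsi ψ d) + 2 * d * (J * Real.log 2)) +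
        2 * d * Real.log 2 * (i : ℕ) := by
    intro i
    have hA : 0 < limitVar ψ d fstar (J + i) := by
      unfold limitVar; positivity
    have e : empVar φ ψ T n (fun k => X k ω) (J + i) =
        limitVar ψ d fstar (J + i) * normVar φ ψ T d fstar X n (J + i) ω := by
      rw [normVar, mul_inv_cancel_left₀ hA.ne']
      rfl
    rw [e, Real.log_mul hA.ne' (hpos i).ne', log_limitVar hf0 hK]
    push_cast
    ring
  have h1 : ∑ i : Fin (ℓ + 1), w i * (2 * d * Real.log 2 * ((i : ℕ) : ℝ)) = d := by
    calc _ = d * (2 * Real.log 2 * ∑ i : Fin (ℓ + 1), ((i : ℕ) : ℝ) * w i) := by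
          rw [Finset.mul_sum, Finset.mul_sum]
          exact Finset.sum_congr rfl fun i _ => by ring
      _ = d := by rw [hw1, mul_one]
  simp only [dHat, hlog, mul_add, Finset.sum_add_distrib, ← Finset.sum_mul] at h1 ⊢
  rw [hw0, h1]
  ring

end WaveletMemory

/-! ### Assembly of the bias, covariance and moment estimates -/

theorem mainTheorem4
    {Ω : Type*} [MeasurableSpace Ω] (P : Measure Ω) [IsProbabilityMeasure P]
    (φ ψ : ℝ → ℝ) (α : ℝ) (M : ℕ) (hM : 1 ≤ M)
    (hW : WaveletMemory.WaveletAssumptions φ ψ α M)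
    (T : ℕ) (hT : 1 ≤ T)
    (hφ : Function.support φ ⊆ Set.Ioo (-(T : ℝ)) 0)
    (hψ : Function.support ψ ⊆ Set.Ioo 0 (T : ℝ))
    (β L : ℝ) (hβ : β ∈ Set.Ioc (0 : ℝ) 2) (hL : 0 < L)
    (d : ℝ) (hd : d ∈ Set.Ioc ((1 + β) / 2 - α) (M : ℝ))
    (fstar : ℝ → ℝ) (hf : fstar ∈ WaveletMemory.smoothClass β L)
    (X : ℤ → Ω → ℝ) (hGauss : IsGaussianProcess X P)
    (hX : WaveletMemory.HasMemoryParameter P X d fstar)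
    (hcentered : ∀ K : ℕ, d - 1 / 2 < (K : ℝ) → ∀ k : ℤ, P[WaveletMemory.diff^[K] X k] = 0)
    (ℓ : ℕ) (hℓ : 1 ≤ ℓ) (w : Fin (ℓ + 1) → ℝ)
    (hw0 : ∑ i, w i = 0)
    (hw1 : 2 * Real.log 2 * ∑ i : Fin (ℓ + 1), ((i : ℕ) : ℝ) * w i = 1)
    (J₀ : ℕ → ℕ)
    (hJ : Tendsto
      (fun n : ℕ => (n : ℝ) * (2 : ℝ) ^ (-((J₀ n : ℝ) * (1 + 2 * β))) +
        (n : ℝ)⁻¹ * (2 : ℝ) ^ (J₀ n : ℝ)) atTop (𝓝 0)) :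
    (∀ᶠ n : ℕ in atTop, Integrable
      (fun ω => (WaveletMemory.dHat φ ψ T n w (J₀ n) (fun k => X k ω) - d) ^ 2) P) ∧
    Tendsto
      (fun n : ℕ => (n : ℝ) * (2 : ℝ) ^ (-(J₀ n : ℝ)) *
        ∫ ω, (WaveletMemory.dHat φ ψ T n w (J₀ n) (fun k => X k ω) - d) ^ 2 ∂P)
      atTop (𝓝 (w ⬝ᵥ (WaveletMemory.asympVar ψ d ℓ *ᵥ w))) := by
  open WaveletMemory in
  have hf0 : 0 < fstar 0 := by
    obtain ⟨c, hc, hev⟩ := hX.bounded_away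
    exact hc.trans_le hev.self_of_nhds
  have hdα : 1 < 2 * d + 2 * α := by linarith [hd.1, hβ.1]
  have hK := Kpsi_pos hW hψ hT hd.2 hdα
  have hG : IsGaussianProcess (coeffProcess φ ψ X) P :=
    isGaussianProcess_waveletCoeff hW hφ hψ hGauss
  have h0 : ∀ p, P[coeffProcess φ ψ X p] = 0 := fun p =>
    integral_waveletCoeff hW hφ hψ hX hd.2 (hcentered M (by linarith [hd.2])) p.1 p.2
  obtain ⟨hJ1, hr, hr2⟩ := scale_growth hβ.1 hJ
  set r : ℕ → ℝ := fun n => (n : ℝ) * (2 : ℝ) ^ (-(J₀ n : ℝ)) with hrdef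
  have hJi : ∀ i : ℕ, Tendsto (fun n => J₀ n + i) atTop atTop := fun i =>
    tendsto_atTop_mono (fun n => Nat.le_add_right (J₀ n) i) hJ1
  have hdiv : ∀ i : ℕ, Tendsto (fun n => (numCoeff T n (J₀ n + i) : ℝ) / r n) atTop
      (𝓝 ((2 : ℝ) ^ i)⁻¹) := fun i => tendsto_numCoeff_div i hr
  have hmtop : ∀ i : ℕ, Tendsto (fun n => (numCoeff T n (J₀ n + i) : ℝ)) atTop atTop := by
    intro i
    refine ((hr.atTop_mul_pos (by positivity) (hdiv i))).congr' ?_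
    filter_upwards [hr.eventually_gt_atTop 0] with n hn
    rw [mul_div_cancel₀ _ hn.ne']
  have hrm : ∀ i : ℕ, Tendsto (fun n => r n * (numCoeff T n (J₀ n + i) : ℝ)⁻¹) atTop
      (𝓝 ((2 : ℝ) ^ i)) := by
    intro i
    have := (hdiv i).inv₀ (by positivity)
    rw [inv_inv] at this
    refine this.congr fun n => ?_
    rw [inv_div, div_eq_mul_inv]
  have havg : ∀ a u : ℕ, Tendsto (fun n => (numCoeff T n (J₀ n + a + u) : ℝ)⁻¹ *
      ∑ k ∈ Finset.range (numCoeff T n (J₀ n + a + u)),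
        ∑ l ∈ Finset.range (numCoeff T n (J₀ n + a)),
        (cov[coeffProcess φ ψ X (J₀ n + a + u, (k : ℤ)),
          coeffProcess φ ψ X (J₀ n + a, (l : ℤ)); P] /
          (fstar 0 * ((2 : ℝ) ^ (J₀ n + a + u)) ^ (2 * d))) ^ 2) atTop
      (𝓝 (2 * Real.pi * ∫ x in Set.Ioo (-Real.pi) Real.pi, ‖DInf ψ u d x‖ ^ 2)) := by
    intro a u
    refine tendsto_average_covariance_sq hW hM hφ hψ hβ hL hd hf hf0 hX u (hJi a) ?_
      fun n => two_pow_mul_numCoeff_le hT n (J₀ n + a) u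
    simpa only [add_assoc] using hmtop (a + u)
  obtain ⟨C, hC, hvar⟩ := exists_abs_variance_div_sub_le hW hM hφ hψ hβ hL hd hf hf0 hX
  have hvar' : ∀ (j : ℕ) (k : ℤ), |Var[coeffProcess φ ψ X (j, k); P] /
      (fstar 0 * ((2 : ℝ) ^ j) ^ (2 * d)) - Kpsi ψ d| ≤ C * ((2 : ℝ) ^ j) ^ (-β) := by
    intro j k
    rw [← covariance_self (hG.aemeasurable _)]
    exact hvar j k
  have hcov : ∀ i j : Fin (ℓ + 1), Tendsto (fun n => r n *
      cov[normVar φ ψ T d fstar X n (J₀ n + i), normVar φ ψ T d fstar X n (J₀ n + j); P]) atTop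
      (𝓝 (asympVar ψ d ℓ i j)) := by
    -- With i = j + u, the factor r/m at scale j tends to 2^j, the power 2^{min(i,j)} of V. The 4π
    -- is 2 from the covariance of squares times 2π from Parseval. Symmetry covers i < j.
    have key : ∀ i j : Fin (ℓ + 1), j ≤ i → Tendsto (fun n => r n *
        cov[normVar φ ψ T d fstar X n (J₀ n + i), normVar φ ψ T d fstar X n (J₀ n + j); P])
        atTop (𝓝 (asympVar ψ d ℓ i j)) := by
      intro i j hij
      obtain ⟨u, hu⟩ := Nat.exists_eq_add_of_le (show (j : ℕ) ≤ i from hij)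
      rw [asympVar_apply_add ψ d hu]
      refine (((hrm j).const_mul (2 * ((2 : ℝ) ^ u) ^ (2 * d) / Kpsi ψ d ^ 2)).mul
        (havg j u)).congr fun n => ?_
      rw [hu, ← add_assoc, covariance_normVar hG h0 hf0]
      ring
    intro i j
    rcases le_total j i with h | h
    · exact key i j h
    · rw [asympVar_comm]
      simpa only [covariance_comm] using key j i h
  have hmean : ∀ i : Fin (ℓ + 1), Tendsto (fun n => r n *
      (P[normVar φ ψ T d fstar X n (J₀ n + i)] - 1) ^ 2) atTop (𝓝 0) := by
    intro i
    -- The squared relative bias is O(2^{-2βJ₀}), and r 2^{-2βJ₀} → 0 is the undersmoothing half of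
    -- the growth condition.
    have hlim := hr2.const_mul (((Kpsi ψ d)⁻¹ * C) ^ 2)
    rw [mul_zero] at hlim
    refine squeeze_zero' (Eventually.of_forall fun n => by positivity) ?_ hlim
    filter_upwards [(hmtop i).eventually_gt_atTop 0] with n hn
    have h1 := abs_integral_normVar_sub_one_le hG h0 hf0 hK (by exact_mod_cast hn)
      (hvar' (J₀ n + i))
    have h2 : ((2 : ℝ) ^ (J₀ n + i)) ^ (-β) ≤ ((2 : ℝ) ^ J₀ n) ^ (-β) :=
      Real.rpow_le_rpow_of_nonpos (by positivity)
        (pow_le_pow_right₀ (by norm_num) (Nat.le_add_right _ _)) (by linarith [hβ.1])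
    rw [← sq_abs]
    calc _ ≤ r n * ((Kpsi ψ d)⁻¹ * (C * ((2 : ℝ) ^ J₀ n) ^ (-β))) ^ 2 := by
          have : 0 ≤ r n := by positivity
          have := inv_pos.2 hK
          gcongr
          exact h1.trans (by gcongr)
      _ = _ := by ring
  -- D is the limiting average of squared covariances within one scale. Eventually that average is
  -- below D + 1 and r/m is below 2^ℓ + 1, whence C1; C2 is the negative-moment constant. The single
  -- constant C1 + 2 C2 serves both bounds.
  set D := 2 * Real.pi * ∫ x in Set.Ioo (-Real.pi) Real.pi, ‖DInf ψ 0 d x‖ ^ 2 with hD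
  have hD0 : 0 ≤ D := mul_nonneg (by positivity) (integral_nonneg fun x => by positivity)
  set C1 := 60 * (Kpsi ψ d ^ 4)⁻¹ * (2 ^ ℓ + 1) ^ 2 * (D + 1) ^ 2 with hC1
  set C2 := 1 + (√Real.pi)⁻¹ * ∫ x in Set.Ioc (-1 : ℝ) 1, |x| ^ (-(1 / 2) : ℝ) with hC2
  have hC10 : 0 ≤ C1 := by positivity
  have hC20 : 0 ≤ C2 := by
    have : 0 ≤ ∫ x in Set.Ioc (-1 : ℝ) 1, |x| ^ (-(1 / 2) : ℝ) :=
      integral_nonneg fun x => by positivity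
    positivity
  have h4 : ∀ i : Fin (ℓ + 1), ∀ᶠ n in atTop,
      ∫ ω, (normVar φ ψ T d fstar X n (J₀ n + i) ω -
        P[normVar φ ψ T d fstar X n (J₀ n + i)]) ^ 4 ∂P ≤ (C1 + 2 * C2) / r n ^ 2 := by
    intro i
    have hi : (2 : ℝ) ^ (i : ℕ) < 2 ^ ℓ + 1 := by
      have : (2 : ℝ) ^ (i : ℕ) ≤ 2 ^ ℓ :=
        pow_le_pow_right₀ (by norm_num) (Nat.lt_succ_iff.1 i.2)
      linarith
    filter_upwards [(havg i 0).eventually (gt_mem_nhds (lt_add_one D)),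
      (hrm i).eventually (gt_mem_nhds hi), hr.eventually_gt_atTop 0] with n hn1 hn2 hn3
    refine (integral_normVar_sub_pow_four_le hG h0 n (J₀ n + i)).trans ?_
    simp only [add_zero] at hn1
    rw [le_div_iff₀ (by positivity)]
    set s := (numCoeff T n (J₀ n + i) : ℝ)⁻¹ * ∑ k ∈ Finset.range (numCoeff T n (J₀ n + i)),
        ∑ l ∈ Finset.range (numCoeff T n (J₀ n + i)),
        (cov[coeffProcess φ ψ X (J₀ n + i, (k : ℤ)),
          coeffProcess φ ψ X (J₀ n + i, (l : ℤ)); P] /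
          (fstar 0 * ((2 : ℝ) ^ (J₀ n + i)) ^ (2 * d))) ^ 2
    have hs : 0 ≤ s := by positivity
    calc 60 * (Kpsi ψ d ^ 4)⁻¹ * ((numCoeff T n (J₀ n + i) : ℝ)⁻¹) ^ 2 * s ^ 2 * r n ^ 2
        = 60 * (Kpsi ψ d ^ 4)⁻¹ * (r n * (numCoeff T n (J₀ n + i) : ℝ)⁻¹) ^ 2 * s ^ 2 := by ring
      _ ≤ C1 := by
          rw [hC1]
          gcongr
      _ ≤ C1 + 2 * C2 := by linarith
  have hnegpos : ∀ i : Fin (ℓ + 1), ∀ᶠ n in atTop,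
      (∀ᵐ ω ∂P, 0 < normVar φ ψ T d fstar X n (J₀ n + i) ω) ∧
      Integrable (fun ω => normVar φ ψ T d fstar X n (J₀ n + i) ω ^ (-(1 / 4) : ℝ)) P ∧
      ∫ ω, normVar φ ψ T d fstar X n (J₀ n + i) ω ^ (-(1 / 4) : ℝ) ∂P ≤
        (C1 + 2 * C2) * √√(r n) := by
    intro i
    have hδ : Tendsto (fun n => C * ((2 : ℝ) ^ (J₀ n + i)) ^ (-β)) atTop (𝓝 0) := by
      simpa using (tendsto_two_pow_rpow_neg (hJi i) hβ.1).const_mul C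
    -- Any bound above 1 would do; 16 has fourth root 2, which keeps the double square root
    -- explicit.
    have hi : ((2 : ℝ) ^ (i : ℕ))⁻¹ < 16 :=
      (inv_le_one_of_one_le₀ (one_le_pow₀ (by norm_num))).trans_lt (by norm_num)
    filter_upwards [hδ.eventually (gt_mem_nhds (half_pos hK)),
      (hdiv i).eventually (gt_mem_nhds hi), hr.eventually_gt_atTop 0,
      (hmtop i).eventually_gt_atTop 0] with n hn1 hn2 hn3 hn4
    have hA0 : 0 < fstar 0 * ((2 : ℝ) ^ (J₀ n + i)) ^ (2 * d) := by positivity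
    have hv : limitVar ψ d fstar (J₀ n + i) / 2 ≤
        Var[coeffProcess φ ψ X (J₀ n + i, ((0 : ℕ) : ℤ)); P] := by
      have h1 := (hvar' (J₀ n + i) ((0 : ℕ) : ℤ)).trans hn1.le
      have h2 := (abs_le.1 h1).1
      have h3 : Kpsi ψ d / 2 ≤ Var[coeffProcess φ ψ X (J₀ n + i, ((0 : ℕ) : ℤ)); P] /
        (fstar 0 * ((2 : ℝ) ^ (J₀ n + i)) ^ (2 * d)) := by linarith
      rw [le_div_iff₀ hA0] at h3
      rw [limitVar]
      linarith
    have hlv : 0 < limitVar ψ d fstar (J₀ n + i) := mul_pos hA0 hK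
    obtain ⟨p1, p2, p3⟩ := integral_scaled_average_rpow_le hG h0
      (fun k => (J₀ n + (i : ℕ), (k : ℤ))) (by exact_mod_cast hn4) hlv hv
    refine ⟨p1, p2, p3.trans ?_⟩
    have hm : (numCoeff T n (J₀ n + i) : ℝ) ≤ 4 ^ 2 * r n := by
      rw [div_lt_iff₀ hn3] at hn2
      linarith
    have hsq : √√(numCoeff T n (J₀ n + i) : ℝ) ≤ 2 * √√(r n) := by
      calc √√(numCoeff T n (J₀ n + i) : ℝ) ≤ √√(4 ^ 2 * r n) := by gcongr
        _ = 2 * √√(r n) := by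
          rw [Real.sqrt_mul (by norm_num), Real.sqrt_sq (by norm_num),
            show (4 : ℝ) = 2 ^ 2 by norm_num, Real.sqrt_mul (by norm_num),
            Real.sqrt_sq (by norm_num)]
    calc _ ≤ C2 * (2 * √√(r n)) := by gcongr
      _ ≤ _ := by nlinarith [Real.sqrt_nonneg √(r n)]
  obtain ⟨hint, hlim⟩ := tendsto_integral_sq_sum_log w
    (fun n (i : Fin (ℓ + 1)) => normVar φ ψ T d fstar X n (J₀ n + i)) r hr
    (fun n i ω => by
      have : 0 ≤ limitVar ψ d fstar (J₀ n + i) := by unfold limitVar; positivity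
      unfold normVar
      positivity)
    (fun n i => memLp_normVar hG n _) hmean (asympVar ψ d ℓ) hcov h4
    (fun i => (hnegpos i).mono fun n hn => hn.2)
  -- The logarithms can be split only where every empirical variance is positive, which holds almost
  -- surely once all scales have coefficients and nondegenerate variances.
  have hae : ∀ᶠ n in atTop, (fun ω => (∑ i : Fin (ℓ + 1),
      w i * Real.log (normVar φ ψ T d fstar X n (J₀ n + i) ω)) ^ 2) =ᵐ[P]
      fun ω => (dHat φ ψ T n w (J₀ n) (fun k => X k ω) - d) ^ 2 := by
    filter_upwards [eventually_all.2 hnegpos] with n hn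
    filter_upwards [ae_all_iff.2 fun i => (hn i).1] with ω hω
    rw [dHat_sub_eq hw0 hw1 hf0 hK hω]
  refine ⟨?_, hlim.congr' ?_⟩
  · filter_upwards [hint, hae] with n h1 h2
    exact h1.congr h2
  · filter_upwards [hae] with n hn
    rw [integral_congr_ae hn]
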